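/- An oracle is a set $A\subseteq\{0,1\}^*$ of binary words. It is *low for speed* if, for every computable language $L$, every deterministic multitape Turing machine $M$ with oracle $A$ that decides $L$, and every $f:\{0,1\}^*\to\mathbb{N}$ such that $M$ runs in at most $f(x)$ steps on each input $x$, there are a Turing machine $M'$ without oracle and a polynomial $p$ with coefficients in $\mathbb{N}$ such that $M'$ decides $L$ and runs in at most $p(f(x))$ steps on each input $x$. (An oracle machine has a query tape; asking whether the word written on the query tape belongs to $A$ takes one step.) Identify subsets of $\mathbb{N}$ with subsets of $\{0,1\}^*$ through the length-lexicographic enumeration of $\{0,1\}^*$, and let $\mathbf{LFS}$ be the set of Turing degrees that contain a low for speed set. For degrees $\mathbf{a},\mathbf{b}$ let $\mathbf{a}\vee\mathbf{b}$ be their join, that is, their least upper bound: the degree of $X\oplus Y=\{2n : n\in X\}\cup\{2n+1 : n\in Y\}$ for any $X\in\mathbf{a}$ and $Y\in\mathbf{b}$. **Theorem.** There are $\mathbf{a},\mathbf{b}\in\mathbf{LFS}$ such that $\mathbf{a}\vee\mathbf{b}\notin\mathbf{LFS}$. -/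

import Mathlib

/-! ### Sets of natural numbers, Turing reducibility, degrees and joins -/

open Classical in
/-- The characteristic function of a set of natural numbers, as a (total) partial function. -/
noncomputable def charFun (X : Set ℕ) : ℕ →. ℕ :=
  fun n => Part.some (if n ∈ X then 1 else 0)

/-- Turing reducibility `X ≤_T Y` between sets of natural numbers. -/
def SetReducible (X Y : Set ℕ) : Prop :=
  TuringReducible (charFun X) (charFun Y)

/-- The join `X ⊕ Y`, with characteristic sequence `X(0) Y(0) X(1) Y(1) …`. -/
def setJoin (X Y : Set ℕ) : Set ℕ :=
  {n | (n % 2 = 0 ∧ n / 2 ∈ X) ∨ (n % 2 = 1 ∧ n / 2 ∈ Y)}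

instance SetReducible.isPreorder : IsPreorder (Set ℕ) SetReducible where
  refl X := TuringReducible.refl (charFun X)
  trans _ _ _ h₁ h₂ := TuringReducible.trans h₁ h₂

theorem SetReducible.join_left (X Y : Set ℕ) : SetReducible X (setJoin X Y) := by
  have hd : Nat.Primrec fun n : ℕ => 2 * n :=
    Primrec.nat_iff.1 (Primrec.nat_mul.comp (Primrec.const 2) Primrec.id)
  have h := Nat.RecursiveIn.comp
    (Nat.RecursiveIn.oracle (O := {charFun (setJoin X Y)}) _ (Set.mem_singleton _))
    (Nat.Primrec.recursiveIn hd)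
  refine RecursiveIn.iff_nat.2 (Nat.RecursiveIn.of_eq h fun n => ?_)
  refine (Part.bind_some (2 * n) (charFun (setJoin X Y))).trans ?_
  by_cases hn : n ∈ X <;> simp [charFun, setJoin, hn]

theorem SetReducible.join_right (X Y : Set ℕ) : SetReducible Y (setJoin X Y) := by
  have hd : Nat.Primrec fun n : ℕ => 2 * n + 1 :=
    Primrec.nat_iff.1 (Primrec.succ.comp (Primrec.nat_mul.comp (Primrec.const 2) Primrec.id))
  have h := Nat.RecursiveIn.comp
    (Nat.RecursiveIn.oracle (O := {charFun (setJoin X Y)}) _ (Set.mem_singleton _))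
    (Nat.Primrec.recursiveIn hd)
  refine RecursiveIn.iff_nat.2 (Nat.RecursiveIn.of_eq h fun n => ?_)
  refine (Part.bind_some (2 * n + 1) (charFun (setJoin X Y))).trans ?_
  have h₁ : (2 * n + 1) % 2 = 1 := by omega
  have h₂ : (2 * n + 1) / 2 = n := by omega
  by_cases hn : n ∈ Y <;> simp [charFun, setJoin, hn, h₁, h₂]

theorem SetReducible.join_le {X Y Z : Set ℕ} (hX : SetReducible X Z) (hY : SetReducible Y Z) :
    SetReducible (setJoin X Y) Z := by
  have hX' : Nat.RecursiveIn {charFun Z} (charFun X) := RecursiveIn.iff_nat.1 hX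
  have hY' : Nat.RecursiveIn {charFun Z} (charFun Y) := RecursiveIn.iff_nat.1 hY
  have hdiv : Nat.Primrec fun n : ℕ => n / 2 :=
    Primrec.nat_iff.1 (Primrec.nat_div.comp Primrec.id (Primrec.const 2))
  have hid : Nat.Primrec fun n : ℕ => n := Primrec.nat_iff.1 Primrec.id
  have hsel : Nat.Primrec fun m : ℕ => if m.unpair.1 % 2 = 0 then m.unpair.2.unpair.1
      else m.unpair.2.unpair.2 := by
    refine Primrec.nat_iff.1 (Primrec.ite ?_ ?_ ?_)
    · exact Primrec.eq.comp (Primrec.nat_mod.comp (Primrec.fst.comp Primrec.unpair)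
        (Primrec.const 2)) (Primrec.const 0)
    · exact Primrec.fst.comp (Primrec.unpair.comp (Primrec.snd.comp Primrec.unpair))
    · exact Primrec.snd.comp (Primrec.unpair.comp (Primrec.snd.comp Primrec.unpair))
  have h := Nat.RecursiveIn.comp (Nat.Primrec.recursiveIn (O := {charFun Z}) hsel)
    (Nat.RecursiveIn.pair (Nat.Primrec.recursiveIn hid)
      (Nat.RecursiveIn.pair (Nat.RecursiveIn.comp hX' (Nat.Primrec.recursiveIn hdiv))
        (Nat.RecursiveIn.comp hY' (Nat.Primrec.recursiveIn hdiv))))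
  refine RecursiveIn.iff_nat.2 (Nat.RecursiveIn.of_eq h fun n => ?_)
  have hc (U : Set ℕ) : ((Part.some (n / 2) : Part ℕ) >>= charFun U) = charFun U (n / 2) :=
    Part.bind_some _ _
  rcases Nat.mod_two_eq_zero_or_one n with hn | hn <;>
    by_cases h₁ : n / 2 ∈ X <;> by_cases h₂ : n / 2 ∈ Y <;>
      simp [hc, charFun, setJoin, hn, h₁, h₂, Seq.seq]

/-- The Turing degrees (of sets of natural numbers). -/
def SetDegree : Type :=
  Antisymmetrization (Set ℕ) SetReducible

/-- The Turing degree of a set of natural numbers. -/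
def degree (X : Set ℕ) : SetDegree :=
  toAntisymmetrization SetReducible X

/-- The degrees, ordered by Turing reducibility of representatives, form an upper semilattice;
the join of the degrees of `X` and `Y` is the degree of `X ⊕ Y`. -/
instance SetDegree.semilatticeSup : SemilatticeSup SetDegree where
  le a b := Quotient.liftOn₂ a b SetReducible fun _ _ _ _ h₁ h₂ =>
    propext ⟨fun h => TuringReducible.trans h₁.2 (TuringReducible.trans h h₂.1),
      fun h => TuringReducible.trans h₁.1 (TuringReducible.trans h h₂.2)⟩
  le_refl a := Quotient.inductionOn a fun X => TuringReducible.refl (charFun X)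
  le_trans a b c := Quotient.inductionOn₃ a b c fun _ _ _ h₁ h₂ => TuringReducible.trans h₁ h₂
  le_antisymm a b := Quotient.inductionOn₂ a b fun _ _ h₁ h₂ => Quotient.sound ⟨h₁, h₂⟩
  sup a b := Quotient.liftOn₂ a b (fun X Y => degree (setJoin X Y)) fun _ _ _ _ h₁ h₂ =>
    Quotient.sound
      ⟨SetReducible.join_le (TuringReducible.trans h₁.1 (SetReducible.join_left _ _))
          (TuringReducible.trans h₂.1 (SetReducible.join_right _ _)),
        SetReducible.join_le (TuringReducible.trans h₁.2 (SetReducible.join_left _ _))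
          (TuringReducible.trans h₂.2 (SetReducible.join_right _ _))⟩
  le_sup_left a b := Quotient.inductionOn₂ a b fun X Y => SetReducible.join_left X Y
  le_sup_right a b := Quotient.inductionOn₂ a b fun X Y => SetReducible.join_right X Y
  sup_le a b c := Quotient.inductionOn₃ a b c fun _ _ _ h₁ h₂ => SetReducible.join_le h₁ h₂

theorem degree_le_degree (X Y : Set ℕ) : degree X ≤ degree Y ↔ SetReducible X Y := Iff.rfl

theorem degree_sup_degree (X Y : Set ℕ) : degree X ⊔ degree Y = degree (setJoin X Y) := rfl

/-! ### Deterministic multitape oracle Turing machines -/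

/-- The tapes of a machine: an input tape, a query tape, and work tapes indexed by `W`. -/
inductive TapeName (W : Type) : Type
  | input : TapeName W
  | query : TapeName W
  | work : W → TapeName W

/-- Tape symbols: the blank `none`, the bits `some (Sum.inl b)`, and auxiliary symbols
`some (Sum.inr g)`. -/
abbrev TapeSymbol (Γ : Type) : Type := Option (Bool ⊕ Γ)

/-- What a machine does in a given state.
* `halt b`: the machine has stopped, with answer `b`.
* `query yes no`: enter state `yes` if the word on the query tape is in the oracle, and
  state `no` otherwise; the tapes are unchanged.
* `act δ`: depending on the scanned symbols, choose the next state and, for each tape, the symbol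
  to write and the direction in which to move the head (`none`: do not move). -/
inductive Instruction (Q W Γ : Type) : Type
  | halt : Bool → Instruction Q W Γ
  | query : Q → Q → Instruction Q W Γ
  | act : ((TapeName W → TapeSymbol Γ) →
      Q × (TapeName W → TapeSymbol Γ × Option Turing.Dir)) → Instruction Q W Γ

/-- A deterministic oracle Turing machine with finitely many two-way infinite tapes. -/
structure OracleTM where
  /-- The states. -/
  Q : Type
  /-- The names of the work tapes. -/
  W : Type
  /-- The auxiliary tape symbols. -/
  Γ : Type
  finite_Q : Finite Q
  finite_W : Finite W
  finite_Γ : Finite Γ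
  /-- The initial state. -/
  start : Q
  /-- The program. -/
  prog : Q → Instruction Q W Γ

/-- `HoldsWord T w`: the maximal block of bits on `T` that starts at the head and extends to the
right is `w`. -/
def HoldsWord {Γ : Type} (T : Turing.Tape (TapeSymbol Γ)) (w : List Bool) : Prop :=
  (∀ i : Fin w.length, T.nth (i : ℕ) = some (Sum.inl (w.get i))) ∧
    ∀ b : Bool, T.nth (w.length : ℕ) ≠ some (Sum.inl b)

namespace OracleTM

/-- A configuration: the current state and the contents of all tapes (with head positions). -/
structure Cfg (M : OracleTM) where
  state : M.Q
  tape : TapeName M.W → Turing.Tape (TapeSymbol M.Γ)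

/-- The initial configuration on input `x`: the input tape holds `x`, with the head on its first
symbol; all other tapes are blank. -/
def init (M : OracleTM) (x : List Bool) : M.Cfg where
  state := M.start
  tape
    | .input => Turing.Tape.mk₁ (x.map fun b => some (Sum.inl b))
    | _ => Turing.Tape.mk₁ []

open Classical in
/-- One step of `M` with oracle `A`. Halted configurations do not change. -/
noncomputable def step (M : OracleTM) (A : Set (List Bool)) (c : M.Cfg) : M.Cfg :=
  match M.prog c.state with
  | .halt _ => c
  | .query yes no =>
      { state := if ∃ w ∈ A, HoldsWord (c.tape .query) w then yes else no
        tape := c.tape }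
  | .act δ =>
      let r := δ fun i => (c.tape i).head
      { state := r.1
        tape := fun i =>
          let T := (c.tape i).write (r.2 i).1
          match (r.2 i).2 with
          | none => T
          | some d => T.move d }

/-- With oracle `A` and on input `x`, the machine halts with answer `b` after at most `t` steps. -/
def AnswersWithin (M : OracleTM) (A : Set (List Bool)) (x : List Bool) (t : ℕ) (b : Bool) : Prop :=
  M.prog ((M.step A)^[t] (M.init x)).state = .halt b

/-- With oracle `A`, the machine decides `L`, and its running time on each input `x` is at most
`f x`. -/
def DecidesInTime (M : OracleTM) (A L : Set (List Bool)) (f : List Bool → ℕ) : Prop :=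
  ∀ x, ∃ b : Bool, M.AnswersWithin A x (f x) b ∧ (b = true ↔ x ∈ L)

/-- The machine is an ordinary Turing machine: it has no query instruction. -/
def OracleFree (M : OracleTM) : Prop :=
  ∀ q yes no, M.prog q ≠ .query yes no

end OracleTM

/-! ### Lowness for speed -/

/-- A language `A` is low for speed: if `L` is a computable language that some machine decides
with oracle `A` in time `f`, then some machine without oracle decides `L` in time `p ∘ f` for some
polynomial `p`. -/
def LowForSpeed (A : Set (List Bool)) : Prop :=
  ∀ L : Set (List Bool), (ComputablePred fun x => x ∈ L) →
    ∀ (M : OracleTM) (f : List Bool → ℕ), M.DecidesInTime A L f →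
      ∃ (M' : OracleTM) (p : Polynomial ℕ),
        M'.OracleFree ∧ M'.DecidesInTime ∅ L fun x => p.eval (f x)

/-- The position of a binary word in the length-lexicographic order
`ε, 0, 1, 00, 01, 10, 11, 000, …`, counted from `0`. -/
def lexNum (w : List Bool) : ℕ :=
  w.foldl (fun n b => 2 * n + 1 + b.toNat) 0

/-- The language identified with a set of natural numbers through the length-lexicographic
order. -/
def toLanguage (X : Set ℕ) : Set (List Bool) :=
  {w | lexNum w ∈ X}

/-- The set of Turing degrees that contain a low for speed set. -/
def LFSDegrees : Set SetDegree :=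
  {a | ∃ X : Set ℕ, degree X = a ∧ LowForSpeed (toLanguage X)}

/-! The low for speed sets are generic sets coded very sparsely. `sparseLang X` can contain only the
words 1^(2^(j+1)-2), one for each j, so a computation of t steps depends on about log t bits of X,
and these bits have only polynomially many (in t) possible values. Call X generic if, for every
machine M and every computable language L, a finite part of X decides membership in the open set
`badSets M L` of those oracles for which M gives a wrong answer about L. If M with oracle
`sparseLang X` decides L, then X is outside this set, so some finite part of X already guarantees
that M never errs, whatever the rest of the oracle is. A machine without oracle can keep this finite
part in its program and try all continuations in turn, with growing time bounds: the first answer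
that appears is right, and the true continuation has its turn after polynomially many rounds. This
is `lowForSpeed_sparseLang`, carried by the simulating machine of `simMachine_answersWithin`.

Two such sets X and Y are built together by finite extensions. A genericity requirement for one of
them is met by extending both in the same way, which creates no new difference; differences are
inserted only on purpose, as far apart as desired (`exists_generic_pair`). Each set is generic, yet
the set of places where they differ is infinite with prescribed gaps. With gaps that exceed the
halting times of all programs of smaller number, the join of the two sets finds two successive
differences beyond e, hence a bound for the halting time of program e, hence the halting time itself
(`recursiveIn_haltTime_of_sparse`).

Finally, no set Z that computes the halting times is low for speed
(`not_lowForSpeed_of_recursiveIn`). Membership of an input with e leading ones in the computable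
language `haltLang` is settled by comparing its length with e plus the halting time of program e.
With oracle Z this takes a time that depends on e alone, however long the input is. A machine
without oracle that is polynomially slower would still have a time bound depending on e alone; it
could not see the end of a long input, and its answer would solve the halting problem. This applies
to every set in the join degree, since all of them compute the join.

Most of the work is machine construction: structured multitape programs with exact step counts
(`Exec.sound`), counter programs for functions recursive in an oracle (`exists_computes`,
`CExec.compile`), and the primitive recursiveness of computations without oracle
(`exists_primrec_answers`). -/

namespace SpeedLow

open Turing

/-! ### Tapes as functions on the integers -/

section Tape

variable {G : Type} [Inhabited G]

theorem tape_ext {S T : Tape G} (h : ∀ i, S.nth i = T.nth i) : S = T := by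
  obtain ⟨a, l, r⟩ := S
  obtain ⟨a', l', r'⟩ := T
  have h0 : a = a' := h 0
  have hl : l = l' := ListBlank.ext fun n => h (Int.negSucc n)
  have hr : r = r' := ListBlank.ext fun n => h ((n + 1 : ℕ) : ℤ)
  subst h0 hl hr
  rfl

theorem nth_shiftR (n : ℕ) (T : Tape G) (i : ℤ) :
    ((Tape.move Dir.right)^[n] T).nth i = T.nth (i + n) := by
  induction n generalizing i with
  | zero => simp
  | succ n ih =>
    rw [Function.iterate_succ_apply', Tape.move_right_nth, ih]
    congr 1
    push_cast
    ring

theorem nth_shiftL (n : ℕ) (T : Tape G) (i : ℤ) :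
    ((Tape.move Dir.left)^[n] T).nth i = T.nth (i - n) := by
  induction n generalizing i with
  | zero => simp
  | succ n ih =>
    rw [Function.iterate_succ_apply', Tape.move_left_nth, ih]
    congr 1
    push_cast
    ring

theorem head_shiftR (n : ℕ) (T : Tape G) :
    ((Tape.move Dir.right)^[n] T).head = T.nth n := by
  rw [← Tape.nth_zero, nth_shiftR, zero_add]

theorem shiftL_shiftR (n : ℕ) (T : Tape G) :
    (Tape.move Dir.left)^[n] ((Tape.move Dir.right)^[n] T) = T :=
  tape_ext fun i => by rw [nth_shiftL, nth_shiftR, sub_add_cancel]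

theorem nth_mk₁_nat (l : List G) (n : ℕ) : (Tape.mk₁ l).nth (n : ℤ) = l.getI n := by
  rw [Tape.mk₁, Tape.mk₂, Tape.mk'_nth_nat, ListBlank.nth_mk]

theorem nth_mk₁_negSucc (l : List G) (n : ℕ) : (Tape.mk₁ l).nth (Int.negSucc n) = default := by
  change (ListBlank.mk ([] : List G)).nth n = default
  rw [ListBlank.nth_mk, List.getI_nil]

/-- Perform a write and a move. -/
def actTape (T : Tape G) (a : G × Option Dir) : Tape G :=
  match a.2 with
  | none => T.write a.1
  | some d => (T.write a.1).move d

@[simp]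
theorem actTape_none (T : Tape G) (g : G) : actTape T (g, none) = T.write g := rfl

@[simp]
theorem actTape_some (T : Tape G) (g : G) (d : Dir) :
    actTape T (g, some d) = (T.write g).move d := rfl

@[simp]
theorem write_head (T : Tape G) : T.write T.head = T := T.write_self

end Tape

/-! ### Structured programs and their translation into machines -/

variable {W Γ : Type}

/-- The contents of all tapes. -/
abbrev Tapes (W Γ : Type) : Type := TapeName W → Tape (TapeSymbol Γ)

/-- The scanned symbols. -/
abbrev Heads (W Γ : Type) : Type := TapeName W → TapeSymbol Γ

/-- The scanned symbols of given tapes. -/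
def heads (T : Tapes W Γ) : Heads W Γ := fun i => (T i).head

/-- Structured programs for multitape machines. -/
inductive Prog (W Γ : Type) : Type
  | op : (Heads W Γ → TapeName W → TapeSymbol Γ × Option Dir) → Prog W Γ
  | seq : Prog W Γ → Prog W Γ → Prog W Γ
  | ite : (Heads W Γ → Bool) → Prog W Γ → Prog W Γ → Prog W Γ
  | loop : (Heads W Γ → Bool) → Prog W Γ → Prog W Γ
  | ask : Prog W Γ → Prog W Γ → Prog W Γ

/-- The program, started with tapes `T`, ends with tapes `T'` after exactly `t` steps. -/
inductive Exec (A : Set (List Bool)) : Prog W Γ → Tapes W Γ → Tapes W Γ → ℕ → Prop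
  | op (δ : Heads W Γ → TapeName W → TapeSymbol Γ × Option Dir) (T : Tapes W Γ) :
      Exec A (.op δ) T (fun i => actTape (T i) (δ (heads T) i)) 1
  | seq {P Q : Prog W Γ} {T T₁ T₂ : Tapes W Γ} {t₁ t₂ : ℕ} :
      Exec A P T T₁ t₁ → Exec A Q T₁ T₂ t₂ → Exec A (.seq P Q) T T₂ (t₁ + t₂)
  | ite_true {c : Heads W Γ → Bool} {P : Prog W Γ} (Q : Prog W Γ) {T T' : Tapes W Γ} {t : ℕ} :
      c (heads T) = true → Exec A P T T' t → Exec A (.ite c P Q) T T' (t + 1)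
  | ite_false {c : Heads W Γ → Bool} (P : Prog W Γ) {Q : Prog W Γ} {T T' : Tapes W Γ} {t : ℕ} :
      c (heads T) = false → Exec A Q T T' t → Exec A (.ite c P Q) T T' (t + 1)
  | loop_false {c : Heads W Γ → Bool} (P : Prog W Γ) {T : Tapes W Γ} :
      c (heads T) = false → Exec A (.loop c P) T T 1
  | loop_true {c : Heads W Γ → Bool} {P : Prog W Γ} {T T₁ T₂ : Tapes W Γ} {t₁ t₂ : ℕ} :
      c (heads T) = true → Exec A P T T₁ t₁ → Exec A (.loop c P) T₁ T₂ t₂ →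
        Exec A (.loop c P) T T₂ (1 + t₁ + t₂)
  | ask_true {P : Prog W Γ} (Q : Prog W Γ) {T T' : Tapes W Γ} {t : ℕ} :
      (∃ w ∈ A, HoldsWord (T .query) w) → Exec A P T T' t → Exec A (.ask P Q) T T' (t + 1)
  | ask_false (P : Prog W Γ) {Q : Prog W Γ} {T T' : Tapes W Γ} {t : ℕ} :
      (¬ ∃ w ∈ A, HoldsWord (T .query) w) → Exec A Q T T' t → Exec A (.ask P Q) T T' (t + 1)

namespace Prog

/-- The control states of a program. -/
def St : Prog W Γ → Type
  | op _ => Unit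
  | seq P Q => P.St ⊕ Q.St
  | ite _ P Q => Unit ⊕ (P.St ⊕ Q.St)
  | loop _ P => Unit ⊕ P.St
  | ask P Q => Unit ⊕ (P.St ⊕ Q.St)

theorem finite_St : ∀ P : Prog W Γ, Finite P.St
  | op _ => inferInstanceAs (Finite Unit)
  | seq P Q =>
    have := P.finite_St
    have := Q.finite_St
    inferInstanceAs (Finite (P.St ⊕ Q.St))
  | ite _ P Q =>
    have := P.finite_St
    have := Q.finite_St
    inferInstanceAs (Finite (Unit ⊕ (P.St ⊕ Q.St)))
  | loop _ P =>
    have := P.finite_St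
    inferInstanceAs (Finite (Unit ⊕ P.St))
  | ask P Q =>
    have := P.finite_St
    have := Q.finite_St
    inferInstanceAs (Finite (Unit ⊕ (P.St ⊕ Q.St)))

/-- The first state of a program. -/
def entry : (P : Prog W Γ) → P.St
  | op _ => ()
  | seq P _ => Sum.inl P.entry
  | ite _ _ _ => Sum.inl ()
  | loop _ _ => Sum.inl ()
  | ask _ _ => Sum.inl ()

/-- The instructions of a program whose states are embedded by `ι` and which continues at `e`. -/
def code {K : Type} : (P : Prog W Γ) → (P.St → K) → K → P.St → Instruction K W Γ
  | op δ, _, e, _ => .act fun h => (e, δ h)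
  | seq P Q, ι, e, s =>
    match s with
    | Sum.inl s => P.code (fun s => ι (Sum.inl s)) (ι (Sum.inr Q.entry)) s
    | Sum.inr s => Q.code (fun s => ι (Sum.inr s)) e s
  | ite c P Q, ι, e, s =>
    match s with
    | Sum.inl _ => .act fun h =>
        (if c h then ι (Sum.inr (Sum.inl P.entry)) else ι (Sum.inr (Sum.inr Q.entry)),
          fun i => (h i, none))
    | Sum.inr (Sum.inl s) => P.code (fun s => ι (Sum.inr (Sum.inl s))) e s
    | Sum.inr (Sum.inr s) => Q.code (fun s => ι (Sum.inr (Sum.inr s))) e s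
  | loop c P, ι, e, s =>
    match s with
    | Sum.inl _ => .act fun h =>
        (if c h then ι (Sum.inr P.entry) else e, fun i => (h i, none))
    | Sum.inr s => P.code (fun s => ι (Sum.inr s)) (ι (Sum.inl ())) s
  | ask P Q, ι, e, s =>
    match s with
    | Sum.inl _ => .query (ι (Sum.inr (Sum.inl P.entry))) (ι (Sum.inr (Sum.inr Q.entry)))
    | Sum.inr (Sum.inl s) => P.code (fun s => ι (Sum.inr (Sum.inl s))) e s
    | Sum.inr (Sum.inr s) => Q.code (fun s => ι (Sum.inr (Sum.inr s))) e s

/-- The program contains no query. -/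
def AskFree : Prog W Γ → Prop
  | op _ => True
  | seq P Q => P.AskFree ∧ Q.AskFree
  | ite _ P Q => P.AskFree ∧ Q.AskFree
  | loop _ P => P.AskFree
  | ask _ _ => False

theorem code_ne_query {K : Type} : ∀ {P : Prog W Γ}, P.AskFree → ∀ (ι : P.St → K) (e : K)
    (s : P.St) (yes no : K), P.code ι e s ≠ .query yes no
  | op _, _, _, _, _, _, _ => by simp [code]
  | seq P Q, h, ι, e, s, yes, no =>
    match s with
    | Sum.inl s => code_ne_query (P := P) h.1 _ _ s yes no
    | Sum.inr s => code_ne_query (P := Q) h.2 _ _ s yes no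
  | ite c P Q, h, ι, e, s, yes, no =>
    match s with
    | Sum.inl _ => by simp [code]
    | Sum.inr (Sum.inl s) => code_ne_query (P := P) h.1 _ _ s yes no
    | Sum.inr (Sum.inr s) => code_ne_query (P := Q) h.2 _ _ s yes no
  | loop c P, h, ι, e, s, yes, no =>
    match s with
    | Sum.inl _ => by simp [code]
    | Sum.inr s => code_ne_query (P := P) h _ _ s yes no
  | ask _ _, h, _, _, _, _, _ => h.elim

/-- The machine that runs a program and then answers according to the scanned symbols. -/
def machine [Finite W] [Finite Γ] (P : Prog W Γ) (out : Heads W Γ → Bool) : OracleTM where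
  Q := P.St ⊕ Option Bool
  W := W
  Γ := Γ
  finite_Q := have := P.finite_St; inferInstance
  finite_W := inferInstance
  finite_Γ := inferInstance
  start := Sum.inl P.entry
  prog
    | Sum.inl s => P.code Sum.inl (Sum.inr none) s
    | Sum.inr none => .act fun h => (Sum.inr (some (out h)), fun i => (h i, none))
    | Sum.inr (some b) => .halt b

theorem machine_oracleFree [Finite W] [Finite Γ] {P : Prog W Γ} (hP : P.AskFree)
    (out : Heads W Γ → Bool) : (P.machine out).OracleFree := by
  rintro (s | (_ | b)) yes no
  · exact code_ne_query hP _ _ s yes no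
  · simp [machine]
  · simp [machine]

end Prog

theorem step_act (M : OracleTM) (A : Set (List Bool)) (q : M.Q) (T : Tapes M.W M.Γ)
    {δ : Heads M.W M.Γ → M.Q × (TapeName M.W → TapeSymbol M.Γ × Option Dir)}
    (h : M.prog q = .act δ) :
    M.step A ⟨q, T⟩ =
      ⟨(δ (heads T)).1, fun i => actTape (T i) ((δ (heads T)).2 i)⟩ := by
  unfold OracleTM.step
  simp only [h]
  rfl

theorem step_query (M : OracleTM) (A : Set (List Bool)) (q : M.Q) (T : Tapes M.W M.Γ)
    {yes no : M.Q} (h : M.prog q = .query yes no) [Decidable (∃ w ∈ A, HoldsWord (T .query) w)] :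
    M.step A ⟨q, T⟩ = ⟨if ∃ w ∈ A, HoldsWord (T .query) w then yes else no, T⟩ := by
  unfold OracleTM.step
  simp only [h]
  congr

theorem step_halt (M : OracleTM) (A : Set (List Bool)) (c : M.Cfg)
    {b : Bool} (h : M.prog c.state = .halt b) : M.step A c = c := by
  unfold OracleTM.step
  simp only [h]

theorem iterate_step_halt (M : OracleTM) (A : Set (List Bool)) (c : M.Cfg)
    {b : Bool} (h : M.prog c.state = .halt b) (n : ℕ) : (M.step A)^[n] c = c :=
  Function.iterate_fixed (step_halt M A c h) n

theorem AnswersWithin.mono {M : OracleTM} {A : Set (List Bool)} {x : List Bool} {t t' : ℕ}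
    {b : Bool} (h : M.AnswersWithin A x t b) (ht : t ≤ t') : M.AnswersWithin A x t' b := by
  obtain ⟨k, rfl⟩ := Nat.exists_eq_add_of_le ht
  unfold OracleTM.AnswersWithin at *
  rw [add_comm, Function.iterate_add_apply, iterate_step_halt M A _ h]
  exact h

theorem AnswersWithin.unique {M : OracleTM} {A : Set (List Bool)} {x : List Bool} {t t' : ℕ}
    {b b' : Bool} (h : M.AnswersWithin A x t b) (h' : M.AnswersWithin A x t' b') : b = b' := by
  have h₁ := AnswersWithin.mono h (le_max_left t t')
  have h₂ := AnswersWithin.mono h' (le_max_right t t')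
  unfold OracleTM.AnswersWithin at h₁ h₂
  rw [h₁] at h₂
  exact Instruction.halt.inj h₂

-- Induction on the run, with the embedding `ι` and the continuation `e` left general: a subprogram
-- lives inside the states of a larger program and hands over to whatever comes next. `M.prog` is
-- prescribed only on the image of `ι`, and `ι` need not be injective.
open Classical in
theorem Exec.sound (M : OracleTM) (A : Set (List Bool)) {P : Prog M.W M.Γ}
    {T T' : Tapes M.W M.Γ} {t : ℕ} (h : Exec A P T T' t) :
    ∀ (ι : P.St → M.Q) (e : M.Q), (∀ s, M.prog (ι s) = P.code ι e s) →
      (M.step A)^[t] ⟨ι P.entry, T⟩ = ⟨e, T'⟩ := by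
  induction h with
  | op δ T =>
    intro ι e hι
    exact step_act M A _ T (hι ())
  | @seq P Q T T₁ T₂ t₁ t₂ _ _ ih₁ ih₂ =>
    intro ι e hι
    rw [add_comm, Function.iterate_add_apply]
    rw [show (Prog.seq P Q).entry = Sum.inl P.entry from rfl]
    rw [ih₁ (fun s => ι (Sum.inl s)) (ι (Sum.inr Q.entry)) fun s => hι (Sum.inl s)]
    exact ih₂ (fun s => ι (Sum.inr s)) e fun s => hι (Sum.inr s)
  | @ite_true c P Q T T' t hc _ ih =>
    intro ι e hι
    rw [Function.iterate_succ_apply, step_act M A _ T (hι (Prog.entry _))]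
    simp only [hc, if_true, actTape_none, heads, write_head]
    exact ih (fun s => ι (Sum.inr (Sum.inl s))) e fun s => hι (Sum.inr (Sum.inl s))
  | @ite_false c P Q T T' t hc _ ih =>
    intro ι e hι
    rw [Function.iterate_succ_apply, step_act M A _ T (hι (Prog.entry _))]
    simp only [hc, Bool.false_eq_true, if_false, actTape_none, heads, write_head]
    exact ih (fun s => ι (Sum.inr (Sum.inr s))) e fun s => hι (Sum.inr (Sum.inr s))
  | @loop_false c P T hc =>
    intro ι e hι
    rw [Function.iterate_one, step_act M A _ T (hι (Prog.entry _))]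
    simp only [hc, Bool.false_eq_true, if_false, actTape_none, heads, write_head]
  | @loop_true c P T T₁ T₂ t₁ t₂ hc _ _ ih₁ ih₂ =>
    intro ι e hι
    rw [show 1 + t₁ + t₂ = t₂ + t₁ + 1 by ring, Function.iterate_succ_apply,
      step_act M A _ T (hι (Prog.entry _))]
    simp only [hc, if_true, actTape_none, heads, write_head]
    rw [Function.iterate_add_apply]
    rw [ih₁ (fun s => ι (Sum.inr s)) (ι (Sum.inl ())) fun s => hι (Sum.inr s)]
    exact ih₂ ι e hι
  | @ask_true P Q T T' t hc _ ih =>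
    intro ι e hι
    rw [Function.iterate_succ_apply, step_query M A _ T (hι (Prog.entry _)), if_pos hc]
    exact ih (fun s => ι (Sum.inr (Sum.inl s))) e fun s => hι (Sum.inr (Sum.inl s))
  | @ask_false P Q T T' t hc _ ih =>
    intro ι e hι
    rw [Function.iterate_succ_apply, step_query M A _ T (hι (Prog.entry _)), if_neg hc]
    exact ih (fun s => ι (Sum.inr (Sum.inr s))) e fun s => hι (Sum.inr (Sum.inr s))

/-- The tapes at the start of a computation on input `x`. -/
def initTapes (W Γ : Type) (x : List Bool) : Tapes W Γ
  | .input => Tape.mk₁ (x.map fun b => some (Sum.inl b))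
  | _ => Tape.mk₁ []

/-- The extra step is the one that turns the scanned symbols into a halting state. -/
theorem Exec.answersWithin [Finite W] [Finite Γ] {A : Set (List Bool)} {P : Prog W Γ}
    {out : Heads W Γ → Bool} {x : List Bool} {T' : Tapes W Γ} {t t' : ℕ}
    (h : Exec A P (initTapes W Γ x) T' t) (ht : t + 1 ≤ t') :
    (P.machine out).AnswersWithin A x t' (out (heads T')) := by
  refine AnswersWithin.mono ?_ ht
  have hi : (P.machine out).init x = ⟨Sum.inl P.entry, initTapes W Γ x⟩ := by
    unfold OracleTM.init
    congr 1
    funext i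
    cases i <;> rfl
  have hs := Exec.sound (P.machine out) A h Sum.inl (Sum.inr none) fun _ => rfl
  have hs' : ((P.machine out).step A)^[t + 1] ((P.machine out).init x) =
      ⟨Sum.inr (some (out (heads T'))), fun i => T' i⟩ := by
    rw [add_comm, Function.iterate_add_apply]
    refine (congrArg _ ((congrArg _ hi).trans hs)).trans ?_
    refine (step_act (P.machine out) A (Sum.inr none) T' rfl).trans ?_
    simp only [heads]
    rfl
  unfold OracleTM.AnswersWithin
  rw [hs']
  rfl

end SpeedLow

/-! ### The length-lexicographic order, and a counter with digits at exponentially growing distances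
-/

namespace SpeedLow

/-- The successor of a word with respect to the length-lexicographic order, least significant
letter first. -/
def wordSucc : List Bool → List Bool
  | [] => [false]
  | false :: l => true :: l
  | true :: l => false :: wordSucc l

/-- The position of a word in the length-lexicographic order, least significant letter first. -/
def wordIndex : List Bool → ℕ
  | [] => 0
  | b :: l => 2 * wordIndex l + 1 + b.toNat

theorem wordIndex_wordSucc : ∀ l : List Bool, wordIndex (wordSucc l) = wordIndex l + 1
  | [] => rfl
  | false :: l => by simp [wordSucc, wordIndex]
  | true :: l => by
    simp only [wordSucc, wordIndex, wordIndex_wordSucc l, Bool.toNat_false, Bool.toNat_true]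
    ring

theorem wordIndex_injective : Function.Injective wordIndex := by
  intro l
  induction l with
  | nil =>
    intro l' h
    cases l' with
    | nil => rfl
    | cons b l' => simp only [wordIndex] at h; omega
  | cons b l ih =>
    intro l' h
    cases l' with
    | nil => simp only [wordIndex] at h; omega
    | cons b' l' =>
      simp only [wordIndex] at h
      have hb : b = b' := by
        cases b <;> cases b' <;> simp at h ⊢ <;> omega
      subst hb
      rw [ih (show wordIndex l = wordIndex l' by omega)]

theorem wordIndex_iterate_wordSucc (n : ℕ) : wordIndex (wordSucc^[n] []) = n := by
  induction n with
  | zero => rfl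
  | succ n ih => rw [Function.iterate_succ_apply', wordIndex_wordSucc, ih]

theorem iterate_wordSucc_wordIndex (l : List Bool) : wordSucc^[wordIndex l] [] = l :=
  wordIndex_injective (wordIndex_iterate_wordSucc _)

/-- `lexNum` consumes the most significant letter first, `wordIndex` the least significant one;
hence the reversal. -/
theorem lexNum_eq (w : List Bool) : lexNum w = wordIndex w.reverse := by
  induction w using List.reverseRecOn with
  | nil => rfl
  | append_singleton w b ih =>
    rw [List.reverse_append, List.reverse_singleton, List.singleton_append, wordIndex, ← ih]
    simp [lexNum, List.foldl_append]

theorem lexNum_injective : Function.Injective lexNum := fun w w' h => by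
  rw [lexNum_eq, lexNum_eq] at h
  exact List.reverse_injective (wordIndex_injective h)

theorem wordIndex_lt (l : List Bool) : wordIndex l + 1 < 2 ^ (l.length + 1) := by
  induction l with
  | nil => simp [wordIndex]
  | cons b l ih =>
    have hb : b.toNat ≤ 1 := b.toNat_le
    rw [wordIndex, List.length_cons, pow_succ]
    omega

theorem le_wordIndex (l : List Bool) : 2 ^ l.length ≤ wordIndex l + 1 := by
  induction l with
  | nil => simp [wordIndex]
  | cons b l ih =>
    rw [wordIndex, List.length_cons, pow_succ]
    omega

theorem lexNum_replicate_true (p : ℕ) : lexNum (List.replicate p true) = 2 ^ (p + 1) - 2 := by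
  rw [lexNum_eq, List.reverse_replicate]
  induction p with
  | zero => rfl
  | succ p ih =>
    rw [List.replicate_succ, wordIndex, ih, pow_succ 2 (p + 1)]
    have : 2 ≤ 2 ^ (p + 1) := by rw [pow_succ]; have := Nat.one_le_two_pow (n := p); omega
    simp
    omega

/-- The value of a binary number, least significant digit first. -/
def binVal : List Bool → ℕ
  | [] => 0
  | b :: l => b.toNat + 2 * binVal l

/-- The digits of a counter, written at distances `2 ^ (j + 1)`, `2 ^ (j + 2)`, …. -/
def spread : ℕ → List Bool → List (Option Bool)
  | _, [] => []
  | _, [b] => [some b]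
  | j, b :: b' :: l =>
    some b :: (List.replicate (2 ^ (j + 1) - 1) none ++ spread (j + 1) (b' :: l))

/-- The contents of the oracle tape while the counter stands at `l`. -/
def orcList (l : List Bool) : List (Option Bool) :=
  spread 0 l ++ List.replicate (binVal l) none

/-- Increment the counter and extend the oracle tape by one cell. -/
def orcSucc : List (Option Bool) → List (Option Bool)
  | [] => [some false]
  | none :: l => none :: orcSucc l
  | some true :: l => some false :: orcSucc l
  | some false :: l => some true :: (l ++ [none])

theorem orcSucc_replicate (n : ℕ) (l : List (Option Bool)) :
    orcSucc (List.replicate n none ++ l) = List.replicate n none ++ orcSucc l := by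
  induction n with
  | zero => rfl
  | succ n ih => simp [List.replicate_succ, orcSucc, ih]

theorem length_orcSucc (l : List (Option Bool)) : (orcSucc l).length = l.length + 1 := by
  induction l with
  | nil => rfl
  | cons a l ih =>
    rcases a with _ | (_ | _) <;> simp [orcSucc, ih]

theorem wordSucc_replicate_true (k : ℕ) :
    wordSucc (List.replicate k true) = List.replicate (k + 1) false := by
  induction k with
  | zero => rfl
  | succ k ih => rw [List.replicate_succ, wordSucc, ih, List.replicate_succ (n := k + 1)]

theorem binVal_replicate_true (k : ℕ) : binVal (List.replicate k true) = 2 ^ k - 1 := by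
  induction k with
  | zero => rfl
  | succ k ih =>
    have := Nat.one_le_two_pow (n := k)
    rw [List.replicate_succ, binVal, ih, pow_succ, Bool.toNat_true]
    omega

theorem binVal_replicate_false (k : ℕ) : binVal (List.replicate k false) = 0 := by
  induction k with
  | zero => rfl
  | succ k ih => rw [List.replicate_succ, binVal, ih, Bool.toNat_false]

/-- The overflow case: the carry runs through all digits and fillers and creates a new most
significant digit behind them. -/
theorem orcSucc_spread_replicate_true (k j n : ℕ) :
    orcSucc (spread j (List.replicate k true) ++ List.replicate n none) =
      spread j (List.replicate k false) ++ (List.replicate n none ++ [some false]) := by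
  induction k generalizing j with
  | zero => simpa [spread, orcSucc] using orcSucc_replicate n []
  | succ k ih =>
    cases k with
    | zero => simpa [spread, orcSucc] using orcSucc_replicate n []
    | succ k =>
      simp only [List.replicate_succ, spread, List.cons_append, orcSucc, List.append_assoc,
        orcSucc_replicate] at ih ⊢
      rw [ih]

/-- For `j = 0` the number of fillers is the binary value of `k + 1` ones, that is, the padding that
`orcList` carries at the moment of overflow. So the new digit lands exactly where `spread` wants it.
-/
theorem spread_replicate_false (k j : ℕ) :
    spread j (List.replicate (k + 1) false) ++
        (List.replicate (2 ^ (j + k + 1) - 1) none ++ [some false]) =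
      spread j (List.replicate (k + 2) false) := by
  induction k generalizing j with
  | zero => simp [spread, List.replicate_succ]
  | succ k ih =>
    have := ih (j + 1)
    rw [show j + 1 + k + 1 = j + (k + 1) + 1 by ring] at this
    simp only [List.replicate_succ, spread, List.cons_append, List.append_assoc] at this ⊢
    rw [this]

/-- Without overflow the carry stops at the first digit `false`. The value and the padding both grow
by one. -/
theorem orcSucc_spread_of_mem (l : List Bool) (hl : false ∈ l) (j n : ℕ) :
    orcSucc (spread j l ++ List.replicate n none) =
        spread j (wordSucc l) ++ List.replicate (n + 1) none ∧
      binVal (wordSucc l) = binVal l + 1 ∧ (wordSucc l).length = l.length := by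
  induction l generalizing j with
  | nil => simp at hl
  | cons b l ih =>
    cases b with
    | false =>
      refine ⟨?_, by simp [wordSucc, binVal]; omega, by simp [wordSucc]⟩
      cases l with
      | nil => simp [spread, wordSucc, orcSucc, ← List.replicate_succ']
      | cons b l =>
        simp [spread, wordSucc, orcSucc, ← List.replicate_succ']
    | true =>
      have hl' : false ∈ l := by simpa using hl
      obtain ⟨h₁, h₂, h₃⟩ := ih hl' (j + 1)
      refine ⟨?_, by simp [wordSucc, binVal, h₂]; omega, by simp [wordSucc, h₃]⟩
      cases l with
      | nil => simp at hl'
      | cons b l =>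
        obtain ⟨b', l', hbl⟩ : ∃ b' l', wordSucc (b :: l) = b' :: l' := by
          cases b <;> simp [wordSucc]
        rw [wordSucc, hbl]
        rw [hbl] at h₁
        simp only [spread, List.cons_append, orcSucc, List.append_assoc, orcSucc_replicate, h₁]

/-- Each increment lengthens the tape by one cell. Between 0…0 and 1…1 with k digits there are 2^k -
1 increments, and the cells added meanwhile form the gap in front of the next digit. Thus the
exponential spacing arises without any computation of powers. -/
theorem orcSucc_orcList (l : List Bool) : orcSucc (orcList l) = orcList (wordSucc l) := by
  by_cases hl : false ∈ l
  · obtain ⟨h₁, h₂, -⟩ := orcSucc_spread_of_mem l hl 0 (binVal l)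
    rw [orcList, h₁, orcList, h₂]
  · have hl' : l = List.replicate l.length true :=
      List.eq_replicate_of_mem fun b hb => by cases b <;> simp_all
    rw [hl', orcList, orcSucc_spread_replicate_true, wordSucc_replicate_true, orcList,
      binVal_replicate_false, binVal_replicate_true]
    cases l.length with
    | zero => rfl
    | succ k => simpa using spread_replicate_false k 0

theorem orcList_iterate (n : ℕ) : orcSucc^[n] [] = orcList (wordSucc^[n] []) := by
  induction n with
  | zero => rfl
  | succ n ih =>
    rw [Function.iterate_succ_apply', ih, orcSucc_orcList, Function.iterate_succ_apply']

theorem length_orcSucc_iterate (n : ℕ) : (orcSucc^[n] []).length = n := by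
  induction n with
  | zero => rfl
  | succ n ih => rw [Function.iterate_succ_apply', length_orcSucc, ih]

theorem getElem?_spread (l : List Bool) (j p : ℕ) (b : Bool) :
    (spread j l)[p]? = some (some b) ↔
      ∃ i, p + 2 ^ (j + 1) = 2 ^ (j + 1 + i) ∧ l[i]? = some b := by
  induction l generalizing j p with
  | nil => simp [spread]
  | cons a l ih =>
    have hj := Nat.one_le_two_pow (n := j + 1)
    have key : (spread j (a :: l))[p]? = some (some b) ↔ (p = 0 ∧ a = b) ∨
        ∃ q, p = q + 2 ^ (j + 1) ∧ (spread (j + 1) l)[q]? = some (some b) := by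
      cases l with
      | nil =>
        cases p <;> simp [spread]
      | cons a' l =>
        cases p with
        | zero => simp [spread]; intro h; omega
        | succ p =>
          simp only [spread, List.getElem?_cons_succ, Nat.succ_ne_zero, false_and, false_or]
          by_cases hp : p < 2 ^ (j + 1) - 1
          · rw [List.getElem?_append_left (by simpa using hp)]
            simp only [List.getElem?_replicate, hp, if_true]
            constructor
            · intro h; simp at h
            · rintro ⟨q, hq, -⟩; omega
          · rw [List.getElem?_append_right (by simpa using hp), List.length_replicate]
            constructor
            · intro h; exact ⟨_, by omega, h⟩
            · rintro ⟨q, hq, h⟩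
              rwa [show p - (2 ^ (j + 1) - 1) = q by omega]
    rw [key]
    constructor
    · rintro (⟨rfl, rfl⟩ | ⟨q, rfl, hq⟩)
      · exact ⟨0, by simp, by simp⟩
      · obtain ⟨i, hi, hl⟩ := (ih _ _).1 hq
        refine ⟨i + 1, ?_, by simpa using hl⟩
        rw [show j + 1 + (i + 1) = j + 1 + 1 + i by ring, ← hi, pow_succ 2 (j + 1)]
        ring
    · rintro ⟨i, hi, hl⟩
      cases i with
      | zero => left; simp at hl hi; exact ⟨hi, hl⟩
      | succ i =>
        right
        have h2 : 2 ^ (j + 1 + 1) ≤ 2 ^ (j + 1 + (i + 1)) :=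
          Nat.pow_le_pow_right (by norm_num) (by omega)
        have h3 : 2 ^ (j + 1 + 1) = 2 ^ (j + 1) + 2 ^ (j + 1) := by ring
        refine ⟨p - 2 ^ (j + 1), by omega, (ih _ _).2 ⟨i, ?_, by simpa using hl⟩⟩
        rw [show j + 1 + 1 + i = j + 1 + (i + 1) by ring, ← hi]
        omega

/-- Digit i stands at position 2^(i+1) - 2, the length of the i-th word that a sparse language may
contain. A query of 1^p is therefore answered by cell p of the oracle tape. -/
theorem getElem?_orcList (l : List Bool) (p : ℕ) (b : Bool) :
    (orcList l)[p]? = some (some b) ↔ ∃ i, p + 2 = 2 ^ (i + 1) ∧ l[i]? = some b := by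
  have h := getElem?_spread l 0 p b
  simp only [zero_add, pow_one, add_comm 1] at h
  rw [← h, orcList]
  by_cases hp : p < (spread 0 l).length
  · rw [List.getElem?_append_left hp]
  · rw [List.getElem?_append_right (by omega), List.getElem?_replicate,
      List.getElem?_eq_none (by omega)]
    split <;> simp

end SpeedLow

/-! ### Time-bounded runs and basic tape programs -/

namespace SpeedLow

open Turing

section Zipper

variable {G : Type} [Inhabited G]

@[simp]
theorem head_mk₂_cons (L R : List G) (a : G) : (Tape.mk₂ L (a :: R)).head = a := rfl

@[simp]
theorem head_mk₂_nil (L : List G) : (Tape.mk₂ L []).head = default := rfl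

@[simp]
theorem move_right_mk₂_cons (L R : List G) (a : G) :
    (Tape.mk₂ L (a :: R)).move Dir.right = Tape.mk₂ (a :: L) R := by
  simp only [Tape.mk₂, Tape.move_right_mk']
  rfl

@[simp]
theorem move_left_mk₂_cons (L R : List G) (a : G) :
    (Tape.mk₂ (a :: L) R).move Dir.left = Tape.mk₂ L (a :: R) := by
  simp only [Tape.mk₂, Tape.move_left_mk']
  rfl

@[simp]
theorem move_left_mk₂_nil (R : List G) :
    (Tape.mk₂ [] R).move Dir.left = Tape.mk₂ [] (default :: R) := by
  simp only [Tape.mk₂, Tape.move_left_mk']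
  rfl

@[simp]
theorem write_mk₂_cons (L R : List G) (a b : G) :
    (Tape.mk₂ L (a :: R)).write b = Tape.mk₂ L (b :: R) := rfl

@[simp]
theorem write_mk₂_nil (L : List G) (b : G) : (Tape.mk₂ L []).write b = Tape.mk₂ L [b] := rfl

theorem mk₂_default (R : List G) : Tape.mk₂ [default] R = Tape.mk₂ [] R := by
  have : ListBlank.mk [(default : G)] = ListBlank.mk [] :=
    ListBlank.ext fun i => by cases i <;> simp [ListBlank.nth_mk]
  rw [Tape.mk₂, Tape.mk₂, this]

theorem mk₂_default_right (L : List G) : Tape.mk₂ L [default] = Tape.mk₂ L [] := by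
  have : ListBlank.mk [(default : G)] = ListBlank.mk [] :=
    ListBlank.ext fun i => by cases i <;> simp [ListBlank.nth_mk]
  rw [Tape.mk₂, Tape.mk₂, this]

theorem mk₁_eq_mk₂ (R : List G) : Tape.mk₁ R = Tape.mk₂ [] R := rfl

theorem shiftR_mk₁_append (L R : List G) :
    (Tape.move Dir.right)^[L.length] (Tape.mk₁ (L ++ R)) = Tape.mk₂ L.reverse R := by
  induction L using List.reverseRecOn generalizing R with
  | nil => rfl
  | append_singleton L a ih =>
    rw [List.length_append, List.length_singleton, Function.iterate_succ_apply',
      List.append_assoc, List.singleton_append, ih, move_right_mk₂_cons, List.reverse_append]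
    rfl

end Zipper

variable {W Γ : Type} {A : Set (List Bool)}

/-- The program, started with tapes `T`, ends with tapes `T'` after at most `B` steps. -/
def RunsIn (A : Set (List Bool)) (P : Prog W Γ) (T T' : Tapes W Γ) (B : ℕ) : Prop :=
  ∃ t ≤ B, Exec A P T T' t

namespace RunsIn

theorem mono {P : Prog W Γ} {T T' : Tapes W Γ} {B B' : ℕ} (h : RunsIn A P T T' B)
    (hB : B ≤ B') : RunsIn A P T T' B' :=
  let ⟨t, ht, h⟩ := h
  ⟨t, ht.trans hB, h⟩

theorem op {δ : Heads W Γ → TapeName W → TapeSymbol Γ × Option Dir} {T T' : Tapes W Γ}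
    (h : ∀ i, actTape (T i) (δ (heads T) i) = T' i) : RunsIn A (.op δ) T T' 1 :=
  ⟨1, le_rfl, by
    have := Exec.op (A := A) δ T
    rwa [show (fun i => actTape (T i) (δ (heads T) i)) = T' from funext h] at this⟩

theorem seq {P Q : Prog W Γ} {T T₁ T₂ : Tapes W Γ} {B₁ B₂ : ℕ} (h₁ : RunsIn A P T T₁ B₁)
    (h₂ : RunsIn A Q T₁ T₂ B₂) : RunsIn A (.seq P Q) T T₂ (B₁ + B₂) :=
  let ⟨t₁, ht₁, h₁⟩ := h₁
  let ⟨t₂, ht₂, h₂⟩ := h₂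
  ⟨t₁ + t₂, add_le_add ht₁ ht₂, h₁.seq h₂⟩

theorem ite_true {c : Heads W Γ → Bool} {P Q : Prog W Γ} {T T' : Tapes W Γ} {B : ℕ}
    (hc : c (heads T) = true) (h : RunsIn A P T T' B) : RunsIn A (.ite c P Q) T T' (B + 1) :=
  let ⟨t, ht, h⟩ := h
  ⟨t + 1, add_le_add ht le_rfl, h.ite_true Q hc⟩

theorem ite_false {c : Heads W Γ → Bool} {P Q : Prog W Γ} {T T' : Tapes W Γ} {B : ℕ}
    (hc : c (heads T) = false) (h : RunsIn A Q T T' B) : RunsIn A (.ite c P Q) T T' (B + 1) :=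
  let ⟨t, ht, h⟩ := h
  ⟨t + 1, add_le_add ht le_rfl, h.ite_false P hc⟩

theorem loop_false {c : Heads W Γ → Bool} {P : Prog W Γ} {T : Tapes W Γ}
    (hc : c (heads T) = false) : RunsIn A (.loop c P) T T 1 :=
  ⟨1, le_rfl, .loop_false P hc⟩

theorem loop_true {c : Heads W Γ → Bool} {P : Prog W Γ} {T T₁ T₂ : Tapes W Γ} {B₁ B₂ : ℕ}
    (hc : c (heads T) = true) (h₁ : RunsIn A P T T₁ B₁) (h₂ : RunsIn A (.loop c P) T₁ T₂ B₂) :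
    RunsIn A (.loop c P) T T₂ (1 + B₁ + B₂) :=
  let ⟨t₁, ht₁, h₁⟩ := h₁
  let ⟨t₂, ht₂, h₂⟩ := h₂
  ⟨1 + t₁ + t₂, by omega, h₁.loop_true hc h₂⟩

/-- For inductions that treat a loop and its continuation as one program: the given run is split at
the end of the loop, and one more pass is put in front. -/
theorem seq_loop_true {c : Heads W Γ → Bool} {P Q : Prog W Γ} {T T₁ T₂ : Tapes W Γ}
    {B₁ B₂ : ℕ} (hc : c (heads T) = true) (h₁ : RunsIn A P T T₁ B₁)
    (h₂ : RunsIn A (.seq (.loop c P) Q) T₁ T₂ B₂) :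
    RunsIn A (.seq (.loop c P) Q) T T₂ (1 + B₁ + B₂) := by
  obtain ⟨t₁, ht₁, h₁⟩ := h₁
  obtain ⟨t₂, ht₂, h₂⟩ := h₂
  cases h₂ with
  | @seq _ _ _ T' _ s₁ s₂ h₃ h₄ =>
    exact ⟨(1 + t₁ + s₁) + s₂, by omega, (h₁.loop_true hc h₃).seq h₄⟩

/-- A loop that is executed `n` times. -/
theorem loop_iterate {c : Heads W Γ → Bool} {P : Prog W Γ} (S : ℕ → Tapes W Γ) {B : ℕ} :
    ∀ n : ℕ, (∀ i < n, c (heads (S i)) = true) → (∀ i < n, RunsIn A P (S i) (S (i + 1)) B) →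
      c (heads (S n)) = false → RunsIn A (.loop c P) (S 0) (S n) (n * (B + 1) + 1)
  | 0, _, _, h => (loop_false h).mono (by omega)
  | n + 1, h₁, h₂, h₃ => by
    have ih := loop_iterate (fun i => S (i + 1)) n (fun i hi => h₁ (i + 1) (by omega))
      (fun i hi => h₂ (i + 1) (by omega)) h₃
    refine (loop_true (h₁ 0 (by omega)) (h₂ 0 (by omega)) ih).mono ?_
    rw [add_mul]
    omega

end RunsIn

open Classical in
/-- Act on a single tape. -/
noncomputable def Prog.on (i : TapeName W) (f : TapeSymbol Γ → TapeSymbol Γ × Option Dir) :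
    Prog W Γ :=
  .op fun h j => if j = i then f (h j) else (h j, none)

open Classical in
theorem RunsIn.on {i : TapeName W} {f : TapeSymbol Γ → TapeSymbol Γ × Option Dir}
    {T : Tapes W Γ} {X Y : Tape (TapeSymbol Γ)} (h : actTape X (f X.head) = Y) :
    RunsIn A (.on i f) (Function.update T i X) (Function.update T i Y) 1 := by
  refine RunsIn.op fun j => ?_
  by_cases hj : j = i
  · subst hj
    simp [heads, h]
  · simp [heads, hj]

/-- The head moves in the given direction. -/
noncomputable def Prog.go (i : TapeName W) (d : Dir) : Prog W Γ :=
  .on i fun a => (a, some d)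

/-- The head moves in the given direction to the next blank. -/
noncomputable def Prog.slide (i : TapeName W) (d : Dir) : Prog W Γ :=
  .loop (fun h => (h i).isSome) (.go i d)

/-- The head returns to the first symbol of a word. -/
noncomputable def Prog.rewind (i : TapeName W) : Prog W Γ :=
  .seq (.slide i Dir.left) (.go i Dir.right)

open Classical in
theorem RunsIn.go {i : TapeName W} (d : Dir) {T : Tapes W Γ} {X : Tape (TapeSymbol Γ)} :
    RunsIn A (.go i d) (Function.update T i X) (Function.update T i (X.move d)) 1 :=
  .on (by rw [actTape_some, write_head])

open Classical in
theorem RunsIn.slide_right {i : TapeName W} {T : Tapes W Γ} :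
    ∀ (L R : List (TapeSymbol Γ)), (∀ a ∈ R, a.isSome = true) →
      RunsIn A (.slide i Dir.right) (Function.update T i (Tape.mk₂ L R))
        (Function.update T i (Tape.mk₂ (R.reverse ++ L) [])) (2 * R.length + 1)
  | L, [], _ => (RunsIn.loop_false (by simp [heads]; rfl)).mono (by simp)
  | L, a :: R, h => by
    have ih := RunsIn.slide_right (i := i) (T := T) (a :: L) R
      fun b hb => h b (List.mem_cons_of_mem _ hb)
    have h₁ := RunsIn.go (A := A) (i := i) Dir.right (T := T) (X := Tape.mk₂ L (a :: R))
    rw [move_right_mk₂_cons] at h₁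
    have h₂ := RunsIn.loop_true (c := fun h => (h i).isSome)
      (by simpa [heads] using h a List.mem_cons_self) h₁ ih
    rw [List.reverse_cons, List.append_assoc, List.singleton_append]
    exact h₂.mono (by rw [List.length_cons]; omega)

open Classical in
theorem RunsIn.slide_left {i : TapeName W} {T : Tapes W Γ} :
    ∀ (L R : List (TapeSymbol Γ)) (a : TapeSymbol Γ), (∀ b ∈ L, b.isSome = true) →
      a.isSome = true → RunsIn A (.slide i Dir.left) (Function.update T i (Tape.mk₂ L (a :: R)))
        (Function.update T i (Tape.mk₂ [] (none :: (L.reverse ++ a :: R)))) (2 * L.length + 3)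
  | [], R, a, _, ha => by
    have h₁ := RunsIn.go (A := A) (i := i) Dir.left (T := T) (X := Tape.mk₂ [] (a :: R))
    rw [move_left_mk₂_nil] at h₁
    exact RunsIn.loop_true (by simpa [heads] using ha) h₁ (RunsIn.loop_false (by simp [heads]; rfl))
  | b :: L, R, a, hL, ha => by
    have ih := RunsIn.slide_left (i := i) (T := T) L (a :: R) b
      (fun b hb => hL b (List.mem_cons_of_mem _ hb)) (hL b List.mem_cons_self)
    have h₁ := RunsIn.go (A := A) (i := i) Dir.left (T := T) (X := Tape.mk₂ (b :: L) (a :: R))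
    rw [move_left_mk₂_cons] at h₁
    have h₂ := RunsIn.loop_true (c := fun h => (h i).isSome) (by simpa [heads] using ha) h₁ ih
    rw [List.reverse_cons, List.append_assoc, List.singleton_append]
    exact h₂.mono (by rw [List.length_cons]; omega)

open Classical in
theorem RunsIn.rewind {i : TapeName W} {T : Tapes W Γ} (L R : List (TapeSymbol Γ))
    (a : TapeSymbol Γ) (hL : ∀ b ∈ L, b.isSome = true) (ha : a.isSome = true) :
    RunsIn A (.rewind i) (Function.update T i (Tape.mk₂ L (a :: R)))
      (Function.update T i (Tape.mk₁ (L.reverse ++ a :: R))) (2 * L.length + 4) := by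
  have h := RunsIn.go (A := A) (i := i) Dir.right (T := T)
    (X := Tape.mk₂ [] (none :: (L.reverse ++ a :: R)))
  rw [move_right_mk₂_cons] at h
  -- The overshoot to the left has left an explicit blank on the list, which is the same tape as
  -- with nothing there.
  have hd : Tape.mk₂ [none] (L.reverse ++ a :: R) = Tape.mk₁ (L.reverse ++ a :: R) :=
    mk₂_default _
  rw [hd] at h
  exact (RunsIn.slide_left L R a hL ha).seq h

/-! ### Programs on tapes with a mark -/

section Mark

variable {W G : Type} {A : Set (List Bool)}

/-- The mark. -/
def mark : TapeSymbol (Option G) := some (Sum.inr none)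

/-- A counter tape that holds the number `n`. -/
def unary (n : ℕ) : Tape (TapeSymbol (Option G)) := Tape.mk₁ (List.replicate n mark)

/-- Increment a counter tape. -/
noncomputable def Prog.extend (i : TapeName W) : Prog W (Option G) :=
  .seq (.slide i Dir.right) (.seq (.on i fun _ => (mark, none)) (.rewind i))

open Classical in
theorem RunsIn.extend {i : TapeName W} {T : Tapes W (Option G)} (n : ℕ) :
    RunsIn A (.extend i) (Function.update T i (unary n)) (Function.update T i (unary (n + 1)))
      (4 * n + 6) := by
  have hm : ∀ a ∈ List.replicate n (mark : TapeSymbol (Option G)), a.isSome = true :=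
    fun a ha => by rw [List.eq_of_mem_replicate ha]; rfl
  have h₁ := RunsIn.slide_right (A := A) (i := i) (T := T) [] (List.replicate n mark) hm
  rw [List.reverse_replicate, List.append_nil, List.length_replicate] at h₁
  have h₂ : RunsIn A (.on i fun _ => (mark, none))
      (Function.update T i (Tape.mk₂ (List.replicate n mark) []))
      (Function.update T i (Tape.mk₂ (List.replicate n mark) [mark])) 1 := RunsIn.on rfl
  have h₃ := RunsIn.rewind (A := A) (i := i) (T := T) (List.replicate n mark) [] mark hm rfl
  rw [List.reverse_replicate, List.length_replicate, ← List.replicate_succ'] at h₃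
  exact (h₁.seq (h₂.seq h₃)).mono (by omega)

/-- Perform a program as often as a counter tape says. -/
noncomputable def Prog.times (i : TapeName W) (P : Prog W (Option G)) : Prog W (Option G) :=
  .seq (.loop (fun h => (h i).isSome) (.seq P (.go i Dir.right)))
    (.seq (.go i Dir.left) (.rewind i))

-- The body must run for every content `X` of the counter tape, since the head on that tape advances
-- between the passes; the final rewind restores it, so that the counter can be used again.
open Classical in
theorem RunsIn.times {i : TapeName W} {P : Prog W (Option G)} {B : ℕ}
    (S : ℕ → Tapes W (Option G)) (n : ℕ)
    (h : ∀ k < n, ∀ X, RunsIn A P (Function.update (S k) i X) (Function.update (S (k + 1)) i X) B) :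
    RunsIn A (.times i P) (Function.update (S 0) i (unary n)) (Function.update (S n) i (unary n))
      (n * (B + 4) + 4) := by
  have hs : ∀ k ≤ n, (Tape.move Dir.right)^[k] (unary n) =
      Tape.mk₂ (List.replicate k (mark : TapeSymbol (Option G))) (List.replicate (n - k) mark) := by
    intro k hk
    have := shiftR_mk₁_append (List.replicate k (mark : TapeSymbol (Option G)))
      (List.replicate (n - k) mark)
    rwa [List.replicate_append_replicate, Nat.add_sub_cancel' hk, List.length_replicate,
      List.reverse_replicate] at this
  have h₁ := RunsIn.loop_iterate (A := A) (c := fun h => (h i).isSome)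
    (P := .seq P (.go i Dir.right)) (B := B + 1)
    (fun k => Function.update (S k) i ((Tape.move Dir.right)^[k] (unary n))) n
    (fun k hk => by
      simp only [heads, Function.update_self]
      rw [hs k hk.le, show n - k = n - k - 1 + 1 by omega]
      rfl)
    (fun k hk => by
      have := RunsIn.go (A := A) (i := i) Dir.right (T := S (k + 1))
        (X := (Tape.move Dir.right)^[k] (unary n))
      rw [← Function.iterate_succ_apply' (Tape.move Dir.right)] at this
      exact (h k hk _).seq this)
    (by
      simp only [heads, Function.update_self]
      rw [hs n le_rfl, Nat.sub_self]
      rfl)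
  simp only [hs n le_rfl, Nat.sub_self, List.replicate_zero, Function.iterate_zero, id_eq] at h₁
  have h₂ := RunsIn.go (A := A) (i := i) Dir.left (T := S n)
    (X := Tape.mk₂ (List.replicate n mark) [])
  -- For an empty counter the move to the left already reaches a blank, so the slide stops at once
  -- and `RunsIn.rewind`, which needs a nonblank cell, does not apply.
  cases n with
  | zero =>
    rw [List.replicate_zero, move_left_mk₂_nil] at h₂
    have h₃ : RunsIn A (.slide i Dir.left) (Function.update (S 0) i (Tape.mk₂ [] [default]))
        (Function.update (S 0) i (Tape.mk₂ [] [default])) 1 :=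
      RunsIn.loop_false (by simp [heads]; rfl)
    have h₄ := RunsIn.go (A := A) (i := i) Dir.right (T := S 0)
      (X := Tape.mk₂ [] [(default : TapeSymbol (Option G))])
    rw [move_right_mk₂_cons, mk₂_default] at h₄
    exact (h₁.seq (h₂.seq (h₃.seq h₄))).mono (by omega)
  | succ n =>
    rw [List.replicate_succ, move_left_mk₂_cons] at h₂
    have h₃ := RunsIn.rewind (A := A) (i := i) (T := S (n + 1)) (List.replicate n mark) [] mark
      (fun a ha => by rw [List.eq_of_mem_replicate ha]; rfl) rfl
    rw [List.reverse_replicate, List.length_replicate, ← List.replicate_succ'] at h₃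
    refine (h₁.seq (h₂.seq h₃)).mono ?_
    ring_nf
    omega

/-- The symbol for a cell of the oracle tape. -/
def cellSym : Option Bool → TapeSymbol (Option G)
  | none => mark
  | some b => some (Sum.inl b)

theorem isSome_cellSym (c : Option Bool) : (cellSym c : TapeSymbol (Option G)).isSome = true := by
  cases c <;> rfl

/-- A test for cells from which a carry propagates. -/
def carries : TapeSymbol (Option G) → Bool
  | none => false
  | some (Sum.inl b) => b
  | some (Sum.inr _) => true

/-- Increment the counter on the oracle tape; the head stops inside the word. -/
noncomputable def Prog.orcStep (i : TapeName W) : Prog W (Option G) :=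
  .seq (.loop (fun h => carries (h i)) (.on i fun
      | some (Sum.inl _) => (some (Sum.inl false), some Dir.right)
      | a => (a, some Dir.right)))
    (.ite (fun h => (h i).isNone) (.on i fun _ => (some (Sum.inl false), none))
      (.seq (.on i fun _ => (some (Sum.inl true), some Dir.right))
        (.seq (.slide i Dir.right) (.on i fun _ => (mark, none)))))

-- The head may stop in the middle of the word, so the result is described as a zipper with known
-- concatenation. That its left part and its scanned cell are nonblank is what the subsequent rewind
-- needs, and the length equation bounds the cost of that rewind.
open Classical in
theorem RunsIn.orcStep {i : TapeName W} {T : Tapes W (Option G)} (l : List (Option Bool)) :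
    ∀ L : List (TapeSymbol (Option G)), (∀ a ∈ L, a.isSome = true) →
      ∃ L' a, (∀ b ∈ L', b.isSome = true) ∧ a.isSome = true ∧ ∃ R' : List (TapeSymbol (Option G)),
        L'.length + R'.length = L.length + l.length ∧
        L'.reverse ++ a :: R' = L.reverse ++ (orcSucc l).map cellSym ∧
        RunsIn A (.orcStep i) (Function.update T i (Tape.mk₂ L (l.map cellSym)))
          (Function.update T i (Tape.mk₂ L' (a :: R'))) (2 * l.length + 6) := by
  induction l with
  | nil =>
    intro L hL
    refine ⟨L, some (Sum.inl false), hL, rfl, [], by simp, by simp [orcSucc, cellSym], ?_⟩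
    refine RunsIn.mono (RunsIn.seq (RunsIn.loop_false (by simp [heads]; rfl))
      (RunsIn.ite_true (by simp [heads]; rfl) (RunsIn.on ?_))) ?_
    · rfl
    · simp
  | cons c l ih =>
    intro L hL
    rcases c with _ | (_ | _)
    · obtain ⟨L', a, hL', ha, R', hlen, heq, hrun⟩ := ih (cellSym none :: L) fun a ha => by
        rcases List.mem_cons.1 ha with rfl | ha
        exacts [isSome_cellSym _, hL a ha]
      refine ⟨L', a, hL', ha, R', by simp at hlen ⊢; omega, by simp [heq, orcSucc], ?_⟩
      refine RunsIn.mono (RunsIn.seq_loop_true (by simp [heads]; rfl) (RunsIn.on ?_) hrun) ?_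
      · rfl
      · simp; omega
    · refine ⟨(l.map cellSym).reverse ++ some (Sum.inl true) :: L, mark, ?_, rfl, [], ?_, ?_, ?_⟩
      · intro b hb
        simp only [List.mem_append, List.mem_reverse, List.mem_map, List.mem_cons] at hb
        rcases hb with ⟨c, -, rfl⟩ | rfl | hb
        exacts [isSome_cellSym _, rfl, hL b hb]
      · simp; omega
      · simp [orcSucc, cellSym]
      · have h₁ := RunsIn.slide_right (A := A) (i := i) (T := T) (some (Sum.inl true) :: L)
          (l.map cellSym) fun a ha => by
            obtain ⟨c, -, rfl⟩ := List.mem_map.1 ha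
            exact isSome_cellSym c
        refine RunsIn.mono (RunsIn.seq (RunsIn.loop_false (by simp [heads]; rfl))
          (RunsIn.ite_false (by simp [heads]; rfl) (RunsIn.seq (RunsIn.on ?_)
            (RunsIn.seq h₁ (RunsIn.on ?_))))) ?_
        · rfl
        · rfl
        · simp; omega
    · obtain ⟨L', a, hL', ha, R', hlen, heq, hrun⟩ := ih (cellSym (some false) :: L) fun a ha => by
        rcases List.mem_cons.1 ha with rfl | ha
        exacts [isSome_cellSym _, hL a ha]
      refine ⟨L', a, hL', ha, R', by simp at hlen ⊢; omega, by simp [heq, orcSucc], ?_⟩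
      refine RunsIn.mono (RunsIn.seq_loop_true (by simp [heads]; rfl) (RunsIn.on ?_) hrun) ?_
      · rfl
      · simp; omega

/-- Increment the counter on the oracle tape. -/
noncomputable def Prog.orcNext (i : TapeName W) : Prog W (Option G) :=
  .seq (.orcStep i) (.rewind i)

open Classical in
theorem RunsIn.orcNext {i : TapeName W} {T : Tapes W (Option G)} (l : List (Option Bool)) :
    RunsIn A (.orcNext i) (Function.update T i (Tape.mk₁ (l.map cellSym)))
      (Function.update T i (Tape.mk₁ ((orcSucc l).map cellSym))) (4 * l.length + 10) := by
  obtain ⟨L', a, hL', ha, R', hlen, heq, hrun⟩ :=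
    RunsIn.orcStep (A := A) (i := i) (T := T) l [] (by simp)
  have h := RunsIn.rewind (A := A) (i := i) (T := T) L' R' a hL' ha
  rw [heq, List.reverse_nil, List.nil_append] at h
  refine (hrun.seq h).mono ?_
  simp at hlen
  omega

/-- Write a word to the left of the head. -/
noncomputable def Prog.putLeft (i : TapeName W) : List (TapeSymbol Γ) → Prog W Γ
  | [] => .on i fun a => (a, none)
  | a :: l => .seq (.putLeft i l) (.seq (.go i Dir.left) (.on i fun _ => (a, none)))

open Classical in
theorem RunsIn.putLeft {i : TapeName W} {T : Tapes W Γ} (R l : List (TapeSymbol Γ)) :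
    RunsIn A (.putLeft i l) (Function.update T i (Tape.mk₁ R))
      (Function.update T i (Tape.mk₁ (l ++ R))) (2 * l.length + 1) := by
  induction l with
  | nil => exact RunsIn.on (write_head _)
  | cons a l ih =>
    have h₁ := RunsIn.go (A := A) (i := i) Dir.left (T := T) (X := Tape.mk₁ (l ++ R))
    rw [mk₁_eq_mk₂ (l ++ R), move_left_mk₂_nil] at h₁
    refine (ih.seq (h₁.seq (RunsIn.on (Y := Tape.mk₁ (a :: l ++ R)) rfl))).mono ?_
    rw [List.length_cons]
    omega

end Mark

end SpeedLow

namespace SpeedLow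

open Turing

/-! ### Locality -/

theorem nth_map {G G' : Type} [Inhabited G] [Inhabited G'] (f : PointedMap G G') (T : Tape G)
    (i : ℤ) : (T.map f).nth i = f (T.nth i) := by
  rcases i with (_ | n) | n
  · rfl
  · exact ListBlank.nth_map f T.right n
  · exact ListBlank.nth_map f T.left n

section Support

variable {G : Type} [Inhabited G]

/-- All symbols at distance more than `R` from the head are blank. -/
def BlankBeyond (R : ℕ) (T : Tape G) : Prop :=
  ∀ i : ℤ, R < i.natAbs → T.nth i = default

theorem BlankBeyond.mono {R R' : ℕ} {T : Tape G} (h : BlankBeyond R T) (hR : R ≤ R') :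
    BlankBeyond R' T :=
  fun i hi => h i (lt_of_le_of_lt hR hi)

theorem blankBeyond_mk₁ (l : List G) : BlankBeyond l.length (Tape.mk₁ l) := by
  intro i hi
  rcases i with n | n
  · have : l.length ≤ n := by simp at hi; omega
    change (Tape.mk₁ l).nth (n : ℤ) = _
    rw [nth_mk₁_nat, List.getI_eq_default _ this]
  · exact nth_mk₁_negSucc l n

theorem nth_actTape_none (T : Tape G) (g : G) (i : ℤ) :
    (actTape T (g, none)).nth i = if i = 0 then g else T.nth i := by
  rw [actTape_none, Tape.write_nth]

theorem nth_actTape_left (T : Tape G) (g : G) (i : ℤ) :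
    (actTape T (g, some Dir.left)).nth i = if i - 1 = 0 then g else T.nth (i - 1) := by
  rw [actTape_some, Tape.move_left_nth, Tape.write_nth]

theorem nth_actTape_right (T : Tape G) (g : G) (i : ℤ) :
    (actTape T (g, some Dir.right)).nth i = if i + 1 = 0 then g else T.nth (i + 1) := by
  rw [actTape_some, Tape.move_right_nth, Tape.write_nth]

theorem BlankBeyond.actTape {R : ℕ} {T : Tape G} (h : BlankBeyond R T) (a : G × Option Dir) :
    BlankBeyond (R + 1) (actTape T a) := by
  obtain ⟨g, d⟩ := a
  intro i hi
  rcases d with _ | (_ | _)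
  · rw [nth_actTape_none, if_neg (by omega)]
    exact h i (by omega)
  · rw [nth_actTape_left, if_neg (by omega)]
    exact h _ (by omega)
  · rw [nth_actTape_right, if_neg (by omega)]
    exact h _ (by omega)

/-- The tapes agree at distance less than `r` from the head. -/
def AgreeNear (r : ℕ) (S T : Tape G) : Prop :=
  ∀ i : ℤ, i.natAbs < r → S.nth i = T.nth i

theorem AgreeNear.mono {r r' : ℕ} {S T : Tape G} (h : AgreeNear r S T) (hr : r' ≤ r) :
    AgreeNear r' S T :=
  fun i hi => h i (lt_of_lt_of_le hi hr)

theorem AgreeNear.head {r : ℕ} {S T : Tape G} (h : AgreeNear (r + 1) S T) : S.head = T.head :=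
  h 0 (by simp)

theorem AgreeNear.actTape {r : ℕ} {S T : Tape G} (h : AgreeNear (r + 1) S T)
    (a : G × Option Dir) : AgreeNear r (actTape S a) (actTape T a) := by
  obtain ⟨g, d⟩ := a
  intro i hi
  rcases d with _ | (_ | _)
  · rw [nth_actTape_none, nth_actTape_none, h i (by omega)]
  · rw [nth_actTape_left, nth_actTape_left, h (i - 1) (by omega)]
  · rw [nth_actTape_right, nth_actTape_right, h (i + 1) (by omega)]

end Support

theorem HoldsWord.length_le {Γ : Type} {T : Tape (TapeSymbol Γ)} {w : List Bool} {R : ℕ}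
    (h : HoldsWord T w) (hT : BlankBeyond R T) : w.length ≤ R + 1 := by
  by_contra hc
  have h₁ := h.1 ⟨w.length - 1, by omega⟩
  rw [hT _ (by simp; omega)] at h₁
  cases h₁

open Classical in
/-- The three kinds of steps. -/
theorem step_cases (M : OracleTM) (A : Set (List Bool)) (c : M.Cfg) :
    (∃ b, M.prog c.state = .halt b ∧ M.step A c = c) ∨
    (∃ yes no, M.prog c.state = .query yes no ∧
      M.step A c = ⟨if ∃ w ∈ A, HoldsWord (c.tape .query) w then yes else no, c.tape⟩) ∨
    (∃ δ, M.prog c.state = .act δ ∧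
      M.step A c = ⟨(δ (heads c.tape)).1,
        fun i => actTape (c.tape i) ((δ (heads c.tape)).2 i)⟩) := by
  rcases h : M.prog c.state with b | ⟨yes, no⟩ | δ
  · exact Or.inl ⟨b, rfl, step_halt M A c h⟩
  · exact Or.inr (Or.inl ⟨yes, no, rfl, step_query M A _ _ h⟩)
  · exact Or.inr (Or.inr ⟨δ, rfl, step_act M A _ _ h⟩)

theorem BlankBeyond.step {M : OracleTM} (A : Set (List Bool)) {c : M.Cfg} {R : ℕ}
    {i : TapeName M.W} (h : BlankBeyond R (c.tape i)) :
    BlankBeyond (R + 1) ((M.step A c).tape i) := by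
  rcases step_cases M A c with ⟨b, -, hs⟩ | ⟨yes, no, -, hs⟩ | ⟨δ, -, hs⟩
  · rw [hs]; exact h.mono (by omega)
  · rw [hs]; exact h.mono (by omega)
  · rw [hs]; exact h.actTape _

theorem BlankBeyond.iterate {M : OracleTM} (A : Set (List Bool)) {c : M.Cfg} {R : ℕ}
    {i : TapeName M.W} (h : BlankBeyond R (c.tape i)) (n : ℕ) :
    BlankBeyond (R + n) (((M.step A)^[n] c).tape i) := by
  induction n with
  | zero => exact h
  | succ n ih =>
    rw [Function.iterate_succ_apply']
    exact ih.step A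

theorem blankBeyond_init (M : OracleTM) (x : List Bool) (i : TapeName M.W) :
    BlankBeyond x.length ((M.init x).tape i) := by
  cases i with
  | input =>
    have h := blankBeyond_mk₁ (x.map fun b => (some (Sum.inl b) : TapeSymbol M.Γ))
    rw [List.length_map] at h
    exact h
  | query => exact (blankBeyond_mk₁ []).mono (by simp)
  | work w => exact (blankBeyond_mk₁ []).mono (by simp)

theorem blankBeyond_init_query (M : OracleTM) (x : List Bool) :
    BlankBeyond 0 ((M.init x).tape .query) :=
  blankBeyond_mk₁ []

/-- A computation of length `n` depends only on the oracle for words of length at most `n`. -/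
theorem iterate_step_congr (M : OracleTM) {A B : Set (List Bool)} (x : List Bool) {n : ℕ}
    (h : ∀ w : List Bool, w.length ≤ n → (w ∈ A ↔ w ∈ B)) :
    (M.step A)^[n] (M.init x) = (M.step B)^[n] (M.init x) := by
  induction n with
  | zero => rfl
  | succ n ih =>
    rw [Function.iterate_succ_apply', Function.iterate_succ_apply',
      ← ih fun w hw => h w (by omega)]
    -- The query tape starts blank, so after n steps it is blank beyond distance n, and the word at
    -- the head has at most n + 1 letters.
    have hq := (blankBeyond_init_query M x).iterate A n
    generalize (M.step A)^[n] (M.init x) = c at hq ⊢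
    rcases hp : M.prog c.state with b | ⟨yes, no⟩ | δ
    · rw [step_halt M A c hp, step_halt M B c hp]
    · classical
      rw [step_query M A _ _ hp, step_query M B _ _ hp]
      have : (∃ w ∈ A, HoldsWord (c.tape .query) w) ↔ ∃ w ∈ B, HoldsWord (c.tape .query) w := by
        constructor
        · rintro ⟨w, hw, hh⟩
          exact ⟨w, (h w (by have := HoldsWord.length_le hh hq; omega)).1 hw, hh⟩
        · rintro ⟨w, hw, hh⟩
          exact ⟨w, (h w (by have := HoldsWord.length_le hh hq; omega)).2 hw, hh⟩
      simp only [this]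
    · rw [step_act M A _ _ hp, step_act M B _ _ hp]

theorem AnswersWithin.congr_oracle {M : OracleTM} {A B : Set (List Bool)} {x : List Bool} {n : ℕ}
    {b : Bool} (h : M.AnswersWithin A x n b)
    (hAB : ∀ w : List Bool, w.length ≤ n → (w ∈ A ↔ w ∈ B)) : M.AnswersWithin B x n b := by
  unfold OracleTM.AnswersWithin at *
  rwa [← iterate_step_congr M x hAB]

/-- A computation of length `n` depends only on the first `n` letters of the input. -/
theorem AnswersWithin.congr_input {M : OracleTM} {A : Set (List Bool)} {x y : List Bool} {n : ℕ}
    {b : Bool} (h : M.AnswersWithin A x n b) (hxy : x.take n = y.take n) :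
    M.AnswersWithin A y n b := by
  -- With r steps to go, the tapes still agree at distance less than r from the head; each step
  -- costs one cell. The tapes other than the input are equal throughout, because a query looks at a
  -- whole word and not only at the scanned cell.
  have key : ∀ k r, k + r = n →
      ((M.step A)^[k] (M.init x)).state = ((M.step A)^[k] (M.init y)).state ∧
      ∀ i, AgreeNear r (((M.step A)^[k] (M.init x)).tape i)
          (((M.step A)^[k] (M.init y)).tape i) ∧
        (i ≠ .input → ((M.step A)^[k] (M.init x)).tape i =
          ((M.step A)^[k] (M.init y)).tape i) := by
    intro k
    induction k with
    | zero =>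
      intro r hr
      refine ⟨rfl, fun i => ?_⟩
      cases i with
      | input =>
        refine ⟨fun i hi => ?_, fun h => (h rfl).elim⟩
        rcases i with j | j
        · change (Tape.mk₁ _).nth (j : ℤ) = (Tape.mk₁ _).nth (j : ℤ)
          have hj : j < n := by simp at hi; omega
          have := congrArg (fun l : List Bool => l[j]?) hxy
          simp only [List.getElem?_take, hj, if_true] at this
          rw [nth_mk₁_nat, nth_mk₁_nat, List.getI_eq_getElem?_getD, List.getI_eq_getElem?_getD,
            List.getElem?_map, List.getElem?_map, this]
        · exact (nth_mk₁_negSucc _ j).trans (nth_mk₁_negSucc _ j).symm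
      | query => exact ⟨fun _ _ => rfl, fun _ => rfl⟩
      | work w => exact ⟨fun _ _ => rfl, fun _ => rfl⟩
    | succ k ih =>
      intro r hr
      obtain ⟨h₁, h₂⟩ := ih (r + 1) (by omega)
      rw [Function.iterate_succ_apply', Function.iterate_succ_apply']
      generalize (M.step A)^[k] (M.init x) = c at h₁ h₂ ⊢
      generalize (M.step A)^[k] (M.init y) = d at h₁ h₂ ⊢
      have hh : heads c.tape = heads d.tape := funext fun i => (h₂ i).1.head
      rcases hp : M.prog c.state with b | ⟨yes, no⟩ | δ
      · rw [step_halt M A c hp, step_halt M A d (h₁ ▸ hp)]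
        exact ⟨h₁, fun i => ⟨(h₂ i).1.mono (by omega), (h₂ i).2⟩⟩
      · classical
        rw [step_query M A _ _ hp, step_query M A _ _ (h₁ ▸ hp), (h₂ .query).2 (by simp)]
        exact ⟨rfl, fun i => ⟨(h₂ i).1.mono (by omega), (h₂ i).2⟩⟩
      · rw [step_act M A _ _ hp, step_act M A _ _ (h₁ ▸ hp), hh]
        exact ⟨rfl, fun i => ⟨(h₂ i).1.actTape _, fun hi => by simp only [(h₂ i).2 hi]⟩⟩
  unfold OracleTM.AnswersWithin at *
  rwa [← (key n 0 (by omega)).1]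

end SpeedLow

namespace SpeedLow

open Turing

/-! ### Simulating an oracle machine with all small oracles -/

/-- The oracle given by a fixed word for short queries and by the oracle tape for long ones. -/
def orcSet (F : List Bool) (l : List (Option Bool)) : Set (List Bool) :=
  {w | ∃ p, w = List.replicate p true ∧
    (F[p]? = some true ∨ (F[p]? = none ∧ l[p]? = some (some true)))}

/-- The simulated oracles contain only words of ones, so a query is settled by the first cell j that
does not hold a 1. If it holds a 0, the queried word is not of this kind; otherwise the word is 1^j,
and the entry at position j decides. -/
theorem exists_mem_holdsWord {Γ : Type} {T : Tape (TapeSymbol Γ)} {j : ℕ}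
    (h₁ : ∀ i < j, T.nth (i : ℤ) = some (Sum.inl true)) (h₂ : T.nth (j : ℤ) ≠ some (Sum.inl true))
    (F : List Bool) (l : List (Option Bool)) :
    (∃ w ∈ orcSet F l, HoldsWord T w) ↔ T.nth (j : ℤ) ≠ some (Sum.inl false) ∧
      (F[j]? = some true ∨ (F[j]? = none ∧ l[j]? = some (some true))) := by
  constructor
  · rintro ⟨_, ⟨p, rfl, hp⟩, hw₁, hw₂⟩
    have hw₁' : ∀ i < p, T.nth (i : ℤ) = some (Sum.inl true) := fun i hi => by
      simpa using hw₁ ⟨i, by simpa using hi⟩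
    have hpj : p = j := by
      rcases lt_trichotomy p j with h | h | h
      · exact (hw₂ true (by simpa using h₁ p h)).elim
      · exact h
      · exact (h₂ (hw₁' j h)).elim
    subst hpj
    exact ⟨by simpa using hw₂ false, hp⟩
  · rintro ⟨hf, hp⟩
    refine ⟨_, ⟨j, rfl, hp⟩, fun i => ?_, fun b => ?_⟩
    · simpa using h₁ i (by simpa using i.2)
    · rw [List.length_replicate]
      cases b
      · exact hf
      · exact h₂

/-- The symbols of a simulating machine: a mark, and the symbols and states of the machine. -/
abbrev SimSym (M : OracleTM) : Type := Option (M.Γ ⊕ M.Q)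

/-- The work tapes of a simulating machine: the tapes of the machine, an oracle tape, a tape for
the fixed part of the oracle, a clock, and a tape for the state. -/
abbrev SimWork (M : OracleTM) : Type := TapeName M.W ⊕ Fin 4

section

variable (M : OracleTM)

/-- The symbols of the simulated machine as symbols of the simulating machine. -/
def encSym : PointedMap (TapeSymbol M.Γ) (TapeSymbol (SimSym M)) where
  f
    | none => none
    | some (Sum.inl b) => some (Sum.inl b)
    | some (Sum.inr g) => some (Sum.inr (some (Sum.inl g)))
  map_pt' := rfl

/-- The symbols of the simulating machine as symbols of the simulated machine. -/
def decSym : TapeSymbol (SimSym M) → TapeSymbol M.Γ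
  | some (Sum.inl b) => some (Sum.inl b)
  | some (Sum.inr (some (Sum.inl g))) => some (Sum.inr g)
  | _ => none

theorem decSym_encSym (a : TapeSymbol M.Γ) : decSym M (encSym M a) = a := by
  rcases a with _ | (_ | _) <;> rfl

theorem encSym_eq_bit (a : TapeSymbol M.Γ) (b : Bool) :
    encSym M a = some (Sum.inl b) ↔ a = some (Sum.inl b) := by
  rcases a with _ | (_ | _) <;> simp [encSym]

/-- The symbol for a state. -/
def stateSym (q : M.Q) : TapeSymbol (SimSym M) := some (Sum.inr (some (Sum.inr q)))

/-- The state for a symbol. -/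
def symState : TapeSymbol (SimSym M) → Option M.Q
  | some (Sum.inr (some (Sum.inr q))) => some q
  | _ => none

/-- All tapes of the simulating machine. -/
def simTapes (inp : Tape (TapeSymbol (SimSym M)))
    (sim : TapeName M.W → Tape (TapeSymbol (SimSym M)))
    (orc fix clk st : Tape (TapeSymbol (SimSym M))) : Tapes (SimWork M) (SimSym M)
  | .input => inp
  | .query => Tape.mk₁ []
  | .work (Sum.inl i) => sim i
  | .work (Sum.inr 0) => orc
  | .work (Sum.inr 1) => fix
  | .work (Sum.inr 2) => clk
  | .work (Sum.inr 3) => st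

/-- The tape for the state. -/
def stateTape (q : M.Q) : Tape (TapeSymbol (SimSym M)) := Tape.mk₁ [stateSym M q]

/-- The tape for the fixed part of the oracle. -/
def fixTape (F : List Bool) : Tape (TapeSymbol (SimSym M)) :=
  Tape.mk₂ [mark] (F.map fun b => some (Sum.inl b))

/-- The oracle tape. -/
def orcTape (l : List (Option Bool)) : Tape (TapeSymbol (SimSym M)) := Tape.mk₁ (l.map cellSym)

end

variable {M : OracleTM} {A : Set (List Bool)}

local notation "orcN" => (TapeName.work (Sum.inr 0))
local notation "fixN" => (TapeName.work (Sum.inr 1))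
local notation "clkN" => (TapeName.work (Sum.inr 2))
local notation "stN" => (TapeName.work (Sum.inr 3))

section update

variable (inp : Tape (TapeSymbol (SimSym M))) (sim : TapeName M.W → Tape (TapeSymbol (SimSym M)))
  (orc fix clk st X : Tape (TapeSymbol (SimSym M)))

open Classical in
theorem update_orc : Function.update (simTapes M inp sim orc fix clk st) orcN X =
    simTapes M inp sim X fix clk st := by
  funext i
  rcases i with _ | _ | i | i
  · exact Function.update_of_ne (by simp) _ _
  · exact Function.update_of_ne (by simp) _ _
  · exact Function.update_of_ne (by simp) _ _
  · fin_cases i <;> simp [Function.update, simTapes]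

open Classical in
theorem update_fix : Function.update (simTapes M inp sim orc fix clk st) fixN X =
    simTapes M inp sim orc X clk st := by
  funext i
  rcases i with _ | _ | i | i
  · exact Function.update_of_ne (by simp) _ _
  · exact Function.update_of_ne (by simp) _ _
  · exact Function.update_of_ne (by simp) _ _
  · fin_cases i <;> simp [Function.update, simTapes]

open Classical in
theorem update_clk : Function.update (simTapes M inp sim orc fix clk st) clkN X =
    simTapes M inp sim orc fix X st := by
  funext i
  rcases i with _ | _ | i | i
  · exact Function.update_of_ne (by simp) _ _
  · exact Function.update_of_ne (by simp) _ _
  · exact Function.update_of_ne (by simp) _ _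
  · fin_cases i <;> simp [Function.update, simTapes]

open Classical in
theorem update_st : Function.update (simTapes M inp sim orc fix clk st) stN X =
    simTapes M inp sim orc fix clk X := by
  funext i
  rcases i with _ | _ | i | i
  · exact Function.update_of_ne (by simp) _ _
  · exact Function.update_of_ne (by simp) _ _
  · exact Function.update_of_ne (by simp) _ _
  · fin_cases i <;> simp [Function.update, simTapes]

end update

/-! #### One step of the simulated machine -/

/-- Perform the action of the current state. -/
def simAct (M : OracleTM) : Prog (SimWork M) (SimSym M) :=
  .op fun h i =>
    match symState M (h stN) with
    | none => (h i, none)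
    | some q =>
      match M.prog q with
      | .act δ =>
        match i with
        | .work (Sum.inl j) =>
          (encSym M ((δ fun k => decSym M (h (.work (Sum.inl k)))).2 j).1,
            ((δ fun k => decSym M (h (.work (Sum.inl k)))).2 j).2)
        | stN => (stateSym M (δ fun k => decSym M (h (.work (Sum.inl k)))).1, none)
        | _ => (h i, none)
      | _ => (h i, none)

/-- A step without query is the same for all oracles, so `B` is arbitrary. -/
theorem runsIn_simAct {inp orc fix clk : Tape (TapeSymbol (SimSym M))} (B : Set (List Bool))
    (c : M.Cfg) (hc : ∀ yes no, M.prog c.state ≠ .query yes no) :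
    RunsIn A (simAct M)
      (simTapes M inp (fun i => (c.tape i).map (encSym M)) orc fix clk (stateTape M c.state))
      (simTapes M inp (fun i => ((M.step B c).tape i).map (encSym M)) orc fix clk
        (stateTape M (M.step B c).state)) 1 := by
  refine RunsIn.op fun i => ?_
  have hst : symState M (heads (simTapes M inp (fun i => (c.tape i).map (encSym M)) orc fix clk
      (stateTape M c.state)) stN) = some c.state := rfl
  simp only [hst]
  rcases hp : M.prog c.state with b | ⟨yes, no⟩ | δ
  · rw [step_halt M B c hp]
    exact write_head _
  · exact (hc _ _ hp).elim
  · rw [step_act M B _ _ hp]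
    have hh : (fun k => decSym M (heads (simTapes M inp (fun i => (c.tape i).map (encSym M)) orc fix
        clk (stateTape M c.state)) (.work (Sum.inl k)))) = heads c.tape := by
      funext k
      change decSym M (((c.tape k).map (encSym M)).head) = _
      rw [Tape.map_fst, decSym_encSym]
      rfl
    simp only [hh]
    rcases i with _ | _ | i | i
    · exact write_head _
    · exact write_head _
    · change actTape ((c.tape i).map (encSym M)) (_, _) = (actTape (c.tape i) _).map (encSym M)
      rcases (δ (heads c.tape)).2 i with ⟨g, _ | d⟩
      · simp only [actTape_none, Tape.map_write]
      · simp only [actTape_some, Tape.map_write, Tape.map_move]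
    · fin_cases i
      · exact write_head _
      · exact write_head _
      · exact write_head _
      · rfl

/-- Move on the query tape, the oracle tape and the tape for the fixed part of the oracle. -/
def lookMove (M : OracleTM) (d : Dir) : Prog (SimWork M) (SimSym M) :=
  .op fun h i =>
    match i with
    | .work (Sum.inl .query) | orcN | fixN => (h i, some d)
    | _ => (h i, none)

open Classical in
/-- The tapes after a move of the three heads. -/
theorem runsIn_lookMove (d : Dir) {inp orc fix clk st : Tape (TapeSymbol (SimSym M))}
    {sim : TapeName M.W → Tape (TapeSymbol (SimSym M))} (X : Tape (TapeSymbol (SimSym M))) :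
    RunsIn A (lookMove M d)
      (simTapes M inp (Function.update sim .query X) orc fix clk st)
      (simTapes M inp (Function.update sim .query (X.move d)) (orc.move d) (fix.move d) clk st)
      1 := by
  refine RunsIn.op fun i => ?_
  rcases i with _ | _ | i | i
  · exact write_head _
  · exact write_head _
  · rcases i with _ | _ | i <;> simp [heads, simTapes]
  · fin_cases i <;> simp [heads, simTapes]

open Classical in
/-- Simulate a query. -/
noncomputable def simAsk (M : OracleTM) : Prog (SimWork M) (SimSym M) :=
  .seq (.loop (fun h => decide (h (.work (Sum.inl .query)) = some (Sum.inl true)))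
      (lookMove M Dir.right))
    (.seq (.op fun h i =>
        match i with
        | stN =>
          match symState M (h stN) with
          | none => (h i, none)
          | some q =>
            match M.prog q with
            | .query yes no =>
              (stateSym M (if h (.work (Sum.inl .query)) ≠ some (Sum.inl false) ∧
                (h fixN = some (Sum.inl true) ∨ (h fixN = none ∧ h orcN = some (Sum.inl true)))
                then yes else no), none)
            | _ => (h i, none)
        | _ => (h i, none))
      (.seq (.loop (fun h => decide (h fixN ≠ mark)) (lookMove M Dir.left))
        (lookMove M Dir.right)))

theorem nth_fixTape (F : List Bool) (p : ℕ) :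
    (fixTape M F).nth (p : ℤ) = ((F[p]?).map Sum.inl : Option (Bool ⊕ SimSym M)) := by
  rw [fixTape, Tape.mk₂, Tape.mk'_nth_nat, ListBlank.nth_mk, List.getI_eq_getElem?_getD,
    List.getElem?_map]
  cases F[p]? <;> rfl

theorem nth_orcTape (l : List (Option Bool)) (p : ℕ) :
    (orcTape M l).nth (p : ℤ) = ((l[p]?).bind cellSym : Option (Bool ⊕ SimSym M)) := by
  rw [orcTape, nth_mk₁_nat, List.getI_eq_getElem?_getD, List.getElem?_map]
  cases l[p]? <;> rfl

theorem nth_orcTape_eq_true (l : List (Option Bool)) (p : ℕ) :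
    (orcTape M l).nth (p : ℤ) = some (Sum.inl true) ↔ l[p]? = some (some true) := by
  rw [nth_orcTape]
  rcases l[p]? with _ | _ | _ | _ <;> simp [cellSym, mark]

theorem exists_first_ne {Γ : Type} {T : Tape (TapeSymbol Γ)} {R : ℕ} (hT : BlankBeyond R T) :
    ∃ j ≤ R + 1, (∀ i < j, T.nth (i : ℤ) = some (Sum.inl true)) ∧
      T.nth (j : ℤ) ≠ some (Sum.inl true) := by
  classical
  have hex : ∃ j : ℕ, T.nth (j : ℤ) ≠ some (Sum.inl true) :=
    ⟨R + 1, by rw [hT _ (by simp; omega)]; exact Option.some_ne_none _ |>.symm⟩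
  refine ⟨Nat.find hex, Nat.find_min' hex ?_, fun i hi => ?_, Nat.find_spec hex⟩
  · rw [hT _ (by simp; omega)]; exact Option.some_ne_none _ |>.symm
  · by_contra hc
    exact Nat.find_min hex hi hc

/-- Three heads run in parallel along the ones of the query. At the first other cell j they scan
cell j of the query tape, of the fixed part and of the oracle tape, which is all that
`exists_mem_holdsWord` requires. The mark to the left of the fixed part tells them when they are
back. -/
theorem runsIn_simAsk {inp clk : Tape (TapeSymbol (SimSym M))} (F : List Bool)
    (l : List (Option Bool)) (c : M.Cfg) {yes no : M.Q} (hc : M.prog c.state = .query yes no)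
    {R : ℕ} (hR : BlankBeyond R (c.tape .query)) :
    RunsIn A (simAsk M)
      (simTapes M inp (fun i => (c.tape i).map (encSym M)) (orcTape M l) (fixTape M F) clk
        (stateTape M c.state))
      (simTapes M inp (fun i => ((M.step (orcSet F l) c).tape i).map (encSym M)) (orcTape M l)
        (fixTape M F) clk (stateTape M (M.step (orcSet F l) c).state)) (4 * R + 12) := by
  classical
  obtain ⟨j, hjR, hj₁, hj₂⟩ := exists_first_ne hR
  rw [step_query M _ c.state c.tape hc]
  set q' := if ∃ w ∈ orcSet F l, HoldsWord (c.tape .query) w then yes else no with hq'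
  set sim : TapeName M.W → Tape (TapeSymbol (SimSym M)) :=
    fun i => (c.tape i).map (encSym M) with hsim
  set X := (c.tape .query).map (encSym M) with hX
  have hXn : ∀ i, X.nth i = encSym M ((c.tape .query).nth i) := fun i => nth_map _ _ _
  have hsX : sim = Function.update sim .query X := by
    rw [hX, show (c.tape .query).map (encSym M) = sim .query from rfl, Function.update_eq_self]
  have h₁ := RunsIn.loop_iterate (A := A)
    (c := fun h => decide (h (.work (Sum.inl .query)) = some (Sum.inl true)))
    (P := lookMove M Dir.right) (B := 1)
    (fun k => simTapes M inp (Function.update sim .query ((Tape.move Dir.right)^[k] X))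
      ((Tape.move Dir.right)^[k] (orcTape M l)) ((Tape.move Dir.right)^[k] (fixTape M F)) clk
      (stateTape M c.state)) j
    (fun k hk => by
      simp only [heads, simTapes, Function.update_self, decide_eq_true_eq]
      rw [head_shiftR, hXn, encSym_eq_bit]
      exact hj₁ k hk)
    (fun k hk => by
      simp only [Function.iterate_succ_apply']
      exact runsIn_lookMove Dir.right _)
    (by
      simp only [heads, simTapes, Function.update_self, decide_eq_false_iff_not]
      rw [head_shiftR, hXn, encSym_eq_bit]
      exact hj₂)
  have h₂ : RunsIn A (.op fun h i =>
        match i with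
        | stN =>
          match symState M (h stN) with
          | none => (h i, none)
          | some q =>
            match M.prog q with
            | .query yes no =>
              (stateSym M (if h (.work (Sum.inl .query)) ≠ some (Sum.inl false) ∧
                (h fixN = some (Sum.inl true) ∨ (h fixN = none ∧ h orcN = some (Sum.inl true)))
                then yes else no), none)
            | _ => (h i, none)
        | _ => (h i, none))
      (simTapes M inp (Function.update sim .query ((Tape.move Dir.right)^[j] X))
        ((Tape.move Dir.right)^[j] (orcTape M l)) ((Tape.move Dir.right)^[j] (fixTape M F)) clk
        (stateTape M c.state))
      (simTapes M inp (Function.update sim .query ((Tape.move Dir.right)^[j] X))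
        ((Tape.move Dir.right)^[j] (orcTape M l)) ((Tape.move Dir.right)^[j] (fixTape M F)) clk
        (stateTape M q')) 1 := by
    refine RunsIn.op fun i => ?_
    rcases i with _ | _ | i | i
    · exact write_head _
    · exact write_head _
    · exact write_head _
    · fin_cases i
      · exact write_head _
      · exact write_head _
      · exact write_head _
      · have hst : symState M (heads (simTapes M inp
            (Function.update sim .query ((Tape.move Dir.right)^[j] X))
            ((Tape.move Dir.right)^[j] (orcTape M l)) ((Tape.move Dir.right)^[j] (fixTape M F)) clk
            (stateTape M c.state)) stN) = some c.state := rfl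
        simp only [Fin.reduceFinMk, hst, hc]
        rw [actTape_none]
        have hcond : (heads (simTapes M inp
            (Function.update sim .query ((Tape.move Dir.right)^[j] X))
            ((Tape.move Dir.right)^[j] (orcTape M l)) ((Tape.move Dir.right)^[j] (fixTape M F)) clk
            (stateTape M c.state)) (.work (Sum.inl .query)) ≠ some (Sum.inl false) ∧
          (heads (simTapes M inp
            (Function.update sim .query ((Tape.move Dir.right)^[j] X))
            ((Tape.move Dir.right)^[j] (orcTape M l)) ((Tape.move Dir.right)^[j] (fixTape M F)) clk
            (stateTape M c.state)) fixN = some (Sum.inl true) ∨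
            (heads (simTapes M inp
            (Function.update sim .query ((Tape.move Dir.right)^[j] X))
            ((Tape.move Dir.right)^[j] (orcTape M l)) ((Tape.move Dir.right)^[j] (fixTape M F)) clk
            (stateTape M c.state)) fixN = none ∧
              heads (simTapes M inp
            (Function.update sim .query ((Tape.move Dir.right)^[j] X))
            ((Tape.move Dir.right)^[j] (orcTape M l)) ((Tape.move Dir.right)^[j] (fixTape M F)) clk
            (stateTape M c.state)) orcN = some (Sum.inl true)))) ↔
            ∃ w ∈ orcSet F l, HoldsWord (c.tape .query) w := by
          rw [exists_mem_holdsWord hj₁ hj₂]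
          simp only [heads, simTapes, Function.update_self, head_shiftR, hXn, ne_eq, encSym_eq_bit,
            nth_orcTape_eq_true, nth_fixTape]
          rcases F[j]? with _ | _ | _ <;> simp
        change Tape.write (stateSym M (if _ then yes else no)) _ = stateTape M q'
        rw [if_congr hcond rfl rfl]
        rfl
  -- The mark lies one cell to the left of the starting position; hence j + 1 moves, corrected by
  -- one move to the right.
  have h₃ := RunsIn.loop_iterate (A := A) (c := fun h => decide (h fixN ≠ mark))
    (P := lookMove M Dir.left) (B := 1)
    (fun k => simTapes M inp
      (Function.update sim .query ((Tape.move Dir.left)^[k] ((Tape.move Dir.right)^[j] X)))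
      ((Tape.move Dir.left)^[k] ((Tape.move Dir.right)^[j] (orcTape M l)))
      ((Tape.move Dir.left)^[k] ((Tape.move Dir.right)^[j] (fixTape M F))) clk
      (stateTape M q')) (j + 1)
    (fun k hk => by
      refine decide_eq_true ?_
      simp only [heads, simTapes]
      rw [← Tape.nth_zero, nth_shiftL, nth_shiftR,
        show (0 - (k : ℤ) + j) = ((j - k : ℕ) : ℤ) by omega, nth_fixTape]
      cases F[j - k]? <;> simp [mark])
    (fun k hk => by
      simp only [Function.iterate_succ_apply']
      exact runsIn_lookMove Dir.left _)
    (by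
      refine decide_eq_false (not_not.2 ?_)
      simp only [heads, simTapes]
      rw [← Tape.nth_zero, nth_shiftL, nth_shiftR,
        show (0 - ((j + 1 : ℕ) : ℤ) + j) = -1 by push_cast; ring]
      rfl)
  have h₄ := runsIn_lookMove (A := A) (M := M) Dir.right (inp := inp) (clk := clk)
    (st := stateTape M q') (sim := sim)
    (orc := (Tape.move Dir.left)^[j + 1] ((Tape.move Dir.right)^[j] (orcTape M l)))
    (fix := (Tape.move Dir.left)^[j + 1] ((Tape.move Dir.right)^[j] (fixTape M F)))
    ((Tape.move Dir.left)^[j + 1] ((Tape.move Dir.right)^[j] X))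
  have hback : ∀ T : Tape (TapeSymbol (SimSym M)),
      Tape.move Dir.right ((Tape.move Dir.left)^[j + 1] ((Tape.move Dir.right)^[j] T)) = T := by
    intro T
    rw [Function.iterate_succ_apply', shiftL_shiftR, Tape.move_left_right]
  rw [hback, hback, hback, ← hsX] at h₄
  simp only [Function.iterate_zero, id_eq, ← hsX] at h₁ h₃
  exact (h₁.seq (h₂.seq (h₃.seq h₄))).mono (by omega)

open Classical in
/-- Simulate one step. -/
noncomputable def simStep (M : OracleTM) : Prog (SimWork M) (SimSym M) :=
  .ite (fun h => decide (∃ q yes no, symState M (h stN) = some q ∧ M.prog q = .query yes no))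
    (simAsk M) (simAct M)

theorem runsIn_simStep {inp clk : Tape (TapeSymbol (SimSym M))} (F : List Bool)
    (l : List (Option Bool)) (c : M.Cfg) {R : ℕ} (hR : BlankBeyond R (c.tape .query)) :
    RunsIn A (simStep M)
      (simTapes M inp (fun i => (c.tape i).map (encSym M)) (orcTape M l) (fixTape M F) clk
        (stateTape M c.state))
      (simTapes M inp (fun i => ((M.step (orcSet F l) c).tape i).map (encSym M)) (orcTape M l)
        (fixTape M F) clk (stateTape M (M.step (orcSet F l) c).state)) (4 * R + 13) := by
  classical
  by_cases hc : ∃ yes no, M.prog c.state = .query yes no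
  · obtain ⟨yes, no, hc⟩ := hc
    refine RunsIn.ite_true ?_ (runsIn_simAsk F l c hc hR)
    rw [decide_eq_true_eq]
    exact ⟨c.state, yes, no, rfl, hc⟩
  · push Not at hc
    refine (RunsIn.ite_false ?_ (runsIn_simAct (orcSet F l) c hc)).mono (by omega)
    rw [decide_eq_false_iff_not]
    rintro ⟨q, yes, no, hq, hp⟩
    have : c.state = q := Option.some.inj hq
    subst this
    exact hc _ _ hp

end SpeedLow

namespace SpeedLow

open Turing

variable {M : OracleTM} {A : Set (List Bool)}

local notation "orcN" => (TapeName.work (Sum.inr 0))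
local notation "fixN" => (TapeName.work (Sum.inr 1))
local notation "clkN" => (TapeName.work (Sum.inr 2))
local notation "stN" => (TapeName.work (Sum.inr 3))

/-! #### Clearing the simulated tapes -/

theorem nth_erase_iterate {G : Type} [Inhabited G] (T : Tape G) (k : ℕ) (i : ℤ) :
    ((fun T : Tape G => (T.write default).move Dir.right)^[k] T).nth i =
      if -(k : ℤ) ≤ i ∧ i < 0 then default else T.nth (i + k) := by
  induction k generalizing i with
  | zero => rw [if_neg (by push_cast; omega)]; simp
  | succ k ih =>
    rw [Function.iterate_succ_apply', Tape.move_right_nth, Tape.write_nth, ih]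
    push_cast
    by_cases h₁ : i + 1 = 0
    · rw [if_pos h₁, if_pos (by omega)]
    · rw [if_neg h₁]
      by_cases h₂ : -(k : ℤ) ≤ i + 1 ∧ i + 1 < 0
      · rw [if_pos h₂, if_pos (by omega)]
      · rw [if_neg h₂, if_neg (by omega), show i + 1 + (k : ℤ) = i + (k + 1) by ring]

/-- After 2N moves to the left the head is beyond everything nonblank, and 4N erasures then sweep
the positions from -2N to 2N - 1. -/
theorem erase_eq_blank {G : Type} [Inhabited G] {T : Tape G} {R N : ℕ} (hT : BlankBeyond R T)
    (hR : R < 2 * N) :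
    (fun T : Tape G => (T.write default).move Dir.right)^[4 * N] ((Tape.move Dir.left)^[2 * N] T) =
      Tape.mk₁ [] := by
  refine tape_ext fun i => ?_
  rw [nth_erase_iterate, nth_shiftL]
  have hb : (Tape.mk₁ ([] : List G)).nth i = default := by
    by_cases hi : i = 0
    · subst hi; rfl
    · exact blankBeyond_mk₁ [] i (by simp; omega)
  rw [hb]
  split_ifs with h
  · rfl
  · exact hT _ (by push_cast; omega)

/-- Move all heads of the simulated machine, erasing the scanned symbols if `e` holds. -/
def sweep (M : OracleTM) (e : Bool) (d : Dir) : Prog (SimWork M) (SimSym M) :=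
  .op fun h i =>
    match i with
    | .work (Sum.inl _) => (if e then none else h i, some d)
    | _ => (h i, none)

theorem runsIn_sweep_false (d : Dir) {inp orc fix clk st : Tape (TapeSymbol (SimSym M))}
    {sim : TapeName M.W → Tape (TapeSymbol (SimSym M))} :
    RunsIn A (sweep M false d) (simTapes M inp sim orc fix clk st)
      (simTapes M inp (fun i => (sim i).move d) orc fix clk st) 1 := by
  refine RunsIn.op fun i => ?_
  rcases i with _ | _ | i | i
  · exact write_head _
  · exact write_head _
  · simp [heads, simTapes]
  · fin_cases i <;> exact write_head _

theorem runsIn_sweep_true (d : Dir) {inp orc fix clk st : Tape (TapeSymbol (SimSym M))}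
    {sim : TapeName M.W → Tape (TapeSymbol (SimSym M))} :
    RunsIn A (sweep M true d) (simTapes M inp sim orc fix clk st)
      (simTapes M inp (fun i => ((sim i).write default).move d) orc fix clk st) 1 := by
  refine RunsIn.op fun i => ?_
  rcases i with _ | _ | i | i
  · exact write_head _
  · exact write_head _
  · simp [simTapes]; rfl
  · fin_cases i <;> exact write_head _

/-- Erase the tapes of the simulated machine. -/
noncomputable def simClear (M : OracleTM) : Prog (SimWork M) (SimSym M) :=
  .seq (.times clkN (.seq (sweep M false Dir.left) (sweep M false Dir.left)))
    (.times clkN (.seq (.seq (sweep M true Dir.right) (sweep M true Dir.right))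
      (.seq (sweep M true Dir.right) (sweep M true Dir.right))))

theorem runsIn_simClear {inp orc fix st : Tape (TapeSymbol (SimSym M))}
    {sim : TapeName M.W → Tape (TapeSymbol (SimSym M))} {R N : ℕ} (hR : R < 2 * N)
    (h : ∀ i, BlankBeyond R (sim i)) :
    RunsIn A (simClear M) (simTapes M inp sim orc fix (unary N) st)
      (simTapes M inp (fun _ => Tape.mk₁ []) orc fix (unary N) st) (14 * N + 8) := by
  classical
  have h₁ := RunsIn.times (A := A) (i := clkN)
    (P := .seq (sweep M false Dir.left) (sweep M false Dir.left)) (B := 2)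
    (fun k => simTapes M inp (fun i => (Tape.move Dir.left)^[2 * k] (sim i)) orc fix (unary N) st) N
    (fun k _ X => by
      rw [update_clk, update_clk]
      simp only [Nat.mul_add, Nat.mul_one, Function.iterate_succ_apply']
      exact (runsIn_sweep_false _).seq (runsIn_sweep_false _))
  have h₂ := RunsIn.times (A := A) (i := clkN)
    (P := .seq (.seq (sweep M true Dir.right) (sweep M true Dir.right))
      (.seq (sweep M true Dir.right) (sweep M true Dir.right))) (B := 4)
    (fun k => simTapes M inp (fun i =>
      (fun T : Tape (TapeSymbol (SimSym M)) => (T.write default).move Dir.right)^[4 * k]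
        ((Tape.move Dir.left)^[2 * N] (sim i))) orc fix (unary N) st) N
    (fun k _ X => by
      rw [update_clk, update_clk]
      simp only [Nat.mul_add, Nat.mul_one, Function.iterate_succ_apply']
      exact ((runsIn_sweep_true _).seq (runsIn_sweep_true _)).seq
        ((runsIn_sweep_true _).seq (runsIn_sweep_true _)))
  simp only [update_clk, Nat.mul_zero, Function.iterate_zero, id_eq] at h₁ h₂
  simp only [fun i => erase_eq_blank (h i) hR] at h₂
  exact (h₁.seq h₂).mono (by omega)

/-! #### Copying the input -/

/-- The tape with the word `x`. -/
def bitTape (M : OracleTM) (x : List Bool) : Tape (TapeSymbol (SimSym M)) :=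
  Tape.mk₁ (x.map fun b => some (Sum.inl b))

theorem nth_bitTape_take (x : List Bool) (k m : ℕ) :
    (bitTape M (x.take k)).nth (m : ℤ) = if m < k then (bitTape M x).nth (m : ℤ) else none := by
  rw [bitTape, bitTape, nth_mk₁_nat, nth_mk₁_nat, List.getI_eq_getElem?_getD,
    List.getI_eq_getElem?_getD, List.getElem?_map, List.getElem?_map, List.getElem?_take]
  split_ifs <;> rfl

theorem bitTape_take_succ (x : List Bool) (k : ℕ) :
    (((Tape.move Dir.right)^[k] (bitTape M (x.take k))).write ((bitTape M x).nth k)).move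
        Dir.right = (Tape.move Dir.right)^[k + 1] (bitTape M (x.take (k + 1))) := by
  rw [Function.iterate_succ_apply']
  congr 1
  refine tape_ext fun i => ?_
  rw [Tape.write_nth, nth_shiftR, nth_shiftR]
  by_cases hi : i = 0
  · subst hi
    rw [if_pos rfl, zero_add, nth_bitTape_take, if_pos (by omega)]
  · rw [if_neg hi]
    rcases h : i + (k : ℤ) with m | m
    · have hm : (m : ℤ) = i + k := h.symm
      change (bitTape M (x.take k)).nth (m : ℤ) = (bitTape M (x.take (k + 1))).nth (m : ℤ)
      rw [nth_bitTape_take, nth_bitTape_take]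
      by_cases hmk : m < k
      · rw [if_pos hmk, if_pos (by omega)]
      · rw [if_neg hmk, if_neg (by omega)]
    · exact (nth_mk₁_negSucc _ m).trans (nth_mk₁_negSucc _ m).symm

/-- Copy one symbol of the input. -/
def copySym (M : OracleTM) : Prog (SimWork M) (SimSym M) :=
  .op fun h i =>
    match i with
    | .input | .work (Sum.inl .input) => (h .input, some Dir.right)
    | _ => (h i, none)

/-- Move back on the input and on its copy. -/
def copyBack (M : OracleTM) : Prog (SimWork M) (SimSym M) :=
  .op fun h i =>
    match i with
    | .input | .work (Sum.inl .input) => (h i, some Dir.left)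
    | _ => (h i, none)

open Classical in
/-- The simulated tapes while the input is being copied. -/
noncomputable def copyState (M : OracleTM) (X : Tape (TapeSymbol (SimSym M))) :
    TapeName M.W → Tape (TapeSymbol (SimSym M)) :=
  Function.update (fun _ => Tape.mk₁ []) .input X

theorem runsIn_copySym {inp orc fix clk st X : Tape (TapeSymbol (SimSym M))} :
    RunsIn A (copySym M) (simTapes M inp (copyState M X) orc fix clk st)
      (simTapes M (inp.move Dir.right) (copyState M ((X.write inp.head).move Dir.right)) orc fix clk
        st) 1 := by
  refine RunsIn.op fun i => ?_
  rcases i with _ | _ | i | i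
  · simp [heads, simTapes]
  · exact write_head _
  · rcases i with _ | _ | i <;> simp [heads, simTapes, copyState]
  · fin_cases i <;> exact write_head _

theorem runsIn_copyBack {inp orc fix clk st X : Tape (TapeSymbol (SimSym M))} :
    RunsIn A (copyBack M) (simTapes M inp (copyState M X) orc fix clk st)
      (simTapes M (inp.move Dir.left) (copyState M (X.move Dir.left)) orc fix clk st) 1 := by
  refine RunsIn.op fun i => ?_
  rcases i with _ | _ | i | i
  · simp [heads, simTapes]
  · exact write_head _
  · rcases i with _ | _ | i <;> simp [heads, simTapes, copyState]
  · fin_cases i <;> exact write_head _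

/-- Copy the input as far as the clock says. -/
noncomputable def simCopy (M : OracleTM) : Prog (SimWork M) (SimSym M) :=
  .seq (.times clkN (copySym M)) (.times clkN (copyBack M))

/-- Only N letters are copied, as N simulated steps cannot depend on more. Copying the whole input
would make the running time depend on its length, which the time bound of the simulated machine need
not dominate. -/
theorem runsIn_simCopy {orc fix st : Tape (TapeSymbol (SimSym M))} (x : List Bool) (N : ℕ) :
    RunsIn A (simCopy M)
      (simTapes M (bitTape M x) (fun _ => Tape.mk₁ []) orc fix (unary N) st)
      (simTapes M (bitTape M x) (fun i => ((M.init (x.take N)).tape i).map (encSym M)) orc fix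
        (unary N) st) (10 * N + 8) := by
  classical
  have h₁ := RunsIn.times (A := A) (i := clkN) (P := copySym M) (B := 1)
    (fun k => simTapes M ((Tape.move Dir.right)^[k] (bitTape M x))
      (copyState M ((Tape.move Dir.right)^[k] (bitTape M (x.take k)))) orc fix (unary N) st) N
    (fun k _ X => by
      simp only [update_clk]
      have := runsIn_copySym (A := A) (M := M) (inp := (Tape.move Dir.right)^[k] (bitTape M x))
        (orc := orc) (fix := fix) (clk := X) (st := st)
        (X := (Tape.move Dir.right)^[k] (bitTape M (x.take k)))
      rwa [head_shiftR, bitTape_take_succ, ← Function.iterate_succ_apply' (Tape.move Dir.right)]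
        at this)
  have h₂ := RunsIn.times (A := A) (i := clkN) (P := copyBack M) (B := 1)
    (fun k => simTapes M ((Tape.move Dir.left)^[k] ((Tape.move Dir.right)^[N] (bitTape M x)))
      (copyState M ((Tape.move Dir.left)^[k]
        ((Tape.move Dir.right)^[N] (bitTape M (x.take N))))) orc fix (unary N) st) N
    (fun k _ X => by
      simp only [update_clk, Function.iterate_succ_apply']
      exact runsIn_copyBack)
  simp only [update_clk, Function.iterate_zero, id_eq, shiftL_shiftR] at h₁ h₂
  have hs : copyState M (bitTape M (x.take 0)) = fun _ => Tape.mk₁ [] := by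
    funext i
    rcases i with _ | _ | i <;> simp [copyState, bitTape]
  have he : copyState M (bitTape M (x.take N)) =
      fun i => ((M.init (x.take N)).tape i).map (encSym M) := by
    funext i
    rcases i with _ | _ | i
    · rw [copyState, Function.update_self, bitTape]
      change _ = (Tape.mk₁ _).map _
      rw [Tape.map_mk₁, List.map_map]
      rfl
    · rw [copyState, Function.update_of_ne (by simp)]
      rfl
    · rw [copyState, Function.update_of_ne (by simp)]
      rfl
  rw [hs] at h₁
  rw [he] at h₂
  exact (h₁.seq h₂).mono (by omega)

/-! #### A round of the simulation -/

/-- The configuration at the end of round `n`. -/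
noncomputable def roundCfg (M : OracleTM) (F x : List Bool) (n : ℕ) : M.Cfg :=
  (M.step (orcSet F (orcSucc^[n] [])))^[n] (M.init (x.take n))

/-- The tapes at the end of round `n`. -/
noncomputable def roundTapes (M : OracleTM) (F x : List Bool) (n : ℕ) :
    Tapes (SimWork M) (SimSym M) :=
  simTapes M (bitTape M x) (fun i => ((roundCfg M F x n).tape i).map (encSym M))
    (orcTape M (orcSucc^[n] [])) (fixTape M F) (unary n) (stateTape M (roundCfg M F x n).state)

/-- One round: enlarge the oracle and the time bound, and simulate. -/
noncomputable def simRound (M : OracleTM) : Prog (SimWork M) (SimSym M) :=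
  .seq (.orcNext orcN) (.seq (.extend clkN) (.seq (simClear M) (.seq (simCopy M)
    (.seq (.on stN fun _ => (stateSym M M.start, none)) (.times clkN (simStep M))))))

theorem BlankBeyond.map_encSym {T : Tape (TapeSymbol M.Γ)} {R : ℕ} (h : BlankBeyond R T) :
    BlankBeyond R (T.map (encSym M)) :=
  fun i hi => by rw [nth_map, h i hi]; rfl

/-- Every phase is linear in n except the last one, which simulates n + 1 steps at linear cost each.
-/
theorem runsIn_simRound (F x : List Bool) (n : ℕ) :
    RunsIn A (simRound M) (roundTapes M F x n) (roundTapes M F x (n + 1)) (100 * (n + 1) ^ 2) := by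
  classical
  have h₁ := RunsIn.orcNext (A := A) (i := orcN) (T := roundTapes M F x n) (orcSucc^[n] [])
  rw [roundTapes, update_orc, update_orc] at h₁
  rw [← Function.iterate_succ_apply' orcSucc, length_orcSucc_iterate] at h₁
  have h₂ := RunsIn.extend (A := A) (i := clkN) (T := simTapes M (bitTape M x)
    (fun i => ((roundCfg M F x n).tape i).map (encSym M))
    (orcTape M (orcSucc^[n + 1] [])) (fixTape M F) (unary n)
    (stateTape M (roundCfg M F x n).state)) n
  rw [update_clk, update_clk] at h₂
  -- In round n the machine was given at most n letters and made n steps, so nothing is written at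
  -- distance more than 2n from a head; the clock already shows n + 1.
  have h₃ := runsIn_simClear (A := A) (M := M) (inp := bitTape M x)
    (orc := orcTape M (orcSucc^[n + 1] [])) (fix := fixTape M F)
    (st := stateTape M (roundCfg M F x n).state)
    (sim := fun i => ((roundCfg M F x n).tape i).map (encSym M)) (R := 2 * n) (N := n + 1)
    (by omega) (fun i => by
      refine BlankBeyond.map_encSym ?_
      have := (blankBeyond_init M (x.take n) i).iterate (orcSet F (orcSucc^[n] [])) n
      exact this.mono (by have := List.length_take_le n x; omega))
  have h₄ := runsIn_simCopy (A := A) (M := M) (orc := orcTape M (orcSucc^[n + 1] []))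
    (fix := fixTape M F) (st := stateTape M (roundCfg M F x n).state) x (n + 1)
  have h₅ : RunsIn A (.on stN fun _ => (stateSym M M.start, none))
      (simTapes M (bitTape M x) (fun i => ((M.init (x.take (n + 1))).tape i).map (encSym M))
        (orcTape M (orcSucc^[n + 1] [])) (fixTape M F) (unary (n + 1))
        (stateTape M (roundCfg M F x n).state))
      (simTapes M (bitTape M x) (fun i => ((M.init (x.take (n + 1))).tape i).map (encSym M))
        (orcTape M (orcSucc^[n + 1] [])) (fixTape M F) (unary (n + 1))
          (stateTape M M.start)) 1 := by
    have := RunsIn.on (A := A) (i := stN) (f := fun _ => (stateSym M M.start, none))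
      (T := simTapes M (bitTape M x) (fun i => ((M.init (x.take (n + 1))).tape i).map (encSym M))
        (orcTape M (orcSucc^[n + 1] [])) (fixTape M F) (unary (n + 1))
        (stateTape M (roundCfg M F x n).state)) (X := stateTape M (roundCfg M F x n).state)
      (Y := stateTape M M.start) rfl
    rwa [update_st, update_st] at this
  have h₆ := RunsIn.times (A := A) (i := clkN) (P := simStep M) (B := 4 * (n + 1) + 13)
    (fun k => simTapes M (bitTape M x)
      (fun i => (((M.step (orcSet F (orcSucc^[n + 1] [])))^[k]
        (M.init (x.take (n + 1)))).tape i).map (encSym M))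
      (orcTape M (orcSucc^[n + 1] [])) (fixTape M F) (unary (n + 1))
      (stateTape M ((M.step (orcSet F (orcSucc^[n + 1] [])))^[k]
        (M.init (x.take (n + 1)))).state)) (n + 1)
    (fun k hk X => by
      simp only [update_clk]
      have hb := (blankBeyond_init_query M (x.take (n + 1))).iterate
        (orcSet F (orcSucc^[n + 1] [])) k
      simp only [Function.iterate_succ_apply' (M.step _)]
      exact (runsIn_simStep F _ _ hb).mono (by omega))
  simp only [update_clk] at h₆
  refine (h₁.seq (h₂.seq (h₃.seq (h₄.seq (h₅.seq h₆))))).mono ?_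
  ring_nf
  nlinarith [Nat.zero_le n]

/-! #### The simulating machine -/

open Classical in
/-- Simulate with more and more oracles until an answer is found. -/
noncomputable def simLoop (M : OracleTM) : Prog (SimWork M) (SimSym M) :=
  .loop (fun h => decide (∃ q, symState M (h stN) = some q ∧ ∀ b, M.prog q ≠ .halt b)) (simRound M)

theorem symState_roundTapes (F x : List Bool) (n : ℕ) :
    symState M (heads (roundTapes M F x n) stN) = some (roundCfg M F x n).state := rfl

/-- Round n + k is known to halt, but an earlier round, with another oracle, may halt before it and
with another answer. That such an answer is harmless is a matter of the choice of `F` and is shown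
later. -/
theorem runsIn_simLoop (F x : List Bool) (k n : ℕ) {b : Bool}
    (h : M.prog (roundCfg M F x (n + k)).state = .halt b) :
    ∃ n' b', M.prog (roundCfg M F x n').state = .halt b' ∧
      RunsIn A (simLoop M) (roundTapes M F x n) (roundTapes M F x n')
        (k * (100 * (n + k) ^ 2 + 1) + 1) := by
  classical
  induction k generalizing n with
  | zero =>
    refine ⟨n, b, h, (RunsIn.loop_false ?_).mono (by omega)⟩
    refine decide_eq_false ?_
    rintro ⟨q, hq, hp⟩
    rw [symState_roundTapes] at hq
    cases hq
    exact hp _ h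
  | succ k ih =>
    by_cases hn : ∃ b', M.prog (roundCfg M F x n).state = .halt b'
    · obtain ⟨b', hb'⟩ := hn
      refine ⟨n, b', hb', (RunsIn.loop_false ?_).mono (by omega)⟩
      refine decide_eq_false ?_
      rintro ⟨q, hq, hp⟩
      rw [symState_roundTapes] at hq
      cases hq
      exact hp _ hb'
    · push Not at hn
      rw [show n + (k + 1) = n + 1 + k by ring] at h ⊢
      obtain ⟨n', b', hb', hrun⟩ := ih (n + 1) h
      refine ⟨n', b', hb', (RunsIn.loop_true ?_ (runsIn_simRound F x n) hrun).mono ?_⟩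
      · exact decide_eq_true ⟨_, symState_roundTapes F x n, hn⟩
      · have : 100 * (n + 1) ^ 2 ≤ 100 * (n + 1 + k) ^ 2 :=
          Nat.mul_le_mul_left _ (Nat.pow_le_pow_left (by omega) 2)
        rw [add_mul]
        omega

/-- The program of the simulating machine. -/
noncomputable def simProg (M : OracleTM) (F : List Bool) : Prog (SimWork M) (SimSym M) :=
  .seq (.putLeft fixN (mark :: F.map fun b => some (Sum.inl b)))
    (.seq (.go fixN Dir.right) (.seq (.on stN fun _ => (stateSym M M.start, none)) (simLoop M)))

theorem finite_tapeName (W : Type) [Finite W] : Finite (TapeName W) := by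
  have : Function.Surjective (fun o : Option (Option W) => match o with
      | none => TapeName.input
      | some none => TapeName.query
      | some (some w) => TapeName.work w) := by
    rintro (_ | _ | w)
    exacts [⟨none, rfl⟩, ⟨some none, rfl⟩, ⟨some (some w), rfl⟩]
  exact Finite.of_surjective _ this

open Classical in
/-- The answer of the simulated machine. -/
noncomputable def simOut (M : OracleTM) (h : Heads (SimWork M) (SimSym M)) : Bool :=
  decide (∃ q, symState M (h stN) = some q ∧ M.prog q = .halt true)

/-- The simulating machine. -/
noncomputable def simMachine (M : OracleTM) (F : List Bool) : OracleTM :=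
  have := M.finite_Q
  have := M.finite_Γ
  have := M.finite_W
  have := finite_tapeName M.W
  (simProg M F).machine (simOut M)

theorem askFree_putLeft {W Γ : Type} (i : TapeName W) (l : List (TapeSymbol Γ)) :
    (Prog.putLeft i l).AskFree := by
  induction l with
  | nil => trivial
  | cons a l ih => exact ⟨ih, trivial, trivial⟩

theorem simMachine_oracleFree (M : OracleTM) (F : List Bool) : (simMachine M F).OracleFree := by
  have := M.finite_Q
  have := M.finite_Γ
  have := M.finite_W
  have := finite_tapeName M.W
  refine Prog.machine_oracleFree (P := simProg M F) ?_ _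
  refine ⟨askFree_putLeft _ _, trivial, trivial, ?_⟩
  simp [simLoop, simRound, Prog.AskFree, Prog.orcNext, Prog.orcStep, Prog.rewind, Prog.slide,
    Prog.go, Prog.on, Prog.extend, simClear, simCopy, Prog.times, sweep, copySym, copyBack,
    simStep, simAsk, simAct, lookMove]

/-- At most N rounds of at most 100 N² steps each, plus the time to write `F`. The answer is
certified only as that of some simulated oracle, not necessarily of the N-th one. -/
theorem simMachine_answersWithin (M : OracleTM) (F x : List Bool) {N : ℕ} {b : Bool}
    (h : M.AnswersWithin (orcSet F (orcSucc^[N] [])) x N b) :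
    ∃ n' b', M.AnswersWithin (orcSet F (orcSucc^[n'] [])) x n' b' ∧
      (simMachine M F).AnswersWithin A x
        (N * (100 * N ^ 2 + 1) + (2 * F.length + 7)) b' := by
  classical
  have := M.finite_Q
  have := M.finite_Γ
  have := M.finite_W
  have := finite_tapeName M.W
  have h₁ := RunsIn.putLeft (A := A) (i := fixN) (T := simTapes M (bitTape M x)
    (fun _ => Tape.mk₁ []) (Tape.mk₁ []) (Tape.mk₁ []) (Tape.mk₁ []) (Tape.mk₁ [])) []
    (mark :: F.map fun b => some (Sum.inl b))
  have h₂ := RunsIn.go (A := A) (i := fixN) Dir.right (T := simTapes M (bitTape M x)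
    (fun _ => Tape.mk₁ []) (Tape.mk₁ []) (Tape.mk₁ []) (Tape.mk₁ []) (Tape.mk₁ []))
    (X := Tape.mk₁ ((mark :: F.map fun b => some (Sum.inl b)) ++ []))
  have h₃ := RunsIn.on (A := A) (i := stN) (f := fun _ => (stateSym M M.start, none))
    (T := simTapes M (bitTape M x) (fun _ => Tape.mk₁ []) (Tape.mk₁ []) (fixTape M F)
      (Tape.mk₁ []) (Tape.mk₁ [])) (X := Tape.mk₁ []) (Y := stateTape M M.start) rfl
  have hf : (Tape.mk₁ ((mark :: F.map fun b => some (Sum.inl b)) ++ [])).move Dir.right =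
      fixTape M F := by
    rw [List.append_nil, mk₁_eq_mk₂, move_right_mk₂_cons]
    rfl
  rw [update_fix, update_fix] at h₁ h₂
  rw [hf] at h₂
  rw [update_st, update_st] at h₃
  have hN : M.prog (roundCfg M F x (0 + N)).state = .halt b := by
    rw [zero_add]
    exact AnswersWithin.congr_input h (by rw [List.take_take, min_self])
  obtain ⟨n', b', hb', h₄⟩ := runsIn_simLoop (A := A) F x N 0 hN
  -- Round 0, with empty oracle tape, clock at zero and no letter of the input, is the state after
  -- the preparations.
  have hz : roundTapes M F x 0 = simTapes M (bitTape M x) (fun _ => Tape.mk₁ []) (Tape.mk₁ [])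
      (fixTape M F) (Tape.mk₁ []) (stateTape M M.start) := by
    rw [roundTapes]
    congr 1
    funext i
    rcases i with _ | _ | i <;> rfl
  rw [hz] at h₄
  obtain ⟨t, ht, hex⟩ := h₁.seq (h₂.seq (h₃.seq h₄))
  refine ⟨n', b', AnswersWithin.congr_input (x := x.take n') hb'
    (by rw [List.take_take, min_self]), ?_⟩
  have hi : initTapes (SimWork M) (SimSym M) x = simTapes M (bitTape M x) (fun _ => Tape.mk₁ [])
      (Tape.mk₁ []) (Tape.mk₁ []) (Tape.mk₁ []) (Tape.mk₁ []) := by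
    funext i
    rcases i with _ | _ | i | i
    · rfl
    · rfl
    · rfl
    · fin_cases i <;> rfl
  rw [← hi] at hex
  have hans := Exec.answersWithin (out := simOut M) hex
    (t' := N * (100 * N ^ 2 + 1) + (2 * F.length + 7)) (by
      simp only [List.length_cons, List.length_map, zero_add] at ht
      omega)
  have hb : simOut M (heads (roundTapes M F x n')) = b' := by
    rw [simOut, symState_roundTapes]
    cases b' <;> simp [hb']
  rw [hb] at hans
  exact hans

end SpeedLow

namespace SpeedLow

/-! ### Sufficiently generic sparse languages are low for speed -/

/-- The language of all words of ones of length `2 ^ (j + 1) - 2` where `X j` holds. -/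
def sparseLang (X : ℕ → Bool) : Set (List Bool) :=
  {w | ∃ j, X j = true ∧ w = List.replicate (2 ^ (j + 1) - 2) true}

theorem two_le_two_pow_succ (j : ℕ) : 2 ≤ 2 ^ (j + 1) := by
  rw [pow_succ]
  have := Nat.one_le_two_pow (n := j)
  omega

theorem sparse_injective {i j : ℕ} (h : 2 ^ (i + 1) - 2 = 2 ^ (j + 1) - 2) : i = j := by
  have hi := two_le_two_pow_succ i
  have hj := two_le_two_pow_succ j
  have : 2 ^ (i + 1) = 2 ^ (j + 1) := by omega
  have := Nat.pow_right_injective (le_refl 2) this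
  omega

theorem le_sparse (j : ℕ) : j ≤ 2 ^ (j + 1) - 2 := by
  have : j + 2 ≤ 2 ^ (j + 1) := by
    induction j with
    | zero => norm_num
    | succ j ih => rw [pow_succ]; omega
  omega

theorem mem_sparseLang_congr {X Y : ℕ → Bool} {n : ℕ}
    (h : ∀ j, 2 ^ (j + 1) - 2 ≤ n → X j = Y j) (w : List Bool) (hw : w.length ≤ n) :
    w ∈ sparseLang X ↔ w ∈ sparseLang Y := by
  constructor
  · rintro ⟨j, hj, rfl⟩
    exact ⟨j, by rw [← h j (by simpa using hw), hj], rfl⟩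
  · rintro ⟨j, hj, rfl⟩
    exact ⟨j, by rw [h j (by simpa using hw), hj], rfl⟩

/-- The sets for which some computation of `M` gives a wrong answer about `L`. -/
def badSets (M : OracleTM) (L : Set (List Bool)) : Set (ℕ → Bool) :=
  {X | ∃ x t b, M.AnswersWithin (sparseLang X) x t b ∧ ¬(b = true ↔ x ∈ L)}

/-- Membership in `U` is determined by a finite part of the set. -/
def FinitelyWitnessed (U : Set (ℕ → Bool)) : Prop :=
  ∀ X ∈ U, ∃ m, ∀ Y : ℕ → Bool, (∀ j < m, Y j = X j) → Y ∈ U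

/-- A finite part of `X` decides whether `X` belongs to `U`. -/
def Decides (X : ℕ → Bool) (U : Set (ℕ → Bool)) : Prop :=
  X ∈ U ∨ ∃ m, ∀ Y : ℕ → Bool, (∀ j < m, Y j = X j) → Y ∉ U

/-- A wrong answer after t steps has used only oracle words of length at most t. -/
theorem finitelyWitnessed_badSets (M : OracleTM) (L : Set (List Bool)) :
    FinitelyWitnessed (badSets M L) := by
  rintro X ⟨x, t, b, h, hb⟩
  refine ⟨t + 1, fun Y hY => ⟨x, t, b, AnswersWithin.congr_oracle h fun w hw => ?_, hb⟩⟩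
  exact mem_sparseLang_congr (fun j hj => (hY j (by have := le_sparse j; omega)).symm) w hw

-- Since the digits of the counter sit at the lengths of the admissible words, each simulated oracle
-- is again a sparse language: that of a set which agrees with `X` on the fixed part and continues
-- with `bs`, digits beyond `bs` counting as `false`.
open Classical in
theorem orcSet_eq_sparseLang (X : ℕ → Bool) (m : ℕ) (bs : List Bool) :
    orcSet ((List.range m).map fun p => decide (List.replicate p true ∈ sparseLang X))
      (orcList bs) =
    sparseLang fun j => if 2 ^ (j + 1) - 2 < m then X j else decide (bs[j]? = some true) := by
  have hmem : ∀ j, List.replicate (2 ^ (j + 1) - 2) true ∈ sparseLang X ↔ X j = true := by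
    intro j
    constructor
    · rintro ⟨i, hi, h⟩
      have := congrArg List.length h
      simp only [List.length_replicate] at this
      rw [sparse_injective this, hi]
    · exact fun h => ⟨j, h, rfl⟩
  ext w
  constructor
  · rintro ⟨p, rfl, hp⟩
    by_cases hpm : p < m
    · have hp' : List.replicate p true ∈ sparseLang X := by
        simpa [hpm] using hp
      obtain ⟨j, hj, h⟩ := hp'
      have := congrArg List.length h
      simp only [List.length_replicate] at this
      subst this
      exact ⟨j, by simp only [hpm, if_true, hj], rfl⟩
    · have hp' : (orcList bs)[p]? = some (some true) := by
        simpa [hpm] using hp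
      obtain ⟨i, hi, hbs⟩ := (getElem?_orcList bs p true).1 hp'
      have hpi : p = 2 ^ (i + 1) - 2 := by omega
      subst hpi
      exact ⟨i, by simp [hpm, hbs], rfl⟩
  · rintro ⟨j, hj, rfl⟩
    refine ⟨_, rfl, ?_⟩
    by_cases hpm : 2 ^ (j + 1) - 2 < m
    · simp only [hpm, if_true] at hj
      left
      rw [List.getElem?_map, List.getElem?_range hpm]
      simpa using (hmem j).2 hj
    · simp only [hpm, if_false, decide_eq_true_eq] at hj
      right
      refine ⟨by simpa using hpm, (getElem?_orcList bs _ true).2 ⟨j, ?_, hj⟩⟩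
      have := two_le_two_pow_succ j
      omega

/-- If `X` is generic, then its sparse language is low for speed. -/
theorem lowForSpeed_sparseLang {X : ℕ → Bool}
    (hX : ∀ (M : OracleTM) (L : Set (List Bool)), (ComputablePred fun x => x ∈ L) →
      Decides X (badSets M L)) : LowForSpeed (sparseLang X) := by
  classical
  intro L hL M f hM
  have hgood : X ∉ badSets M L := by
    rintro ⟨x, t, b, hb, hbL⟩
    obtain ⟨b', hb', hbL'⟩ := hM x
    rw [AnswersWithin.unique hb hb'] at hbL
    exact hbL hbL'
  obtain hU | ⟨m, hm⟩ := hX M L hL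
  · exact (hgood hU).elim
  -- The length 2^(m+1) covers 2^(j+1) - 2 for all j < m, so every simulated oracle agrees with `X`
  -- below m.
  set F := (List.range (2 ^ (m + 1))).map fun p => decide (List.replicate p true ∈ sparseLang X)
    with hF
  refine ⟨simMachine M F, (4 * .X + 8) * (100 * (4 * .X + 8) ^ 2 + 1) + .C (2 * F.length + 7),
    simMachine_oracleFree M F, fun x => ?_⟩
  obtain ⟨b, hb, -⟩ := hM x
  set t := f x with ht
  -- The first k bits of `X` decide all queries of length at most t, because 2^(j+1) - 2 ≤ t forces
  -- j < k. As 2^k ≤ 2(t+2), the index N of these bits is less than 4t + 8, whence the polynomial;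
  -- and t ≤ N, so round N has enough time.
  set k := Nat.log 2 (t + 2) + 1 with hk
  have hk₁ : t + 2 < 2 ^ k := Nat.lt_pow_succ_log_self (by norm_num) _
  have hk₂ : 2 ^ k ≤ 2 * (t + 2) := by
    rw [hk, pow_succ, mul_comm]
    exact Nat.mul_le_mul_left _ (Nat.pow_log_le_self 2 (by omega))
  set bs := (List.range k).map X with hbs
  have hlen : bs.length = k := by simp [hbs]
  set N := wordIndex bs with hN
  have hN₁ : 2 ^ k ≤ N + 1 := hlen ▸ le_wordIndex bs
  have hN₂ : N + 1 < 2 ^ (k + 1) := hlen ▸ wordIndex_lt bs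
  rw [pow_succ] at hN₂
  have hans : M.AnswersWithin (orcSet F (orcSucc^[N] [])) x N b := by
    refine AnswersWithin.mono (t := t) ?_ (by omega)
    rw [orcList_iterate, hN, iterate_wordSucc_wordIndex, hF, orcSet_eq_sparseLang]
    refine AnswersWithin.congr_oracle hb (mem_sparseLang_congr fun j hj => ?_)
    split_ifs with hjm
    · rfl
    · have hjk : j < k := by
        have h1 := two_le_two_pow_succ j
        have : 2 ^ (j + 1) < 2 ^ k := by omega
        have := (Nat.pow_lt_pow_iff_right (by norm_num)).1 this
        omega
      simp [hbs, hjk]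
  obtain ⟨n', b', hb', hsim⟩ := simMachine_answersWithin (A := ∅) M F x hans
  refine ⟨b', AnswersWithin.mono hsim ?_, ?_⟩
  · simp only [Polynomial.eval_add, Polynomial.eval_mul, Polynomial.eval_pow, Polynomial.eval_X,
      Polynomial.eval_C, Polynomial.eval_ofNat, Polynomial.eval_one]
    have : N ≤ 4 * t + 8 := by omega
    gcongr
  -- A wrong answer would put the simulated oracle into `badSets M L`, although it agrees with `X`
  -- below m.
  · by_contra hc
    rw [orcList_iterate, hF, orcSet_eq_sparseLang] at hb'
    refine hm _ (fun j hj => ?_) ⟨x, n', b', hb', hc⟩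
    rw [if_pos]
    have h1 := two_le_two_pow_succ j
    have : 2 ^ (j + 1) ≤ 2 ^ (m + 1) := Nat.pow_le_pow_right (by norm_num) (by omega)
    omega

end SpeedLow

namespace SpeedLow

open Turing

/-! ### There are only countably many machines and computable languages -/

section Rename

/-- Rename the work tapes. -/
def nameMap {W W' : Type} (e : W ≃ W') : TapeName W → TapeName W'
  | .input => .input
  | .query => .query
  | .work w => .work (e w)

theorem nameMap_symm {W W' : Type} (e : W ≃ W') (i : TapeName W) :
    nameMap e.symm (nameMap e i) = i := by
  cases i <;> simp [nameMap]

/-- Rename the symbols. -/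
def symMap {Γ Γ' : Type} (e : Γ ≃ Γ') : PointedMap (TapeSymbol Γ) (TapeSymbol Γ') :=
  ⟨Option.map (Sum.map id e), rfl⟩

theorem symMap_symm {Γ Γ' : Type} (e : Γ ≃ Γ') (a : TapeSymbol Γ) :
    symMap e.symm (symMap e a) = a := by
  rcases a with _ | (_ | _) <;> simp [symMap]

theorem symMap_eq_bit {Γ Γ' : Type} (e : Γ ≃ Γ') (a : TapeSymbol Γ) (b : Bool) :
    symMap e a = some (Sum.inl b) ↔ a = some (Sum.inl b) := by
  rcases a with _ | (_ | _) <;> simp [symMap]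

theorem holdsWord_map {Γ Γ' : Type} (e : Γ ≃ Γ') (T : Tape (TapeSymbol Γ)) (w : List Bool) :
    HoldsWord (T.map (symMap e)) w ↔ HoldsWord T w := by
  simp only [HoldsWord, nth_map, symMap_eq_bit, ne_eq]

variable {Q Q' W W' Γ Γ' : Type}

/-- Rename the states, tapes and symbols in an instruction. -/
def instrMap (eQ : Q ≃ Q') (eW : W ≃ W') (eG : Γ ≃ Γ') :
    Instruction Q W Γ → Instruction Q' W' Γ'
  | .halt b => .halt b
  | .query y n => .query (eQ y) (eQ n)
  | .act δ => .act fun h =>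
      (eQ (δ fun i => symMap eG.symm (h (nameMap eW i))).1, fun i =>
        (symMap eG ((δ fun i => symMap eG.symm (h (nameMap eW i))).2 (nameMap eW.symm i)).1,
          ((δ fun i => symMap eG.symm (h (nameMap eW i))).2 (nameMap eW.symm i)).2))

/-- The two machines run in lockstep. Thus the arbitrary finite types of a machine can be replaced
by `Fin n`, and countably many machines account for all genericity requirements. -/
theorem answersWithin_of_rename {M M' : OracleTM} (eQ : M.Q ≃ M'.Q) (eW : M.W ≃ M'.W)
    (eG : M.Γ ≃ M'.Γ) (hstart : M'.start = eQ M.start)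
    (hprog : ∀ q, M'.prog (eQ q) = instrMap eQ eW eG (M.prog q))
    (A : Set (List Bool)) (x : List Bool) (t : ℕ) (b : Bool) :
    M'.AnswersWithin A x t b ↔ M.AnswersWithin A x t b := by
  classical
  have key : ∀ t, ((M'.step A)^[t] (M'.init x)).state = eQ ((M.step A)^[t] (M.init x)).state ∧
      ∀ i, ((M'.step A)^[t] (M'.init x)).tape (nameMap eW i) =
        (((M.step A)^[t] (M.init x)).tape i).map (symMap eG) := by
    intro t
    induction t with
    | zero =>
      refine ⟨hstart, fun i => ?_⟩
      rcases i with _ | _ | i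
      · change Tape.mk₁ (x.map fun b => (some (Sum.inl b) : TapeSymbol M'.Γ)) =
          Tape.map (symMap eG) (Tape.mk₁ (x.map fun b => (some (Sum.inl b) : TapeSymbol M.Γ)))
        rw [Tape.map_mk₁, List.map_map]
        rfl
      · rfl
      · rfl
    | succ t ih =>
      rw [Function.iterate_succ_apply', Function.iterate_succ_apply']
      obtain ⟨h₁, h₂⟩ := ih
      generalize (M'.step A)^[t] (M'.init x) = d at h₁ h₂ ⊢
      generalize (M.step A)^[t] (M.init x) = c at h₁ h₂ ⊢
      have hp' : M'.prog d.state = instrMap eQ eW eG (M.prog c.state) := by rw [h₁, hprog]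
      rcases hp : M.prog c.state with b | ⟨yes, no⟩ | δ
      · rw [hp] at hp'
        rw [step_halt M A c hp, step_halt M' A d hp']
        exact ⟨h₁, h₂⟩
      · rw [hp] at hp'
        rw [step_query M A _ _ hp, step_query M' A _ _ hp']
        refine ⟨?_, h₂⟩
        have : (∃ w ∈ A, HoldsWord (d.tape .query) w) ↔ ∃ w ∈ A, HoldsWord (c.tape .query) w := by
          have hq := h₂ .query
          change d.tape .query = _ at hq
          rw [hq]
          exact exists_congr fun w => and_congr_right fun _ => holdsWord_map eG _ w
        simp only [this]
        exact (apply_ite eQ _ _ _).symm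
      · rw [hp] at hp'
        rw [step_act M A _ _ hp, step_act M' A _ _ hp']
        have hh : (fun i => symMap eG.symm (heads d.tape (nameMap eW i))) = heads c.tape := by
          funext i
          rw [heads, h₂ i, Tape.map_fst, symMap_symm]
          rfl
        simp only [hh]
        refine ⟨trivial, fun i => ?_⟩
        rw [nameMap_symm, h₂ i]
        rcases (δ (heads c.tape)).2 i with ⟨a, _ | dir⟩
        · simp only [actTape_none, Tape.map_write]
        · simp only [actTape_some, Tape.map_write, Tape.map_move]
  unfold OracleTM.AnswersWithin
  rw [(key t).1, hprog]
  generalize M.prog _ = I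
  rcases I with b | ⟨yes, no⟩ | δ <;> simp [instrMap]

end Rename

theorem finite_instruction (Q W Γ : Type) [Finite Q] [Finite W] [Finite Γ] :
    Finite (Instruction Q W Γ) := by
  have := finite_tapeName W
  have : Finite Dir := Finite.of_injective (fun d : Dir => match d with
    | .left => true
    | .right => false) (by rintro (_ | _) (_ | _) h <;> simp_all)
  let F : Instruction Q W Γ → Bool ⊕ (Q × Q) ⊕ ((TapeName W → TapeSymbol Γ) →
      Q × (TapeName W → TapeSymbol Γ × Option Turing.Dir)) := fun
    | .halt b => Sum.inl b
    | .query y n => Sum.inr (Sum.inl (y, n))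
    | .act δ => Sum.inr (Sum.inr δ)
  refine Finite.of_injective F ?_
  rintro (b | ⟨y, n⟩ | δ) (b' | ⟨y', n'⟩ | δ') h <;> simp_all [F]

/-- Descriptions of machines. -/
abbrev MachineIndex : Type :=
  Σ (n m g : ℕ), Fin n × (Fin n → Instruction (Fin n) (Fin m) (Fin g))

instance : Countable MachineIndex := by
  have : ∀ n m g, Countable (Fin n × (Fin n → Instruction (Fin n) (Fin m) (Fin g))) := by
    intro n m g
    have := finite_instruction (Fin n) (Fin m) (Fin g)
    infer_instance
  infer_instance

/-- The machine with a given description. -/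
def MachineIndex.machine (i : MachineIndex) : OracleTM where
  Q := Fin i.1
  W := Fin i.2.1
  Γ := Fin i.2.2.1
  finite_Q := inferInstance
  finite_W := inferInstance
  finite_Γ := inferInstance
  start := i.2.2.2.1
  prog := i.2.2.2.2

theorem exists_machineIndex (M : OracleTM) : ∃ i : MachineIndex, ∀ A x t b,
    i.machine.AnswersWithin A x t b ↔ M.AnswersWithin A x t b := by
  have := M.finite_Q
  have := M.finite_W
  have := M.finite_Γ
  obtain ⟨n, ⟨eQ⟩⟩ := Finite.exists_equiv_fin M.Q
  obtain ⟨m, ⟨eW⟩⟩ := Finite.exists_equiv_fin M.W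
  obtain ⟨g, ⟨eG⟩⟩ := Finite.exists_equiv_fin M.Γ
  exact ⟨⟨n, m, g, eQ M.start, fun q => instrMap eQ eW eG (M.prog (eQ.symm q))⟩,
    answersWithin_of_rename eQ eW eG rfl fun q =>
      congrArg (fun q => instrMap eQ eW eG (M.prog q)) (eQ.symm_apply_apply q)⟩

/-- The language given by a code. -/
def codeLang (c : Nat.Partrec.Code) : Set (List Bool) :=
  {x | Encodable.encode true ∈ c.eval (Encodable.encode x)}

theorem exists_codeLang {L : Set (List Bool)} (hL : ComputablePred fun x => x ∈ L) :
    ∃ c, codeLang c = L := by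
  obtain ⟨hd, hL⟩ := hL
  obtain ⟨c, hc⟩ := Nat.Partrec.Code.exists_code.1 hL
  refine ⟨c, Set.ext fun x => ?_⟩
  rw [codeLang, Set.mem_ofPred_eq, hc]
  simp only [Encodable.encodek, PFun.coe_val, Part.coe_some, Part.bind_some, Part.map_some,
    Part.mem_some_iff]
  rw [Encodable.encode_inj, eq_comm, decide_eq_true_eq]

theorem badSets_congr {M M' : OracleTM} (L : Set (List Bool))
    (h : ∀ A x t b, M.AnswersWithin A x t b ↔ M'.AnswersWithin A x t b) :
    badSets M L = badSets M' L := by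
  simp only [badSets, h]

/-! ### Pairs of generic sets -/

/-- A finite approximation to a pair of sets; between any two differences there is a gap. -/
structure Approx (g : ℕ → ℕ) where
  X : ℕ → Bool
  Y : ℕ → Bool
  m : ℕ
  gap : ∀ i j, i < j → j < m → X i ≠ Y i → X j ≠ Y j → g i ≤ j

namespace Approx

variable {g : ℕ → ℕ}

instance : Preorder (Approx g) where
  le p q := p.m ≤ q.m ∧ ∀ k < p.m, q.X k = p.X k ∧ q.Y k = p.Y k
  le_refl p := ⟨le_rfl, fun _ _ => ⟨rfl, rfl⟩⟩
  le_trans p q r h₁ h₂ := ⟨h₁.1.trans h₂.1, fun k hk =>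
    ⟨(h₂.2 k (hk.trans_le h₁.1)).1.trans (h₁.2 k hk).1,
      (h₂.2 k (hk.trans_le h₁.1)).2.trans (h₁.2 k hk).2⟩⟩

/-- Exchange the two sets. -/
def swap (p : Approx g) : Approx g :=
  ⟨p.Y, p.X, p.m, fun i j hij hj hi hj' => p.gap i j hij hj hi.symm hj'.symm⟩

theorem swap_le_swap {p q : Approx g} (h : p ≤ q) : p.swap ≤ q.swap :=
  ⟨h.1, fun k hk => (h.2 k hk).symm⟩

/-- The approximation to the first set decides membership in `U`. -/
def Meets (p : Approx g) (U : Set (ℕ → Bool)) : Prop :=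
  (∀ Z : ℕ → Bool, (∀ k < p.m, Z k = p.X k) → Z ∈ U) ∨
    ∀ Z : ℕ → Bool, (∀ k < p.m, Z k = p.X k) → Z ∉ U

/-- If some continuation of the first set lies in `U`, a finite part of it is adopted, and the
second set copies it beyond `p.m`; no difference is added, so the gap condition survives. If there
is none, `p` itself already keeps the first set out of `U`. -/
theorem exists_meets {U : Set (ℕ → Bool)} (hU : FinitelyWitnessed U) (p : Approx g) :
    ∃ q, p ≤ q ∧ q.Meets U := by
  by_cases h : ∃ Z : ℕ → Bool, (∀ k < p.m, Z k = p.X k) ∧ Z ∈ U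
  · obtain ⟨Z, hZ, hZU⟩ := h
    obtain ⟨m, hm⟩ := hU Z hZU
    refine ⟨⟨Z, fun k => if k < p.m then p.Y k else Z k, max p.m m, ?_⟩, ⟨le_max_left _ _,
      fun k hk => ⟨hZ k hk, if_pos hk⟩⟩, Or.inl fun Z' hZ' => hm Z' fun k hk => hZ' k ?_⟩
    · intro i j hij _ hi hj
      by_cases hjp : j < p.m
      · rw [if_pos hjp, hZ j hjp] at hj
        rw [if_pos (hij.trans hjp), hZ i (hij.trans hjp)] at hi
        exact p.gap i j hij hjp hi hj
      · rw [if_neg hjp] at hj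
        exact (hj rfl).elim
    · exact hk.trans_le (le_max_right _ _)
  · exact ⟨p, le_rfl, Or.inr fun Z hZ hZU => h ⟨Z, hZ, hZU⟩⟩

theorem exists_difference (hg : Monotone g) (n : ℕ) (p : Approx g) :
    ∃ q, p ≤ q ∧ ∃ k ≥ n, k < q.m ∧ q.X k ≠ q.Y k := by
  -- The place of the new difference. Every earlier difference i is below `p.m`, so g i ≤ g p.m ≤ K
  -- by monotonicity.
  set K := max (max n p.m) (g p.m) with hK
  have hKp : p.m ≤ K := (le_max_right n p.m).trans (le_max_left _ _)
  have hd : ∀ i, (if i < p.m then p.X i else decide (i = K)) ≠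
      (if i < p.m then p.Y i else false) → i < p.m ∧ p.X i ≠ p.Y i ∨ i = K := by
    intro i hi
    by_cases hip : i < p.m
    · rw [if_pos hip, if_pos hip] at hi
      exact Or.inl ⟨hip, hi⟩
    · rw [if_neg hip, if_neg hip] at hi
      exact Or.inr (by simpa using hi)
  refine ⟨⟨fun k => if k < p.m then p.X k else decide (k = K),
    fun k => if k < p.m then p.Y k else false, K + 1, ?_⟩,
    ⟨by simp only; omega, fun k hk => ⟨if_pos hk, if_pos hk⟩⟩,
    K, (le_max_left n p.m).trans (le_max_left _ _), by simp, ?_⟩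
  · intro i j hij hj hi hj'
    rcases hd i hi with ⟨hip, hi⟩ | rfl
    · rcases hd j hj' with ⟨hjp, hj'⟩ | rfl
      · exact p.gap i j hij hjp hi hj'
      · exact (hg hip.le).trans (le_max_right _ _)
    · omega
  · simp [show ¬ K < p.m by omega]

end Approx

/-- There are two generic sets with infinitely many differences and large gaps between them. -/
theorem exists_generic_pair {ι : Type} [Countable ι] (U : ι → Set (ℕ → Bool))
    (hU : ∀ i, FinitelyWitnessed (U i)) {g : ℕ → ℕ} (hg : Monotone g) :
    ∃ X Y : ℕ → Bool, (∀ i, Decides X (U i)) ∧ (∀ i, Decides Y (U i)) ∧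
      (∀ n, ∃ k ≥ n, X k ≠ Y k) ∧ ∀ i j, i < j → X i ≠ Y i → X j ≠ Y j → g i ≤ j := by
  classical
  have := Encodable.ofCountable ι
  -- The dense sets to be met: decide `U i` for the first set; decide it for the second one, by
  -- exchanging the sets; have a difference beyond n.
  let D : ι ⊕ ι ⊕ ℕ → Order.Cofinal (Approx g) := fun
    | Sum.inl i => ⟨{q | q.Meets (U i)}, fun p => by
        obtain ⟨q, hpq, hq⟩ := p.exists_meets (hU i)
        exact ⟨q, hq, hpq⟩⟩
    | Sum.inr (Sum.inl i) => ⟨{q | q.swap.Meets (U i)}, fun p => by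
        obtain ⟨q, hpq, hq⟩ := p.swap.exists_meets (hU i)
        exact ⟨q.swap, hq, Approx.swap_le_swap hpq⟩⟩
    | Sum.inr (Sum.inr n) => ⟨{q | ∃ k ≥ n, k < q.m ∧ q.X k ≠ q.Y k}, fun p => by
        obtain ⟨q, hpq, hq⟩ := p.exists_difference hg n
        exact ⟨q, hq, hpq⟩⟩
  let p₀ : Approx g := ⟨fun _ => false, fun _ => false, 0, fun _ _ _ h => by omega⟩
  let s := Order.sequenceOfCofinals p₀ D
  have hs : Monotone s := Order.sequenceOfCofinals.monotone p₀ D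
  have hmem : ∀ r, s (Encodable.encode r + 1) ∈ D r := Order.sequenceOfCofinals.encode_mem p₀ D
  -- The differences beyond every number also force the lengths of the approximations to grow
  -- without bound.
  have hm : ∀ k, ∃ n, k < (s n).m := fun k => by
    obtain ⟨k', hk', hlt, -⟩ := hmem (Sum.inr (Sum.inr k))
    exact ⟨_, lt_of_le_of_lt hk' hlt⟩
  choose N hN using hm
  have hlim : ∀ n k, k < (s n).m →
      (s (N k)).X k = (s n).X k ∧ (s (N k)).Y k = (s n).Y k := by
    intro n k hk
    rcases le_total (N k) n with h | h
    · have := (hs h).2 k (hN k)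
      exact ⟨this.1.symm, this.2.symm⟩
    · exact (hs h).2 k hk
  refine ⟨fun k => (s (N k)).X k, fun k => (s (N k)).Y k, fun i => ?_, fun i => ?_, fun n => ?_,
    fun i j hij hi hj => ?_⟩
  · rcases hmem (Sum.inl i) with h | h
    · exact Or.inl (h _ fun k hk => (hlim _ k hk).1)
    · exact Or.inr ⟨_, fun Z hZ => h Z fun k hk => (hZ k hk).trans (hlim _ k hk).1⟩
  · rcases hmem (Sum.inr (Sum.inl i)) with h | h
    · exact Or.inl (h _ fun k hk => (hlim _ k hk).2)
    · exact Or.inr ⟨_, fun Z hZ => h Z fun k hk => (hZ k hk).trans (hlim _ k hk).2⟩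
  · obtain ⟨k, hk, hlt, hne⟩ := hmem (Sum.inr (Sum.inr n))
    refine ⟨k, hk, ?_⟩
    simp only [(hlim _ k hlt).1, (hlim _ k hlt).2]
    exact hne
  · have hj' := hN j
    simp only [(hlim (N j) i (by omega)).1, (hlim (N j) i (by omega)).2] at hi
    exact (s (N j)).gap i j hij hj' hi hj

/-- There are two low for speed languages with infinitely many differences and large gaps. -/
theorem exists_lowForSpeed_pair {g : ℕ → ℕ} (hg : Monotone g) :
    ∃ X Y : ℕ → Bool, LowForSpeed (sparseLang X) ∧ LowForSpeed (sparseLang Y) ∧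
      (∀ n, ∃ k ≥ n, X k ≠ Y k) ∧ ∀ i j, i < j → X i ≠ Y i → X j ≠ Y j → g i ≤ j := by
  obtain ⟨X, Y, hX, hY, h₁, h₂⟩ := exists_generic_pair
    (ι := MachineIndex × Nat.Partrec.Code) (fun i => badSets i.1.machine (codeLang i.2))
    (fun i => finitelyWitnessed_badSets _ _) hg
  have hc : ∀ Z : ℕ → Bool, (∀ i : MachineIndex × Nat.Partrec.Code,
      Decides Z (badSets i.1.machine (codeLang i.2))) → LowForSpeed (sparseLang Z) := by
    intro Z hZ
    refine lowForSpeed_sparseLang fun M L hL => ?_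
    obtain ⟨i, hi⟩ := exists_machineIndex M
    obtain ⟨c, rfl⟩ := exists_codeLang hL
    rw [← badSets_congr _ hi]
    exact hZ (i, c)
  exact ⟨X, Y, hc X hX, hc Y hY, h₁, h₂⟩

end SpeedLow

namespace SpeedLow

open Turing

/-! ### Computations of machines without oracle are primitive recursive -/

section Code

variable {S : Type} [Inhabited S]

/-- A tape is represented by the symbols to the left of the head and those from the head on. -/
abbrev TapeCode (S : Type) : Type := List S × List S

/-- Write and move on a represented tape. -/
def tapeCodeAct (a : S × Option Bool) (T : TapeCode S) : TapeCode S :=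
  Option.casesOn a.2 (T.1, a.1 :: T.2.tail) fun d =>
    cond d (a.1 :: T.1, T.2.tail) (T.1.tail, T.1.headI :: a.1 :: T.2.tail)

theorem primrec_tapeCodeAct [Primcodable S] : Primrec₂ (tapeCodeAct (S := S)) := by
  have h1 : Primrec fun p : (S × Option Bool) × TapeCode S => p.1.1 :=
    Primrec.fst.comp Primrec.fst
  have hl : Primrec fun p : (S × Option Bool) × TapeCode S => p.2.1 :=
    Primrec.fst.comp Primrec.snd
  have hr : Primrec fun p : (S × Option Bool) × TapeCode S => p.2.2.tail :=
    Primrec.list_tail.comp (Primrec.snd.comp Primrec.snd)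
  have hd : Primrec fun p : (S × Option Bool) × TapeCode S => p.1.2 :=
    Primrec.snd.comp Primrec.fst
  refine Primrec.option_casesOn hd (hl.pair (Primrec.list_cons.comp h1 hr)) ?_
  refine Primrec.cond Primrec.snd
    (Primrec.pair (Primrec.list_cons.comp (h1.comp Primrec.fst) (hl.comp Primrec.fst))
      (hr.comp Primrec.fst))
    (Primrec.pair (Primrec.list_tail.comp (hl.comp Primrec.fst))
      (Primrec.list_cons.comp (Primrec.list_headI.comp (hl.comp Primrec.fst))
        (Primrec.list_cons.comp (h1.comp Primrec.fst) (hr.comp Primrec.fst))))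

/-- The Boolean for a direction. -/
def dirBool : Dir → Bool
  | Dir.right => true
  | Dir.left => false

theorem mk₂_eq_cons_tail {G : Type} [Inhabited G] (L R : List G) :
    Tape.mk₂ L R = Tape.mk₂ L (R.headI :: R.tail) := by
  cases R with
  | nil => exact (mk₂_default_right L).symm
  | cons a R => rfl

/-- A tape has many codes, differing in trailing blanks, so the agreement is asserted after
decoding. -/
theorem mk₂_tapeCodeAct (a : S × Option Dir) (T : TapeCode S) :
    Tape.mk₂ (tapeCodeAct (a.1, a.2.map dirBool) T).1 (tapeCodeAct (a.1, a.2.map dirBool) T).2 =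
      actTape (Tape.mk₂ T.1 T.2) a := by
  obtain ⟨L, R⟩ := T
  obtain ⟨b, d⟩ := a
  rw [mk₂_eq_cons_tail L R]
  rcases d with _ | (_ | _)
  · rfl
  · cases L with
    | nil => simp [tapeCodeAct, dirBool]
    | cons c L => simp [tapeCodeAct, dirBool]
  · simp [tapeCodeAct, dirBool]

end Code

theorem primrec_replicate {α : Type} [Primcodable α] (a : α) :
    Primrec fun n : ℕ => List.replicate n a :=
  (Primrec.list_map Primrec.list_range (Primrec.const a).to₂).of_eq fun n => by simp

/-- A configuration is coded by a state and finitely many pairs of lists. One step is a lookup in a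
finite table followed by list operations, and t steps are an iteration. A query to the empty oracle
always leads to the state `no`, so query instructions need not be excluded. -/
theorem exists_primrec_answers_of_primcodable (M : OracleTM) [Primcodable M.Q] [Primcodable M.Γ] :
    ∃ φ : List Bool → ℕ → Option Bool, Primrec₂ φ ∧
      ∀ x t b, φ x t = some b ↔ M.AnswersWithin ∅ x t b := by
  classical
  have := M.finite_Q
  have := M.finite_W
  have := M.finite_Γ
  have := finite_tapeName M.W
  obtain ⟨k, ⟨e⟩⟩ := Finite.exists_equiv_fin (TapeName M.W)
  let S := TapeSymbol M.Γ
  let C := M.Q × (Fin k → TapeCode S)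
  let δ : M.Q × (Fin k → S) → M.Q × (Fin k → S × Option Bool) := fun c =>
    match M.prog c.1 with
    | .halt _ => (c.1, fun j => (c.2 j, none))
    | .query _ no => (no, fun j => (c.2 j, none))
    | .act δ => ((δ fun i => c.2 (e i)).1, fun j =>
        (((δ fun i => c.2 (e i)).2 (e.symm j)).1,
          ((δ fun i => c.2 (e i)).2 (e.symm j)).2.map dirBool))
  have hδ : Primrec δ := Primrec.dom_finite δ
  let hd : C → Fin k → S := fun c j => (c.2 j).2.headI
  have hhd : Primrec hd := Primrec.fin_curry.2
    (Primrec.list_headI.comp (Primrec.snd.comp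
      (Primrec.fin_app.comp (Primrec.snd.comp Primrec.fst) Primrec.snd)))
  let r : C → M.Q × (Fin k → S × Option Bool) := fun c => δ (c.1, hd c)
  have hr : Primrec r := hδ.comp (Primrec.pair Primrec.fst hhd)
  let nxt : C → C := fun c => ((r c).1, fun j => tapeCodeAct ((r c).2 j) (c.2 j))
  have hnxt : Primrec nxt := Primrec.pair (Primrec.fst.comp hr) (Primrec.fin_curry.2
    (primrec_tapeCodeAct.comp
      (Primrec.fin_app.comp (Primrec.snd.comp (hr.comp Primrec.fst)) Primrec.snd)
      (Primrec.fin_app.comp (Primrec.snd.comp Primrec.fst) Primrec.snd)))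
  let ini : List Bool → C := fun x => (M.start, fun j =>
    if j = e .input then ([], x.map fun b => some (Sum.inl b)) else ([], []))
  have hini : Primrec ini := by
    refine Primrec.pair (Primrec.const _) (Primrec.fin_curry.2 ?_)
    refine Primrec.ite (Primrec.eq.comp Primrec.snd (Primrec.const _)) ?_ (Primrec.const _)
    refine Primrec.pair (Primrec.const _) (Primrec.list_map Primrec.fst ?_)
    exact ((Primrec.dom_finite fun b : Bool => (some (Sum.inl b) : S)).comp Primrec.snd).to₂
  let out : M.Q → Option Bool := fun q =>
    match M.prog q with
    | .halt b => some b
    | _ => none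
  have hout : Primrec out := Primrec.dom_finite out
  refine ⟨fun x t => out (nxt^[t] (ini x)).1, ?_, fun x t b => ?_⟩
  · exact hout.comp (Primrec.fst.comp (Primrec.nat_iterate Primrec.snd (hini.comp Primrec.fst)
      (hnxt.comp Primrec.snd).to₂))
  · have key : ∀ t, (nxt^[t] (ini x)).1 = ((M.step ∅)^[t] (M.init x)).state ∧
        ∀ i, ((M.step ∅)^[t] (M.init x)).tape i =
          Tape.mk₂ ((nxt^[t] (ini x)).2 (e i)).1 ((nxt^[t] (ini x)).2 (e i)).2 := by
      intro t
      induction t with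
      | zero =>
        refine ⟨rfl, fun i => ?_⟩
        have hi : (ini x).2 (e i) = if e i = e .input then
          ([], x.map fun b => some (Sum.inl b)) else ([], []) := rfl
        simp only [Function.iterate_zero, id_eq, hi, e.injective.eq_iff]
        rcases i with _ | _ | i
        · rw [if_pos rfl]
          rfl
        · rw [if_neg (by simp)]
          rfl
        · rw [if_neg (by simp)]
          rfl
      | succ t ih =>
        rw [Function.iterate_succ_apply', Function.iterate_succ_apply']
        obtain ⟨h₁, h₂⟩ := ih
        generalize (M.step ∅)^[t] (M.init x) = d at h₁ h₂ ⊢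
        generalize nxt^[t] (ini x) = c at h₁ h₂ ⊢
        have hh : (fun i => hd c (e i)) = heads d.tape := by
          funext i
          simp only [heads, h₂ i]
          rfl
        have hkeep : ∀ i, Tape.mk₂ (tapeCodeAct (hd c (e i), none) (c.2 (e i))).1
            (tapeCodeAct (hd c (e i), none) (c.2 (e i))).2 = d.tape i := by
          intro i
          refine (mk₂_tapeCodeAct (hd c (e i), none) (c.2 (e i))).trans ?_
          rw [← h₂ i]
          have : hd c (e i) = (d.tape i).head := congrFun hh i
          rw [this, actTape_none, write_head]
        have hn : ∀ {q f}, r c = (q, f) →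
            nxt c = (q, fun j => tapeCodeAct (f j) (c.2 j)) := by
          intro q f h
          simp only [nxt, h]
        rcases hp : M.prog c.1 with b | ⟨yes, no⟩ | δ'
        · have hs : M.step ∅ d = d := step_halt M ∅ d (by rw [← h₁]; exact hp)
          have hr' : r c = (c.1, fun j => (hd c j, none)) := by simp only [r, δ, hp]
          rw [hs, hn hr']
          exact ⟨h₁, fun i => (hkeep i).symm⟩
        · have hs := step_query M ∅ d.state d.tape (yes := yes) (no := no) (by rw [← h₁]; exact hp)
          have hr' : r c = (no, fun j => (hd c j, none)) := by simp only [r, δ, hp]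
          have hs' : M.step ∅ d = ⟨no, d.tape⟩ := by
            refine hs.trans ?_
            simp
          rw [hs', hn hr']
          exact ⟨rfl, fun i => (hkeep i).symm⟩
        · have hs : M.step ∅ d = _ :=
            step_act M ∅ d.state d.tape (δ := δ') (by rw [← h₁]; exact hp)
          have hr' : r c = ((δ' (heads d.tape)).1, fun j =>
              (((δ' (heads d.tape)).2 (e.symm j)).1,
                ((δ' (heads d.tape)).2 (e.symm j)).2.map dirBool)) := by
            rw [← hh]
            simp only [r, δ, hp]
          rw [hs, hn hr']
          refine ⟨rfl, fun i => ?_⟩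
          simp only [Equiv.symm_apply_apply]
          rw [mk₂_tapeCodeAct, ← h₂ i]
    unfold OracleTM.AnswersWithin
    rw [← (key t).1]
    simp only [out]
    generalize M.prog _ = J
    rcases J with b' | ⟨yes, no⟩ | δ' <;> simp

/-- Computations without oracle are primitive recursive. -/
theorem exists_primrec_answers (M : OracleTM) :
    ∃ φ : List Bool → ℕ → Option Bool, Primrec₂ φ ∧
      ∀ x t b, φ x t = some b ↔ M.AnswersWithin ∅ x t b := by
  obtain ⟨I, hI⟩ := exists_machineIndex M
  have : Primcodable I.machine.Q := inferInstanceAs (Primcodable (Fin I.1))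
  have : Primcodable I.machine.Γ := inferInstanceAs (Primcodable (Fin I.2.2.1))
  obtain ⟨φ, hφ, h⟩ := exists_primrec_answers_of_primcodable I.machine
  exact ⟨φ, hφ, fun x t b => (h x t b).trans (hI ∅ x t b)⟩

end SpeedLow

namespace SpeedLow

/-! ### Counter programs with an oracle -/

/-- Programs for machines whose registers `0, 1, 2, …` hold natural numbers. The program `shift P`
ignores register `0` and renumbers the others; `query` replaces register `0` by the answer of the
oracle. -/
inductive CProg : Type
  | inc : ℕ → CProg
  | dec : ℕ → CProg
  | query : CProg
  | seq : CProg → CProg → CProg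
  | shift : CProg → CProg
  | ite : ℕ → CProg → CProg → CProg
  | loop : ℕ → CProg → CProg

/-- Put a register in front. -/
def regCons (a : ℕ) (v : ℕ → ℕ) : ℕ → ℕ
  | 0 => a
  | i + 1 => v i

open Classical in
/-- The counter program, started with registers `v`, ends with registers `v'`. -/
inductive CExec (Z : Set ℕ) : CProg → (ℕ → ℕ) → (ℕ → ℕ) → Prop
  | inc (j : ℕ) (v : ℕ → ℕ) : CExec Z (.inc j) v (Function.update v j (v j + 1))
  | dec (j : ℕ) (v : ℕ → ℕ) : CExec Z (.dec j) v (Function.update v j (v j - 1))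
  | query (v : ℕ → ℕ) : CExec Z .query v (Function.update v 0 (if v 0 ∈ Z then 1 else 0))
  | seq {P Q : CProg} {v v₁ v₂ : ℕ → ℕ} :
      CExec Z P v v₁ → CExec Z Q v₁ v₂ → CExec Z (.seq P Q) v v₂
  | shift {P : CProg} (a : ℕ) {v v' : ℕ → ℕ} :
      CExec Z P v v' → CExec Z (.shift P) (regCons a v) (regCons a v')
  | ite_pos {j : ℕ} {P : CProg} (Q : CProg) {v v' : ℕ → ℕ} :
      v j ≠ 0 → CExec Z P v v' → CExec Z (.ite j P Q) v v'
  | ite_zero {j : ℕ} (P : CProg) {Q : CProg} {v v' : ℕ → ℕ} :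
      v j = 0 → CExec Z Q v v' → CExec Z (.ite j P Q) v v'
  | loop_zero {j : ℕ} (P : CProg) {v : ℕ → ℕ} : v j = 0 → CExec Z (.loop j P) v v
  | loop_pos {j : ℕ} {P : CProg} {v v₁ v₂ : ℕ → ℕ} :
      v j ≠ 0 → CExec Z P v v₁ → CExec Z (.loop j P) v₁ v₂ → CExec Z (.loop j P) v v₂

/-- The first registers are given by a list, and the others are zero. -/
def regs (l : List ℕ) : ℕ → ℕ := fun i => l.getD i 0

theorem regs_cons (a : ℕ) (l : List ℕ) : regs (a :: l) = regCons a (regs l) := by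
  funext i
  cases i <;> rfl

theorem regs_append_zero (l : List ℕ) : regs (l ++ [0]) = regs l := by
  funext i
  unfold regs
  rcases lt_trichotomy i l.length with h | rfl | h
  · rw [List.getD_append _ _ _ _ h]
  · simp
  · rw [List.getD_eq_default _ _ (by simp; omega), List.getD_eq_default _ _ (by omega)]

/-- All but finitely many registers are zero; appending zeros to the list makes scratch registers
visible, and dropping them again costs nothing. -/
theorem regs_pad (l : List ℕ) (m : ℕ) : regs (l ++ List.replicate m 0) = regs l := by
  induction m with
  | zero => simp
  | succ m ih => rw [List.replicate_succ', ← List.append_assoc, regs_append_zero, ih]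

theorem update_regs {l : List ℕ} {j : ℕ} (x : ℕ) (h : j < l.length) :
    Function.update (regs l) j x = regs (l.set j x) := by
  funext i
  unfold regs
  by_cases hi : i = j
  · subst hi
    simp [h]
  · rw [Function.update_of_ne hi]
    simp [Ne.symm hi]

namespace CProg

/-- Ignore several registers. -/
def shifts : ℕ → CProg → CProg
  | 0, P => P
  | n + 1, P => .shift (shifts n P)

/-- Do nothing. -/
def nop : CProg := .seq (.inc 0) (.dec 0)

/-- Set a register to zero. -/
def clr (i : ℕ) : CProg := .loop i (.dec i)

/-- Move a register to another. -/
def mv (i j : ℕ) : CProg := .loop i (.seq (.dec i) (.inc j))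

/-- Subtract a register from another, and set the former to zero. -/
def sub (i j : ℕ) : CProg := .loop i (.seq (.dec i) (.dec j))

/-- Add a register to another, with one auxiliary register. -/
def cp (i j t : ℕ) : CProg := .seq (.loop i (.seq (.dec i) (.seq (.inc j) (.inc t)))) (mv t i)

/-- Add the square of a register to another, with two auxiliary registers. -/
def sq (i j s t : ℕ) : CProg := .seq (cp i s t) (.loop s (.seq (.dec s) (cp i j t)))

/-- Change registers `0, a, b` to `pair a b, 0, 0`. -/
def pairing : CProg :=
  .seq (cp 1 3 5) <| .seq (cp 2 4 5) <| .seq (sub 3 4) <|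
    .ite 4 (.seq (clr 4) <| .seq (sq 2 0 3 4) <| .seq (mv 1 0) (clr 2))
      (.seq (sq 1 0 3 4) <| .seq (mv 1 0) (mv 2 0))

/-- Move to the next pair: registers `0` and `1` hold the pair, register `2` the distance of its
entries, and register `3` tells whether the second entry is at most the first. -/
def nextPair : CProg :=
  .ite 3 (.ite 2 (.seq (.inc 1) (.dec 2))
      (.seq (.dec 3) <| .seq (.inc 1) <| .seq (mv 0 2) (.inc 2)))
    (.seq (.inc 0) <| .seq (.dec 2) <| .ite 2 nop (.seq (mv 1 2) (.inc 3)))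

/-- Change registers `n, 0` to the two entries of the pair with number `n`. -/
def unpairing : CProg :=
  .seq (mv 0 4) <| .seq (.inc 3) <| .seq (.loop 4 (.seq (.dec 4) nextPair)) <|
    .seq (clr 2) (clr 3)

end CProg

namespace CExec

variable {Z : Set ℕ}

theorem congr {P : CProg} {v w w' : ℕ → ℕ} (h : CExec Z P v w) (hw : w = w') : CExec Z P v w' :=
  hw ▸ h

theorem loop_iterate {j : ℕ} {P : CProg} (S : ℕ → ℕ → ℕ) :
    ∀ n : ℕ, (∀ i < n, S i j ≠ 0) → (∀ i < n, CExec Z P (S i) (S (i + 1))) → S n j = 0 →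
      CExec Z (.loop j P) (S 0) (S n)
  | 0, _, _, h => .loop_zero P h
  | n + 1, h₁, h₂, h₃ => .loop_pos (h₁ 0 (by omega)) (h₂ 0 (by omega))
      (loop_iterate (fun i => S (i + 1)) n (fun i hi => h₁ (i + 1) (by omega))
        (fun i hi => h₂ (i + 1) (by omega)) h₃)

/-- A loop that counts a register down. -/
theorem loop_down {j : ℕ} {P : CProg} (S : ℕ → ℕ → ℕ) (n : ℕ) (h₁ : ∀ i ≤ n, S i j = n - i)
    (h₂ : ∀ i < n, CExec Z P (Function.update (S i) j (n - (i + 1))) (S (i + 1))) :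
    CExec Z (.loop j (.seq (.dec j) P)) (S 0) (S n) := by
  refine loop_iterate S n (fun i hi => ?_) (fun i hi => ?_) ?_
  · rw [h₁ i hi.le]
    omega
  · refine .seq (.dec j _) ?_
    rw [h₁ i hi.le, Nat.sub_sub]
    exact h₂ i hi
  · rw [h₁ n le_rfl, Nat.sub_self]

theorem nop (v : ℕ → ℕ) : CExec Z CProg.nop v v :=
  (CExec.seq (.inc 0 v) (.dec 0 _)).congr (by simp)

theorem clr (i : ℕ) (v : ℕ → ℕ) : CExec Z (.clr i) v (Function.update v i 0) := by
  have h := loop_iterate (Z := Z) (j := i) (P := .dec i)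
    (fun k => Function.update v i (v i - k)) (v i) (fun k hk => by simp; omega)
    (fun k hk => (CExec.dec i _).congr (by simp [Nat.sub_sub])) (by simp)
  simpa [CProg.clr] using h

theorem mv {i j : ℕ} (hij : i ≠ j) (v : ℕ → ℕ) :
    CExec Z (.mv i j) v (Function.update (Function.update v j (v j + v i)) i 0) := by
  have h := loop_down (Z := Z) (j := i) (P := .inc j)
    (fun k => Function.update (Function.update v j (v j + k)) i (v i - k)) (v i)
    (fun k hk => by simp)
    (fun k hk => (CExec.inc j _).congr (by
      funext r
      simp only [Function.update_apply]
      grind))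
  simpa [CProg.mv] using h

theorem sub {i j : ℕ} (hij : i ≠ j) (v : ℕ → ℕ) :
    CExec Z (.sub i j) v (Function.update (Function.update v j (v j - v i)) i 0) := by
  have h := loop_down (Z := Z) (j := i) (P := .dec j)
    (fun k => Function.update (Function.update v j (v j - k)) i (v i - k)) (v i)
    (fun k hk => by simp)
    (fun k hk => (CExec.dec j _).congr (by
      funext r
      simp only [Function.update_apply]
      grind))
  simpa [CProg.sub] using h

theorem congr₂ {P : CProg} {v v' w w' : ℕ → ℕ} (h : CExec Z P v w) (hv : v = v') (hw : w = w') :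
    CExec Z P v' w' :=
  hv ▸ hw ▸ h

theorem cp {i j t : ℕ} (hij : i ≠ j) (hit : i ≠ t) (hjt : j ≠ t) {v : ℕ → ℕ} (hv : v t = 0) :
    CExec Z (.cp i j t) v (Function.update v j (v j + v i)) := by
  have h := loop_down (Z := Z) (j := i) (P := .seq (.inc j) (.inc t))
    (fun k => Function.update (Function.update (Function.update v j (v j + k)) t k) i (v i - k))
    (v i) (fun k hk => by simp)
    (fun k hk => (CExec.seq (.inc j _) (.inc t _)).congr (by
      funext r
      simp only [Function.update_apply]
      grind))
  refine (CExec.seq h (CExec.mv hit.symm _)).congr₂ ?_ ?_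
  · funext r
    simp only [Function.update_apply]
    grind
  · funext r
    simp only [Function.update_apply]
    grind

theorem sq {i j s t : ℕ} (hij : i ≠ j) (his : i ≠ s) (hit : i ≠ t) (hjs : j ≠ s) (hjt : j ≠ t)
    (hst : s ≠ t) {v : ℕ → ℕ} (hs : v s = 0) (ht : v t = 0) :
    CExec Z (.sq i j s t) v (Function.update v j (v j + v i * v i)) := by
  have h := loop_down (Z := Z) (j := s) (P := CProg.cp i j t)
    (fun k => Function.update (Function.update v j (v j + k * v i)) s (v i - k))
    (v i) (fun k hk => by simp)
    (fun k hk => (CExec.cp hij hit hjt (by simp [hst.symm, hjt.symm, ht])).congr (by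
      funext r
      simp only [Function.update_apply]
      grind))
  refine ((CExec.cp his hit hst ht).seq (h.congr₂ ?_ rfl)).congr₂ rfl ?_
  · funext r
    simp only [Function.update_apply]
    grind
  · funext r
    simp only [Function.update_apply]
    grind

section Lists

variable {l l' : List ℕ}

/-- In the list forms, following a program means evaluating `List.set` on explicit lists, so that
the side conditions are mostly left to `simp`. -/
theorem incL {j : ℕ} (h : l.set j (l.getD j 0 + 1) = l') (hj : j < l.length) :
    CExec Z (.inc j) (regs l) (regs l') :=
  (CExec.inc j _).congr ((update_regs _ hj).trans (congrArg regs h))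

theorem decL {j : ℕ} (h : l.set j (l.getD j 0 - 1) = l') (hj : j < l.length) :
    CExec Z (.dec j) (regs l) (regs l') :=
  (CExec.dec j _).congr ((update_regs _ hj).trans (congrArg regs h))

theorem clrL {j : ℕ} (h : l.set j 0 = l') (hj : j < l.length) :
    CExec Z (.clr j) (regs l) (regs l') :=
  (CExec.clr j _).congr ((update_regs _ hj).trans (congrArg regs h))

theorem mvL {i j : ℕ} (h : (l.set j (l.getD j 0 + l.getD i 0)).set i 0 = l') (hij : i ≠ j)
    (hi : i < l.length) (hj : j < l.length) : CExec Z (.mv i j) (regs l) (regs l') := by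
  refine (CExec.mv hij _).congr ?_
  rw [update_regs _ hj, update_regs _ (by simpa using hi)]
  exact congrArg regs h

theorem subL {i j : ℕ} (h : (l.set j (l.getD j 0 - l.getD i 0)).set i 0 = l') (hij : i ≠ j)
    (hi : i < l.length) (hj : j < l.length) : CExec Z (.sub i j) (regs l) (regs l') := by
  refine (CExec.sub hij _).congr ?_
  rw [update_regs _ hj, update_regs _ (by simpa using hi)]
  exact congrArg regs h

theorem cpL {i j t : ℕ} (h : l.set j (l.getD j 0 + l.getD i 0) = l')
    (ht : l.getD t 0 = 0) (hj : j < l.length) (hij : i ≠ j) (hit : i ≠ t) (hjt : j ≠ t) :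
    CExec Z (.cp i j t) (regs l) (regs l') :=
  (CExec.cp hij hit hjt ht).congr ((update_regs _ hj).trans (congrArg regs h))

theorem sqL {i j s t : ℕ} (h : l.set j (l.getD j 0 + l.getD i 0 * l.getD i 0) = l')
    (hs : l.getD s 0 = 0) (ht : l.getD t 0 = 0) (hj : j < l.length)
    (hij : i ≠ j) (his : i ≠ s) (hit : i ≠ t) (hjs : j ≠ s) (hjt : j ≠ t) (hst : s ≠ t) :
    CExec Z (.sq i j s t) (regs l) (regs l') :=
  (CExec.sq hij his hit hjs hjt hst hs ht).congr ((update_regs _ hj).trans (congrArg regs h))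

theorem shiftL {P : CProg} (a : ℕ) (h : CExec Z P (regs l) (regs l')) :
    CExec Z (.shift P) (regs (a :: l)) (regs (a :: l')) := by
  rw [regs_cons, regs_cons]
  exact h.shift a

theorem shiftsL {P : CProg} (h : CExec Z P (regs l) (regs l')) :
    ∀ m : List ℕ, CExec Z (.shifts m.length P) (regs (m ++ l)) (regs (m ++ l'))
  | [] => h
  | a :: m => shiftL a (shiftsL h m)

end Lists

/-- The case distinction in `Nat.pair` is made by testing whether the truncated difference b - a is
zero. -/
theorem pairing (a b : ℕ) : CExec Z .pairing (regs [0, a, b]) (regs [Nat.pair a b]) := by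
  have h : CExec Z .pairing (regs [0, a, b, 0, 0, 0]) (regs [Nat.pair a b, 0, 0, 0, 0, 0]) := by
    refine .seq (cpL (l' := [0, a, b, a, 0, 0]) ?_ ?_ ?_ ?_ ?_ ?_) <|
      .seq (cpL (l' := [0, a, b, a, b, 0]) ?_ ?_ ?_ ?_ ?_ ?_) <|
      .seq (subL (l' := [0, a, b, 0, b - a, 0]) ?_ ?_ ?_ ?_) ?_
    rotate_right
    · by_cases hab : a < b
      · refine .ite_pos _ (Nat.sub_ne_zero_of_lt hab) <|
          .seq (clrL (l' := [0, a, b, 0, 0, 0]) ?_ ?_) <|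
          .seq (sqL (l' := [b * b, a, b, 0, 0, 0]) ?_ ?_ ?_ ?_ ?_ ?_ ?_ ?_ ?_ ?_) <|
          .seq (mvL (l' := [b * b + a, 0, b, 0, 0, 0]) ?_ ?_ ?_ ?_) (clrL ?_ ?_)
        all_goals simp [Nat.pair, hab]
      · refine .ite_zero _ (Nat.sub_eq_zero_of_le (not_lt.1 hab)) <|
          .seq (sqL (l' := [a * a, a, b, 0, b - a, 0]) ?_ ?_ ?_ ?_ ?_ ?_ ?_ ?_ ?_ ?_) <|
          .seq (mvL (l' := [a * a + a, 0, b, 0, 0, 0]) ?_ ?_ ?_ ?_) (mvL ?_ ?_ ?_ ?_)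
        all_goals simp [Nat.pair, hab]
        all_goals omega
    all_goals simp
  exact h.congr₂ (regs_pad [0, a, b] 3) (regs_pad [Nat.pair a b] 5)

end CExec

end SpeedLow

/-! ### Counter programs for unpairing, primitive recursion and search -/

namespace SpeedLow

/-- The enumeration runs through the shell of maximum s in the order (0, s), …, (s-1, s), (s, 0), …,
(s, s). Unpairing can thus be done by walking through the pairs, without square roots. -/
theorem unpair_succ (n : ℕ) : (n + 1).unpair =
    if n.unpair.2 ≤ n.unpair.1 then
      if n.unpair.1 = n.unpair.2 then (0, n.unpair.2 + 1) else (n.unpair.1, n.unpair.2 + 1)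
    else if n.unpair.1 + 1 = n.unpair.2 then (n.unpair.2, 0)
      else (n.unpair.1 + 1, n.unpair.2) := by
  obtain ⟨⟨a, b⟩, rfl⟩ := Nat.pairEquiv.surjective n
  simp only [Nat.pairEquiv_apply, Function.uncurry_apply_pair, Nat.unpair_pair]
  have key : ∀ c d, Nat.pair a b + 1 = Nat.pair c d → (Nat.pair a b + 1).unpair = (c, d) := by
    intro c d h
    rw [h, Nat.unpair_pair]
  split_ifs with h₁ h₂ h₂ <;> apply key <;> unfold Nat.pair
  · subst h₂
    simp
    ring
  · rw [if_neg (by omega), if_neg (by omega)]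
    ring
  · rw [if_pos (by omega), if_neg (by omega), ← h₂]
    ring
  · rw [if_pos (by omega), if_pos (by omega)]
    ring

namespace CExec

variable {Z : Set ℕ}

/-- One of the two truncated differences vanishes, so their sum is the distance of the entries.
Together with the flag it reduces the tests a = b and a + 1 = b to tests for zero. -/
theorem nextPair (n k : ℕ) :
    CExec Z .nextPair
      (regs [n.unpair.1, n.unpair.2, (n.unpair.1 - n.unpair.2) + (n.unpair.2 - n.unpair.1),
        if n.unpair.2 ≤ n.unpair.1 then 1 else 0, k])
      (regs [(n + 1).unpair.1, (n + 1).unpair.2,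
        ((n + 1).unpair.1 - (n + 1).unpair.2) + ((n + 1).unpair.2 - (n + 1).unpair.1),
        if (n + 1).unpair.2 ≤ (n + 1).unpair.1 then 1 else 0, k]) := by
  rw [unpair_succ]
  generalize n.unpair.1 = a
  generalize n.unpair.2 = b
  by_cases h₁ : b ≤ a
  · rw [if_pos h₁, if_pos h₁]
    refine .ite_pos _ one_ne_zero ?_
    by_cases h₂ : a = b
    · subst h₂
      rw [if_pos rfl]
      refine .ite_zero _ (by simp [regs]) <|
        .seq (decL (l' := [a, a, 0, 0, k]) ?_ ?_) <|
        .seq (incL (l' := [a, a + 1, 0, 0, k]) ?_ ?_) <|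
        .seq (mvL (l' := [0, a + 1, a, 0, k]) ?_ ?_ ?_ ?_) <| incL ?_ ?_
      all_goals simp
    · rw [if_neg h₂]
      refine .ite_pos _ (by simp [regs]; omega) <|
        .seq (incL (l' := [a, b + 1, (a - b) + (b - a), 1, k]) ?_ ?_) <| decL ?_ ?_
      all_goals simp
      exact ⟨by omega, by omega⟩
  · rw [if_neg h₁, if_neg h₁]
    refine .ite_zero _ rfl <|
        .seq (incL (l' := [a + 1, b, (a - b) + (b - a), 0, k]) ?_ ?_) <|
        .seq (decL (l' := [a + 1, b, b - (a + 1), 0, k]) ?_ ?_) ?_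
    rotate_right
    · by_cases h₂ : a + 1 = b
      · subst h₂
        rw [if_pos rfl]
        refine .ite_zero _ (by simp [regs]) <|
          .seq (mvL (l' := [a + 1, 0, a + 1, 0, k]) ?_ ?_ ?_ ?_) <| incL ?_ ?_
        all_goals simp
      · rw [if_neg h₂]
        refine .ite_pos _ (by simp [regs]; omega) <| (CExec.nop _).congr (congrArg regs ?_)
        simp
        exact ⟨by omega, by omega⟩
    all_goals simp
    omega

theorem unpairing (n : ℕ) :
    CExec Z .unpairing (regs [n]) (regs [n.unpair.1, n.unpair.2]) := by
  have h : CExec Z .unpairing (regs [n, 0, 0, 0, 0]) (regs [n.unpair.1, n.unpair.2, 0, 0, 0]) := by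
    have hl := loop_down (Z := Z) (j := 4) (P := .nextPair) (fun k => regs [k.unpair.1, k.unpair.2,
      (k.unpair.1 - k.unpair.2) + (k.unpair.2 - k.unpair.1),
        if k.unpair.2 ≤ k.unpair.1 then 1 else 0, n - k]) n (fun k _ => rfl) (fun k _ => by
          rw [update_regs _ (by simp)]
          exact nextPair k _)
    refine .seq (mvL (l' := [0, 0, 0, 0, n]) ?_ ?_ ?_ ?_) <|
      .seq (incL (l' := [0, 0, 0, 1, n]) ?_ ?_) <|
      .seq (hl.congr₂ (congrArg regs ?_) rfl) <|
      .seq (clrL rfl ?_) <| clrL ?_ ?_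
    all_goals simp
  exact h.congr₂ (regs_pad [n] 4) (regs_pad [n.unpair.1, n.unpair.2] 3)

end CExec

/-- The program computes a partial function. -/
def Computes (Z : Set ℕ) (P : CProg) (f : ℕ →. ℕ) : Prop :=
  ∀ n, ∀ y ∈ f n, CExec Z P (regs [n]) (regs [y])

namespace CProg

/-- A program for a pair of functions. -/
def pairProg (P Q : CProg) : CProg :=
  .seq (cp 0 1 2) <| .seq (.shift P) <| .seq (cp 0 2 3) <| .seq (.shifts 2 Q) <|
    .seq (clr 0) pairing

/-- A program for a primitive recursion. -/
def precProg (P Q : CProg) : CProg :=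
  .seq unpairing <| .seq (cp 0 2 3) <| .seq (.shifts 2 P) <|
    .seq (.loop 1 <| .seq (.dec 1) <| .seq (cp 3 7 9) <| .seq (mv 2 8) <|
      .seq (.shifts 6 pairing) <|
      .seq (cp 0 5 7) <| .seq (.shifts 4 pairing) <| .seq (.shifts 4 Q) <|
      .seq (mv 4 2) (.inc 3)) <|
    .seq (clr 0) <| .seq (clr 3) (mv 2 0)

/-- A program for a search. -/
def rfindProg (P : CProg) : CProg :=
  .seq (.inc 2) <| .seq (.loop 2 <| .seq (clr 2) <| .seq (cp 0 3 5) <| .seq (cp 1 4 5) <|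
      .seq (.shifts 2 pairing) <| .seq (.shifts 2 P) <| .ite 2 (.inc 1) nop) <|
    .seq (clr 0) (mv 1 0)

end CProg

variable {Z : Set ℕ}

theorem Computes.pair {P Q : CProg} {f g : ℕ →. ℕ} (hP : Computes Z P f) (hQ : Computes Z Q g) :
    Computes Z (.pairProg P Q) fun n => Nat.pair <$> f n <*> g n := by
  intro n y hy
  obtain ⟨a, ha, b, hb, rfl⟩ : ∃ a ∈ f n, ∃ b ∈ g n, y = Nat.pair a b := by
    simpa [Seq.seq, eq_comm] using hy
  refine CExec.congr₂ (v := regs [n, 0, 0, 0]) ?_ (regs_pad [n] 3) rfl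
  refine .seq (.cpL (l' := [n, n, 0, 0]) ?_ ?_ ?_ ?_ ?_ ?_) <|
    .seq (CExec.congr₂ (.shiftsL (hP n a ha) [n]) (regs_pad [n, n] 2).symm
      (regs_pad [n, a] 2).symm) <|
    .seq (.cpL (l' := [n, a, n, 0]) ?_ ?_ ?_ ?_ ?_ ?_) <|
    .seq (CExec.congr₂ (.shiftsL (hQ n b hb) [n, a]) (regs_pad [n, a, n] 1).symm rfl) <|
    .seq (.clrL (l' := [0, a, b]) ?_ ?_) <| .pairing a b
  all_goals simp

theorem Computes.comp {P Q : CProg} {f g : ℕ →. ℕ} (hP : Computes Z P f) (hQ : Computes Z Q g) :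
    Computes Z (.seq Q P) fun n => g n >>= f := by
  intro n y hy
  obtain ⟨a, ha, hy⟩ := Part.mem_bind_iff.1 hy
  exact (hQ n a ha).seq (hP a y hy)

theorem Computes.prec {P Q : CProg} {f g : ℕ →. ℕ} (hP : Computes Z P f) (hQ : Computes Z Q g) :
    Computes Z (.precProg P Q) fun p =>
      let (a, n) := Nat.unpair p
      n.rec (f a) fun y IH => IH >>= fun i => g (Nat.pair a (Nat.pair y i)) := by
  intro p y hy
  rcases hp : p.unpair with ⟨a, m⟩
  simp only [hp] at hy
  -- Convergence of the recursion at m provides the whole sequence of its intermediate values.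
  obtain ⟨S, hS₀, hS, hSm⟩ : ∃ S : ℕ → ℕ, S 0 ∈ f a ∧
      (∀ k < m, S (k + 1) ∈ g (Nat.pair a (Nat.pair k (S k)))) ∧ S m = y := by
    clear hp
    induction m generalizing y with
    | zero => exact ⟨fun _ => y, hy, by simp, rfl⟩
    | succ m ih =>
      obtain ⟨i, hi, hy⟩ := Part.mem_bind_iff.1 hy
      obtain ⟨S, hS₀, hS, hSm⟩ := ih i hi
      refine ⟨fun k => if k ≤ m then S k else y, by simpa using hS₀, fun k hk => ?_, by simp⟩
      rcases Nat.lt_succ_iff_lt_or_eq.1 hk with h | rfl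
      · simpa [h.le, Nat.succ_le_of_lt h] using hS k h
      · simpa [hSm] using hy
  subst hSm
  -- Registers 0 to 3 hold the parameter, the number of remaining passes, the current value and the
  -- current stage. The other six are scratch, in which the argument of `Q` is assembled from the
  -- inside out.
  have hl := CExec.loop_down (Z := Z) (j := 1) (P := .seq (.cp 3 7 9) <| .seq (.mv 2 8) <|
      .seq (.shifts 6 .pairing) <| .seq (.cp 0 5 7) <| .seq (.shifts 4 .pairing) <|
      .seq (.shifts 4 Q) <| .seq (.mv 4 2) (.inc 3))
    (fun k => regs [a, m - k, S k, k, 0, 0, 0, 0, 0, 0]) m (fun k _ => rfl) (fun k hk => by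
      rw [update_regs _ (by simp)]
      refine .seq (.cpL (l' := [a, m - (k + 1), S k, k, 0, 0, 0, k, 0, 0]) ?_ ?_ ?_ ?_ ?_ ?_) <|
        .seq (.mvL (l' := [a, m - (k + 1), 0, k, 0, 0, 0, k, S k, 0]) ?_ ?_ ?_ ?_) <|
        .seq (CExec.congr₂ (.shiftsL (.pairing k (S k)) [a, m - (k + 1), 0, k, 0, 0])
          (regs_pad [a, m - (k + 1), 0, k, 0, 0, 0, k, S k] 1).symm
          (regs_pad [a, m - (k + 1), 0, k, 0, 0, Nat.pair k (S k)] 3).symm) <|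
        .seq (.cpL (l' := [a, m - (k + 1), 0, k, 0, a, Nat.pair k (S k), 0, 0, 0])
          ?_ ?_ ?_ ?_ ?_ ?_) <|
        .seq (CExec.congr₂ (.shiftsL (.pairing a (Nat.pair k (S k))) [a, m - (k + 1), 0, k])
          (regs_pad [a, m - (k + 1), 0, k, 0, a, Nat.pair k (S k)] 3).symm rfl) <|
        .seq (CExec.congr₂ (.shiftsL (hQ _ _ (hS k hk)) [a, m - (k + 1), 0, k])
          rfl (regs_pad [a, m - (k + 1), 0, k, S (k + 1)] 5).symm) <|
        .seq (.mvL (l' := [a, m - (k + 1), S (k + 1), k, 0, 0, 0, 0, 0, 0]) ?_ ?_ ?_ ?_) <|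
        .incL ?_ ?_
      all_goals simp)
  have hu := CExec.unpairing (Z := Z) p
  rw [hp] at hu
  refine hu.seq ?_
  refine CExec.congr₂ (v := regs [a, m, 0, 0]) ?_ (regs_pad [a, m] 2) (regs_pad [S m] 9)
  refine .seq (.cpL (l' := [a, m, a, 0]) ?_ ?_ ?_ ?_ ?_ ?_) <|
    .seq (CExec.congr₂ (.shiftsL (hP _ _ hS₀) [a, m]) (regs_pad [a, m, a] 1).symm
      (regs_pad [a, m, S 0] 7).symm) <|
    .seq hl <| .seq (.clrL (l' := [0, 0, S m, m, 0, 0, 0, 0, 0, 0]) ?_ ?_) <|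
    .seq (.clrL (l' := [0, 0, S m, 0, 0, 0, 0, 0, 0, 0]) ?_ ?_) <|
    .mvL ?_ ?_ ?_ ?_
  all_goals simp

theorem Computes.rfind {P : CProg} {f : ℕ →. ℕ} (hP : Computes Z P f) :
    Computes Z (.rfindProg P) fun a =>
      Nat.rfind fun n => (fun m => m = 0) <$> f (Nat.pair a n) := by
  intro a y hy
  obtain ⟨h₁, h₂⟩ := Nat.mem_rfind.1 hy
  have h₁' : 0 ∈ f (Nat.pair a y) := by simpa using h₁
  have h₂' : ∀ k < y, ∃ z ∈ f (Nat.pair a k), z ≠ 0 := by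
    intro k hk
    simpa using h₂ hk
  choose! z hz hz0 using h₂'
  have hbody : ∀ k w, w ∈ f (Nat.pair a k) → ∀ c v,
      CExec Z (.ite 2 (.inc 1) .nop) (regs [a, k, w]) v →
      CExec Z (.seq (.clr 2) <| .seq (.cp 0 3 5) <| .seq (.cp 1 4 5) <|
      .seq (.shifts 2 .pairing) <| .seq (.shifts 2 P) <| .ite 2 (.inc 1) .nop)
      (regs [a, k, c]) v := by
    intro k w hw c v hv
    refine CExec.congr₂ (v := regs [a, k, c, 0, 0, 0]) ?_ (regs_pad [a, k, c] 3) rfl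
    refine .seq (.clrL (l' := [a, k, 0, 0, 0, 0]) ?_ ?_) <|
      .seq (.cpL (l' := [a, k, 0, a, 0, 0]) ?_ ?_ ?_ ?_ ?_ ?_) <|
      .seq (.cpL (l' := [a, k, 0, a, k, 0]) ?_ ?_ ?_ ?_ ?_ ?_) <|
      .seq (CExec.congr₂ (.shiftsL (.pairing a k) [a, k]) (regs_pad [a, k, 0, a, k] 1).symm rfl) <|
      .seq (.shiftsL (hP _ _ hw) [a, k]) hv
    all_goals simp
  -- Register 2 controls the loop: it is 1 at the entrance, then holds the last value found, and
  -- becomes 0 in pass y + 1, in which register 1 is not incremented any more.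
  have hl := CExec.loop_iterate (Z := Z) (j := 2) (P := .seq (.clr 2) <| .seq (.cp 0 3 5) <|
      .seq (.cp 1 4 5) <| .seq (.shifts 2 .pairing) <| .seq (.shifts 2 P) <| .ite 2 (.inc 1) .nop)
    (fun k => if k ≤ y then regs [a, k, if k = 0 then 1 else z (k - 1)] else regs [a, y, 0]) (y + 1)
    (fun k hk => by
      rw [if_pos (by omega)]
      by_cases h : k = 0
      · simp [regs, h]
      · simpa [regs, h] using hz0 (k - 1) (by omega))
    (fun k hk => by
      rw [if_pos (by omega)]
      rcases Nat.lt_succ_iff_lt_or_eq.1 hk with h | rfl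
      · rw [if_pos (Nat.succ_le_of_lt h)]
        refine hbody k _ (hz k h) _ _ (.ite_pos _ (hz0 k h) (.incL ?_ ?_)) <;> simp
      · rw [if_neg (Nat.not_succ_le_self k)]
        exact hbody k 0 h₁' _ _ (.ite_zero _ rfl (.nop _)))
    (by simp [regs])
  rw [if_pos (Nat.zero_le _), if_neg (Nat.not_succ_le_self y), if_pos rfl] at hl
  refine CExec.congr₂ (v := regs [a, 0, 0]) ?_ (regs_pad [a] 2) (regs_pad [y] 2)
  refine .seq (.incL (l' := [a, 0, 1]) ?_ ?_) <| .seq hl <| .seq (.clrL (l' := [0, y, 0]) ?_ ?_) <|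
    .mvL ?_ ?_ ?_ ?_
  all_goals simp

/-- No running times are recorded: it will be enough that each computation takes some number of
steps determined by its argument. -/
theorem exists_computes {f : ℕ →. ℕ} (hf : Nat.RecursiveIn {charFun Z} f) :
    ∃ P, Computes Z P f := by
  induction hf with
  | zero =>
    refine ⟨.clr 0, fun n y hy => ?_⟩
    obtain rfl : y = 0 := Part.mem_some_iff.1 hy
    exact .clrL (by simp) (by simp)
  | succ =>
    refine ⟨.inc 0, fun n y hy => ?_⟩
    obtain rfl : y = n + 1 := Part.mem_some_iff.1 hy
    exact .incL (by simp) (by simp)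
  | left =>
    refine ⟨.seq .unpairing (.clr 1), fun n y hy => ?_⟩
    obtain rfl : y = n.unpair.1 := Part.mem_some_iff.1 hy
    exact (CExec.seq (.unpairing n) (.clrL rfl (by simp))).congr (regs_pad [n.unpair.1] 1)
  | right =>
    refine ⟨.seq .unpairing (.seq (.clr 0) (.mv 1 0)), fun n y hy => ?_⟩
    obtain rfl : y = n.unpair.2 := Part.mem_some_iff.1 hy
    refine (CExec.seq (.unpairing n) (.seq (.clrL rfl ?_)
      (.mvL (l' := [n.unpair.2, 0]) ?_ ?_ ?_ ?_))).congr
      (regs_pad [n.unpair.2] 1)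
    all_goals simp
  | oracle g hg =>
    obtain rfl : g = charFun Z := hg
    refine ⟨.query, fun n y hy => ?_⟩
    have hy' := Part.mem_some_iff.1 hy
    subst hy'
    exact (CExec.query _).congr (update_regs _ (by simp))
  | pair _ _ ihf ihg =>
    obtain ⟨P, hP⟩ := ihf
    obtain ⟨Q, hQ⟩ := ihg
    exact ⟨_, hP.pair hQ⟩
  | comp _ _ ihf ihg =>
    obtain ⟨P, hP⟩ := ihf
    obtain ⟨Q, hQ⟩ := ihg
    exact ⟨_, hP.comp hQ⟩
  | prec _ _ ihf ihg =>
    obtain ⟨P, hP⟩ := ihf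
    obtain ⟨Q, hQ⟩ := ihg
    exact ⟨_, hP.prec hQ⟩
  | rfind _ ihf =>
    obtain ⟨P, hP⟩ := ihf
    exact ⟨_, hP.rfind⟩

end SpeedLow

/-! ### Oracle queries about numbers, and compilation of counter programs -/

namespace SpeedLow

open Turing

section Query

variable {W Γ : Type} {A : Set (List Bool)}

/-- The tape symbols for a word. -/
def bits (w : List Bool) : List (TapeSymbol Γ) := w.map fun b => some (Sum.inl b)

theorem isSome_of_mem_bits {w : List Bool} {a : TapeSymbol Γ}
    (h : a ∈ (bits w : List (TapeSymbol Γ))) :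
    a.isSome = true := by
  obtain ⟨b, -, rfl⟩ := List.mem_map.1 h
  rfl

theorem getI_bits_append (w : List Bool) (i : ℕ) :
    (bits w : List (TapeSymbol Γ)).getI i = (w[i]?).map Sum.inl := by
  rw [List.getI_eq_getElem?_getD]
  simp only [bits, List.getElem?_map]
  cases w[i]? <;> rfl

theorem holdsWord_bits (w : List Bool) :
    HoldsWord (Tape.mk₁ (bits w : List (TapeSymbol Γ))) w := by
  refine ⟨fun i => ?_, fun b => ?_⟩
  · rw [nth_mk₁_nat, getI_bits_append]
    simp
  · rw [nth_mk₁_nat, getI_bits_append]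
    simp

theorem HoldsWord.unique {T : Tape (TapeSymbol Γ)} {w w' : List Bool} (h : HoldsWord T w)
    (h' : HoldsWord T w') : w = w' := by
  have hlen : ∀ {w w' : List Bool}, HoldsWord T w → HoldsWord T w' → w'.length ≤ w.length := by
    intro w w' h h'
    by_contra hlt
    exact h.2 _ (h'.1 ⟨w.length, by omega⟩)
  have hl : w.length = w'.length := le_antisymm (hlen h' h) (hlen h h')
  refine List.ext_getElem hl fun i h₁ h₂ => ?_
  have := (h.1 ⟨i, h₁⟩).symm.trans (h'.1 ⟨i, h₂⟩)
  simpa using this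

theorem exists_holdsWord_bits (w : List Bool) :
    (∃ w' ∈ A, HoldsWord (Tape.mk₁ (bits w : List (TapeSymbol Γ))) w') ↔ w ∈ A :=
  ⟨fun ⟨_, h, h'⟩ => HoldsWord.unique h' (holdsWord_bits w) ▸ h, fun h => ⟨w, h, holdsWord_bits w⟩⟩

/-- Finish the increment of a word when the head has reached a letter. -/
noncomputable def Prog.succAux (i : TapeName W) : Prog W Γ :=
  .seq (.loop (fun h => match h i with | some (Sum.inl b) => b | _ => false)
      (.on i fun _ => (some (Sum.inl false), some Dir.left)))
    (.seq (.on i fun a => (some (Sum.inl a.isSome), none)) (.slide i Dir.right))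

/-- Pass to the next word, with the head behind the last letter. -/
noncomputable def Prog.succWord (i : TapeName W) : Prog W Γ :=
  .seq (.go i Dir.left) (.succAux i)

/-- Go to the first letter of a word. -/
noncomputable def Prog.home (i : TapeName W) : Prog W Γ :=
  .seq (.go i Dir.left) (.rewind i)

/-- Erase a word. -/
noncomputable def Prog.wipe (i : TapeName W) : Prog W Γ :=
  .loop (fun h => (h i).isSome) (.on i fun _ => (none, some Dir.right))

-- With the head behind the word, the left half of the zipper lists the letters with the least
-- significant one first, as `wordSucc` expects. Moving left, ones become zeros until a 0 turns into
-- 1 or a blank into a new letter 0; both are covered by writing `a.isSome`.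
open Classical in
theorem RunsIn.succAux (i : TapeName W) (l : List Bool) : ∀ R : List (TapeSymbol Γ),
    (∀ a ∈ R, a.isSome = true) → ∃ B, ∀ T : Tapes W Γ, RunsIn A (.succAux i)
      (Function.update T i ((Tape.mk₂ (bits l) R).move Dir.left))
      (Function.update T i (Tape.mk₂ (R.reverse ++ bits (wordSucc l)) [])) B := by
  induction l with
  | nil =>
    intro R hR
    refine ⟨1 + (1 + (2 * (R.length + 1) + 1)), fun T => ?_⟩
    rw [show (bits [] : List (TapeSymbol Γ)) = [] from rfl, move_left_mk₂_nil]
    have h := RunsIn.slide_right (A := A) (i := i) (T := T) [] (some (Sum.inl false) :: R) (by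
      simpa using hR)
    rw [List.reverse_cons, List.append_assoc, List.append_nil] at h
    exact RunsIn.seq (RunsIn.loop_false (by simp [heads])) (RunsIn.seq (RunsIn.on rfl) h)
  | cons b l ih =>
    intro R hR
    rw [show (bits (b :: l) : List (TapeSymbol Γ)) = some (Sum.inl b) :: bits l from rfl,
      move_left_mk₂_cons]
    cases b with
    | false =>
      refine ⟨1 + (1 + (2 * (R.length + 1) + 1)), fun T => ?_⟩
      have h := RunsIn.slide_right (A := A) (i := i) (T := T) (bits l)
        (some (Sum.inl true) :: R) (by
        simpa using hR)
      rw [List.reverse_cons, List.append_assoc] at h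
      exact RunsIn.seq (RunsIn.loop_false (by simp [heads])) (RunsIn.seq (RunsIn.on rfl) h)
    | true =>
      obtain ⟨B, hB⟩ := ih (some (Sum.inl false) :: R) (by simpa using hR)
      refine ⟨1 + 1 + B, fun T => ?_⟩
      have h := hB T
      rw [List.reverse_cons, List.append_assoc] at h
      exact RunsIn.seq_loop_true (by simp [heads]) (RunsIn.on rfl) h

open Classical in
theorem RunsIn.succWord (i : TapeName W) (l : List Bool) : ∃ B, ∀ T : Tapes W Γ,
    RunsIn A (.succWord i) (Function.update T i (Tape.mk₂ (bits l) []))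
      (Function.update T i (Tape.mk₂ (bits (wordSucc l)) [])) B := by
  obtain ⟨B, hB⟩ := RunsIn.succAux (A := A) (Γ := Γ) i l [] (by simp)
  exact ⟨_, fun T => (RunsIn.go _).seq (hB T)⟩

open Classical in
theorem RunsIn.home (i : TapeName W) (l : List Bool) : ∃ B, ∀ T : Tapes W Γ,
    RunsIn A (.home i) (Function.update T i (Tape.mk₂ (bits l) []))
      (Function.update T i (Tape.mk₁ (bits l.reverse))) B := by
  cases l with
  | nil =>
    refine ⟨1 + (1 + 1), fun T => ?_⟩
    have h₁ := RunsIn.go (A := A) (i := i) Dir.left (T := T) (X := Tape.mk₂ [] [])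
    rw [move_left_mk₂_nil] at h₁
    have h₂ := RunsIn.go (A := A) (i := i) Dir.right (T := T) (X := Tape.mk₂ [] [default])
    rw [move_right_mk₂_cons, mk₂_default] at h₂
    exact h₁.seq (RunsIn.seq (RunsIn.loop_false (by simp [heads]; rfl)) h₂)
  | cons b l =>
    refine ⟨1 + (2 * (bits l : List (TapeSymbol Γ)).length + 4), fun T => ?_⟩
    have h₁ := RunsIn.go (A := A) (i := i) Dir.left (T := T) (X := Tape.mk₂ (bits (b :: l)) [])
    rw [show (bits (b :: l) : List (TapeSymbol Γ)) = some (Sum.inl b) :: bits l from rfl,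
      move_left_mk₂_cons] at h₁
    have h₂ := RunsIn.rewind (A := A) (i := i) (T := T) (bits l) [] (some (Sum.inl b))
      (fun _ h => isSome_of_mem_bits h) rfl
    have h₃ : (bits l : List (TapeSymbol Γ)).reverse ++ [some (Sum.inl b)] =
        bits (b :: l).reverse := by simp [bits]
    rw [h₃] at h₂
    exact h₁.seq h₂

open Classical in
theorem RunsIn.wipe (i : TapeName W) (l : List Bool) : ∃ B, ∀ T : Tapes W Γ,
    RunsIn A (.wipe i) (Function.update T i (Tape.mk₁ (bits l)))
      (Function.update T i (Tape.mk₁ [])) B := by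
  induction l with
  | nil => exact ⟨_, fun T => RunsIn.loop_false (by simp [heads, bits, mk₁_eq_mk₂]; rfl)⟩
  | cons b l ih =>
    obtain ⟨B, hB⟩ := ih
    refine ⟨_, fun T => RunsIn.loop_true (by simp [heads, bits, mk₁_eq_mk₂]) (RunsIn.on ?_) (hB T)⟩
    rw [mk₁_eq_mk₂, mk₁_eq_mk₂, ← mk₂_default (bits l)]
    rfl

end Query

/-! ### Machines for counter programs -/

/-- A counter. -/
def ctr (n : ℕ) : Tape (TapeSymbol Unit) := (Tape.move Dir.right)^[n] (Tape.mk₁ [some (Sum.inr ())])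

/-- The test for zero. -/
def zeroSym : TapeSymbol Unit → Bool
  | some (Sum.inr _) => true
  | _ => false

theorem zeroSym_ctr (n : ℕ) : zeroSym (ctr n).head = decide (n = 0) := by
  rw [ctr, head_shiftR, nth_mk₁_nat]
  cases n with
  | zero => rfl
  | succ n => rfl

theorem move_right_ctr (n : ℕ) : (ctr n).move Dir.right = ctr (n + 1) :=
  (Function.iterate_succ_apply' _ _ _).symm

theorem move_left_ctr (n : ℕ) : (ctr (n + 1)).move Dir.left = ctr n := by
  rw [← move_right_ctr]
  exact shiftL_shiftR 1 (ctr n)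

variable {m : ℕ}

/-- The tape of a register. -/
def regTape (m i : ℕ) : TapeName (Fin (m + 1)) := .work (Fin.ofNat (m + 1) i)

/-- The tapes that represent registers. -/
def regTapes (m : ℕ) (X Y : Tape (TapeSymbol Unit)) (v : ℕ → ℕ) : Tapes (Fin (m + 1)) Unit
  | .input => X
  | .query => Y
  | .work i => ctr (v i)

theorem regTapes_regTape {X Y : Tape (TapeSymbol Unit)} {v : ℕ → ℕ} {i : ℕ} (hi : i ≤ m) :
    regTapes m X Y v (regTape m i) = ctr (v i) := by
  have : i % (m + 1) = i := Nat.mod_eq_of_lt (by omega)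
  simp [regTape, regTapes, this]

open Classical in
theorem update_regTape {X Y : Tape (TapeSymbol Unit)} {v : ℕ → ℕ} {i : ℕ} (hi : i ≤ m) (n : ℕ) :
    Function.update (regTapes m X Y v) (regTape m i) (ctr n) =
      regTapes m X Y (Function.update v i n) := by
  have hmod : i % (m + 1) = i := Nat.mod_eq_of_lt (by omega)
  funext j
  by_cases hj : j = regTape m i
  · subst hj
    rw [Function.update_self, regTapes_regTape hi, Function.update_self]
  · rw [Function.update_of_ne hj]
    rcases j with _ | _ | j
    · rfl
    · rfl
    · have : (j : ℕ) ≠ i := by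
        rintro rfl
        exact hj (congrArg TapeName.work (Fin.ext (by simp)))
      simp [regTapes, Function.update_of_ne this]

open Classical in
theorem update_query {X Y Y' : Tape (TapeSymbol Unit)} {v : ℕ → ℕ} :
    Function.update (regTapes m X Y v) .query Y' = regTapes m X Y' v := by
  funext j
  rcases j with _ | _ | j <;> simp [regTapes]

open Classical in
theorem update_input {X X' Y : Tape (TapeSymbol Unit)} {v : ℕ → ℕ} :
    Function.update (regTapes m X Y v) .input X' = regTapes m X' Y v := by
  funext j
  rcases j with _ | _ | j <;> simp [regTapes]

section

variable {A : Set (List Bool)} {X Y : Tape (TapeSymbol Unit)} {v : ℕ → ℕ} {i : ℕ}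

theorem RunsIn.incReg (hi : i ≤ m) : RunsIn A (.go (regTape m i) Dir.right) (regTapes m X Y v)
    (regTapes m X Y (Function.update v i (v i + 1))) 1 := by
  classical
  have h := RunsIn.go (A := A) (i := regTape m i) Dir.right (T := regTapes m X Y v)
    (X := ctr (v i))
  rwa [move_right_ctr, update_regTape hi, update_regTape hi, Function.update_eq_self] at h

theorem RunsIn.decReg (hi : i ≤ m) (hv : v i ≠ 0) :
    RunsIn A (.go (regTape m i) Dir.left) (regTapes m X Y v)
      (regTapes m X Y (Function.update v i (v i - 1))) 1 := by
  classical
  have h := RunsIn.go (A := A) (i := regTape m i) Dir.left (T := regTapes m X Y v)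
    (X := ctr (v i))
  obtain ⟨n, hn⟩ := Nat.exists_eq_succ_of_ne_zero hv
  rw [update_regTape hi, Function.update_eq_self, hn, Nat.succ_eq_add_one, move_left_ctr,
    update_regTape hi] at h
  rwa [hn]

theorem RunsIn.nop {W Γ : Type} {T : Tapes W Γ} : RunsIn A (.op fun h i => (h i, none)) T T 1 :=
  RunsIn.op fun _ => write_head _

theorem zeroSym_heads (hi : i ≤ m) :
    zeroSym (heads (regTapes m X Y v) (regTape m i)) = decide (v i = 0) := by
  rw [heads, regTapes_regTape hi, zeroSym_ctr]

end

namespace CProg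

/-- The largest register of a program. -/
def width : CProg → ℕ
  | inc j => j
  | dec j => j
  | query => 0
  | seq P Q => max P.width Q.width
  | shift P => P.width + 1
  | ite j P Q => max j (max P.width Q.width)
  | loop j P => max j P.width

/-- Ask the oracle about the number in a register. -/
noncomputable def queryProg (m i : ℕ) : Prog (Fin (m + 1)) Unit :=
  .seq (.loop (fun h => !zeroSym (h (regTape m i)))
      (.seq (.go (regTape m i) Dir.left) (.succWord .query)))
    (.seq (.home .query) (.seq (.ask (.go (regTape m i) Dir.right) (.op fun h i => (h i, none)))
      (.wipe .query)))

/-- The multitape program for a counter program whose registers start at a given number. -/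
noncomputable def compile (m : ℕ) : CProg → ℕ → Prog (Fin (m + 1)) Unit
  | inc j, k => .go (regTape m (k + j)) Dir.right
  | dec j, k => .ite (fun h => zeroSym (h (regTape m (k + j)))) (.op fun h i => (h i, none))
      (.go (regTape m (k + j)) Dir.left)
  | query, k => queryProg m k
  | seq P Q, k => .seq (P.compile m k) (Q.compile m k)
  | shift P, k => P.compile m (k + 1)
  | ite j P Q, k => .ite (fun h => zeroSym (h (regTape m (k + j)))) (Q.compile m k) (P.compile m k)
  | loop j P, k => .loop (fun h => !zeroSym (h (regTape m (k + j)))) (P.compile m k)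

end CProg

-- The register is counted down to zero while the query tape passes through the words in
-- length-lexicographic order, so it ends with the word of that number. The bound `B` is chosen
-- before the input tape `X`, so the time is independent of the input.
open Classical in
theorem RunsIn.queryProg {Z : Set ℕ} {i : ℕ} (hi : i ≤ m) (v : ℕ → ℕ) :
    ∃ B, ∀ X, RunsIn (toLanguage Z) (CProg.queryProg m i) (regTapes m X (Tape.mk₁ []) v)
      (regTapes m X (Tape.mk₁ []) (Function.update v i (if v i ∈ Z then 1 else 0))) B := by
  have hloop : ∀ (n : ℕ) (l : List Bool), ∃ B, ∀ X, RunsIn (toLanguage Z)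
      (.loop (fun h => !zeroSym (h (regTape m i)))
        (.seq (.go (regTape m i) Dir.left) (.succWord .query)))
      (regTapes m X (Tape.mk₂ (bits l) []) (Function.update v i n))
      (regTapes m X (Tape.mk₂ (bits (wordSucc^[n] l)) []) (Function.update v i 0)) B := by
    intro n
    induction n with
    | zero =>
      intro l
      exact ⟨_, fun X => RunsIn.loop_false (by rw [zeroSym_heads hi]; simp)⟩
    | succ n ih =>
      intro l
      obtain ⟨B₁, h₁⟩ := RunsIn.succWord (W := Fin (m + 1)) (Γ := Unit) (A := toLanguage Z) .query l
      obtain ⟨B₂, h₂⟩ := ih (wordSucc l)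
      refine ⟨1 + (1 + B₁) + B₂, fun X => RunsIn.loop_true (by rw [zeroSym_heads hi]; simp)
        (RunsIn.seq (RunsIn.decReg hi (by simp)) ?_) (h₂ X)⟩
      have h := h₁ (regTapes m X (Tape.mk₁ []) (Function.update v i n))
      rw [update_query, update_query] at h
      simpa using h
  obtain ⟨B₁, h₁⟩ := hloop (v i) []
  rw [Function.update_eq_self] at h₁
  set l := wordSucc^[v i] [] with hl
  obtain ⟨B₂, h₂⟩ := RunsIn.home (W := Fin (m + 1)) (Γ := Unit) (A := toLanguage Z) .query l
  obtain ⟨B₃, h₃⟩ := RunsIn.wipe (W := Fin (m + 1)) (Γ := Unit) (A := toLanguage Z) .query l.reverse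
  have hq : l.reverse ∈ toLanguage Z ↔ v i ∈ Z := by
    change lexNum _ ∈ Z ↔ _
    rw [lexNum_eq, List.reverse_reverse, hl, wordIndex_iterate_wordSucc]
  refine ⟨B₁ + (B₂ + (2 + B₃)), fun X => (h₁ X).seq ?_⟩
  have h₂' := h₂ (regTapes m X (Tape.mk₁ []) (Function.update v i 0))
  rw [update_query, update_query] at h₂'
  refine h₂'.seq (RunsIn.seq (T₁ := regTapes m X (Tape.mk₁ (bits l.reverse))
    (Function.update v i (if v i ∈ Z then 1 else 0))) ?_ ?_)
  · by_cases hZ : v i ∈ Z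
    · obtain ⟨t, ht, h⟩ := RunsIn.incReg (A := toLanguage Z) (X := X)
        (Y := Tape.mk₁ (bits l.reverse)) (v := Function.update v i 0) hi
      refine ⟨t + 1, by omega, .ask_true _ ((exists_holdsWord_bits _).2 (hq.2 hZ)) ?_⟩
      simpa [hZ] using h
    · obtain ⟨t, ht, h⟩ := RunsIn.nop (A := toLanguage Z)
        (T := regTapes m X (Tape.mk₁ (bits l.reverse)) (Function.update v i 0))
      refine ⟨t + 1, by omega, .ask_false _ (fun h => hZ (hq.1 ((exists_holdsWord_bits _).1 h))) ?_⟩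
      simpa [hZ] using h
  · have h := h₃ (regTapes m X (Tape.mk₁ []) (Function.update v i (if v i ∈ Z then 1 else 0)))
    rwa [update_query, update_query] at h

/-- Replace the registers from a given number on. -/
def glue (k : ℕ) (g v : ℕ → ℕ) : ℕ → ℕ := fun i => if i < k then g i else v (i - k)

theorem glue_apply (k : ℕ) (g v : ℕ → ℕ) (j : ℕ) : glue k g v (k + j) = v j := by
  simp [glue]

theorem glue_update (k : ℕ) (g v : ℕ → ℕ) (j n : ℕ) :
    glue k g (Function.update v j n) = Function.update (glue k g v) (k + j) n := by
  funext i
  simp only [glue, Function.update_apply]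
  grind

theorem glue_regCons (k : ℕ) (g v : ℕ → ℕ) (a : ℕ) :
    glue k g (regCons a v) = glue (k + 1) (Function.update g k a) v := by
  funext i
  simp only [glue, Function.update_apply]
  rcases lt_trichotomy i k with h | rfl | h
  · simp [h, h.ne, Nat.lt_succ_of_lt h]
  · simp [regCons]
  · obtain ⟨j, rfl⟩ := Nat.exists_eq_add_of_lt h
    have : k + j + 1 - k = j + 1 := by omega
    rw [if_neg (by omega), if_neg (by omega), this, Nat.add_sub_add_right]
    simp [regCons]

/-- The registers below k, set aside by enclosing shifts, are kept in the arbitrary `g` so that the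
induction passes through `shift`. As before, `B` does not depend on the input tape. -/
theorem CExec.compile {Z : Set ℕ} {P : CProg} {v v' : ℕ → ℕ} (h : CExec Z P v v') :
    ∀ (k : ℕ) (g : ℕ → ℕ), k + P.width ≤ m →
      ∃ B, ∀ X, RunsIn (toLanguage Z) (P.compile m k) (regTapes m X (Tape.mk₁ []) (glue k g v))
        (regTapes m X (Tape.mk₁ []) (glue k g v')) B := by
  induction h with
  | inc j v =>
    intro k g hk
    rw [glue_update, ← glue_apply k g v j]
    exact ⟨1, fun X => RunsIn.incReg hk⟩
  | dec j v =>
    intro k g hk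
    have hk : k + j ≤ m := hk
    rw [glue_update, ← glue_apply k g v j]
    by_cases hv : glue k g v (k + j) = 0
    · rw [hv, Nat.zero_sub, ← hv, Function.update_eq_self]
      exact ⟨_, fun X => RunsIn.ite_true ((zeroSym_heads hk).trans (decide_eq_true hv)) .nop⟩
    · exact ⟨_, fun X => RunsIn.ite_false ((zeroSym_heads hk).trans (decide_eq_false hv))
        (RunsIn.decReg hk hv)⟩
  | query v =>
    intro k g hk
    have h := RunsIn.queryProg (Z := Z) (i := k) hk (glue k g v)
    have h0 : glue k g v k = v 0 := glue_apply k g v 0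
    rw [h0] at h
    rw [glue_update]
    exact h
  | seq _ _ ih₁ ih₂ =>
    intro k g hk
    simp only [CProg.width] at hk
    obtain ⟨B₁, h₁⟩ := ih₁ k g (by omega)
    obtain ⟨B₂, h₂⟩ := ih₂ k g (by omega)
    exact ⟨_, fun X => (h₁ X).seq (h₂ X)⟩
  | shift a _ ih =>
    intro k g hk
    simp only [CProg.width] at hk
    rw [glue_regCons, glue_regCons]
    exact ih (k + 1) _ (by omega)
  | @ite_pos j P Q v v' hv _ ih =>
    intro k g hk
    simp only [CProg.width] at hk
    obtain ⟨B, hB⟩ := ih k g (by omega)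
    refine ⟨_, fun X => RunsIn.ite_false ?_ (hB X)⟩
    rw [zeroSym_heads (by omega), glue_apply]
    simpa using hv
  | @ite_zero j P Q v v' hv _ ih =>
    intro k g hk
    simp only [CProg.width] at hk
    obtain ⟨B, hB⟩ := ih k g (by omega)
    refine ⟨_, fun X => RunsIn.ite_true ?_ (hB X)⟩
    rw [zeroSym_heads (by omega), glue_apply]
    simpa using hv
  | @loop_zero j P v hv =>
    intro k g hk
    simp only [CProg.width] at hk
    refine ⟨_, fun X => RunsIn.loop_false ?_⟩
    rw [zeroSym_heads (by omega), glue_apply]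
    simpa using hv
  | @loop_pos j P v v₁ v₂ hv _ _ ih₁ ih₂ =>
    intro k g hk
    simp only [CProg.width] at hk
    obtain ⟨B₁, h₁⟩ := ih₁ k g (by omega)
    obtain ⟨B₂, h₂⟩ := ih₂ k g (by simp only [CProg.width]; omega)
    refine ⟨_, fun X => RunsIn.loop_true ?_ (h₁ X) (h₂ X)⟩
    rw [zeroSym_heads (by omega), glue_apply]
    simpa using hv

end SpeedLow

/-! ### Machines whose running time depends only on the leading ones of the input -/

namespace SpeedLow

open Turing

/-- The number of letters `1` at the beginning of a word. -/
def ones (x : List Bool) : ℕ := (x.takeWhile id).length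

theorem ones_replicate_append (e : ℕ) (x : List Bool) :
    ones (List.replicate e true ++ false :: x) = e := by
  induction e with
  | zero => rfl
  | succ e ih => simp [ones, List.replicate_succ]

theorem getElem?_of_lt_ones : ∀ {x : List Bool} {i : ℕ}, i < ones x → x[i]? = some true
  | [], _, h => by simp [ones] at h
  | false :: x, i, h => by simp [ones] at h
  | true :: x, 0, _ => rfl
  | true :: x, i + 1, h => getElem?_of_lt_ones (x := x) (by simpa [ones] using h)

theorem getElem?_ones : ∀ x : List Bool, x[ones x]? ≠ some true
  | [] => by simp
  | false :: x => by simp [ones]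
  | true :: x => by simpa [ones] using getElem?_ones x

/-- The test for the letter `1`. -/
def oneSym {Γ : Type} : TapeSymbol Γ → Bool
  | some (Sum.inl b) => b
  | _ => false

/-- The input tape with the head on a given letter. -/
def inputAt (x : List Bool) (n : ℕ) : Tape (TapeSymbol Unit) :=
  (Tape.move Dir.right)^[n] (Tape.mk₁ (bits x))

theorem head_inputAt (x : List Bool) (n : ℕ) : (inputAt x n).head = (x[n]?).map Sum.inl := by
  rw [inputAt, head_shiftR, nth_mk₁_nat, getI_bits_append]

theorem oneSym_head_inputAt (x : List Bool) (n : ℕ) :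
    oneSym (inputAt x n).head = decide (x[n]? = some true) := by
  rw [head_inputAt]
  rcases x[n]? with _ | (_ | _) <;> rfl

theorem isSome_head_inputAt (x : List Bool) (n : ℕ) :
    (inputAt x n).head.isSome = decide (n < x.length) := by
  rw [head_inputAt, Option.isSome_map]
  by_cases h : n < x.length <;> simp [h]

/-- Compute a function of the number of letters `1` at the beginning of the input, and advance on
the input tape by its value. -/
noncomputable def CProg.onInput (m : ℕ) (P : CProg) : Prog (Fin (m + 1)) Unit :=
  .seq (.op fun h i => match i with
      | .work _ => (some (Sum.inr ()), none)
      | i => (h i, none)) <|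
  .seq (.loop (fun h => oneSym (h .input))
    (.seq (.go (regTape m 0) Dir.right) (.go .input Dir.right))) <|
  .seq (P.compile m 0) <|
  .seq (.ite (fun h => zeroSym (h (regTape m 0))) (.op fun h i => (h i, none))
    (.go (regTape m 1) Dir.right)) <|
  .loop (fun h => !zeroSym (h (regTape m 0)))
    (.seq (.go (regTape m 0) Dir.left) (.go .input Dir.right))

theorem RunsIn.goInput {A : Set (List Bool)} {m : ℕ} {x : List Bool} {n : ℕ}
    {Y : Tape (TapeSymbol Unit)} {v : ℕ → ℕ} :
    RunsIn A (.go .input Dir.right) (regTapes m (inputAt x n) Y v)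
      (regTapes m (inputAt x (n + 1)) Y v) 1 := by
  classical
  have h := RunsIn.go (A := A) (i := .input) Dir.right (T := regTapes m (inputAt x n) Y v)
    (X := inputAt x n)
  rw [update_input, update_input] at h
  rwa [inputAt, ← Function.iterate_succ_apply' (Tape.move Dir.right)] at h

/-- The input head first passes the e leading ones and then advances by u e, consuming register 0;
register 1 remembers whether u e was zero. The head then scans a letter exactly if the input is
longer than e + u e, so the rest of the input is never visited and `B` depends on e alone. -/
theorem CProg.runsIn_onInput {Z : Set ℕ} {P : CProg} {u : ℕ → ℕ} {m : ℕ} (hm : 1 ≤ m)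
    (hP : P.width ≤ m) (hu : Computes Z P fun n => Part.some (u n)) (e : ℕ) :
    ∃ B, ∀ x, ones x = e →
      RunsIn (toLanguage Z) (P.onInput m) (initTapes (Fin (m + 1)) Unit x)
        (regTapes m (inputAt x (e + u e)) (Tape.mk₁ [])
          (regs [0, if u e = 0 then 0 else 1])) B := by
  obtain ⟨B, hB⟩ := (hu e (u e) (Part.mem_some _)).compile (m := m) 0 (fun _ => 0) (by omega)
  have hg : ∀ v, glue 0 (fun _ => 0) v = v := fun v => by
    funext i
    simp [glue]
  rw [hg, hg] at hB
  refine ⟨1 + ((e * (1 + 1 + 1) + 1) + (B + (2 + (u e * (1 + 1 + 1) + 1)))), fun x hx => ?_⟩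
  have h₀ : RunsIn (toLanguage Z) (.op fun h i => match i with
      | .work _ => (some (Sum.inr ()), none)
      | i => (h i, none)) (initTapes (Fin (m + 1)) Unit x)
      (regTapes m (inputAt x 0) (Tape.mk₁ []) (regs [0])) 1 := by
    refine RunsIn.op fun i => ?_
    rcases i with _ | _ | i
    · exact write_head _
    · exact write_head _
    · have : regs [0] (i : ℕ) = 0 := congrFun (regs_append_zero []) i
      simp only [regTapes, this]
      rfl
  have h₁ := RunsIn.loop_iterate (A := toLanguage Z) (c := fun h => oneSym (h .input))
    (P := .seq (.go (regTape m 0) Dir.right) (.go .input Dir.right)) (B := 1 + 1)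
    (fun k => regTapes m (inputAt x k) (Tape.mk₁ []) (regs [k])) e
    (fun k hk => (oneSym_head_inputAt x k).trans
      (decide_eq_true (getElem?_of_lt_ones (by omega))))
    (fun k hk => by
      have h := RunsIn.incReg (A := toLanguage Z) (X := inputAt x k) (Y := Tape.mk₁ [])
        (v := regs [k]) (Nat.zero_le m)
      rw [update_regs _ (by simp)] at h
      exact h.seq RunsIn.goInput)
    ((oneSym_head_inputAt x e).trans (decide_eq_false (hx ▸ getElem?_ones x)))
  have h₂ : RunsIn (toLanguage Z) (.ite (fun h => zeroSym (h (regTape m 0)))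
      (.op fun h i => (h i, none)) (.go (regTape m 1) Dir.right))
      (regTapes m (inputAt x e) (Tape.mk₁ []) (regs [u e]))
      (regTapes m (inputAt x e) (Tape.mk₁ []) (regs [u e, if u e = 0 then 0 else 1])) 2 := by
    by_cases h0 : u e = 0
    · rw [if_pos h0, show regs [u e, 0] = regs [u e] from regs_append_zero [u e]]
      exact RunsIn.ite_true ((zeroSym_heads (Nat.zero_le m)).trans (decide_eq_true h0)) .nop
    · rw [if_neg h0, ← regs_append_zero [u e]]
      have h := RunsIn.incReg (A := toLanguage Z) (X := inputAt x e) (Y := Tape.mk₁ [])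
        (v := regs [u e, 0]) hm
      rw [update_regs _ (by simp)] at h
      exact RunsIn.ite_false ((zeroSym_heads (Nat.zero_le m)).trans (decide_eq_false h0)) h
  have h₃ := RunsIn.loop_iterate (A := toLanguage Z) (c := fun h => !zeroSym (h (regTape m 0)))
    (P := .seq (.go (regTape m 0) Dir.left) (.go .input Dir.right)) (B := 1 + 1)
    (fun k => regTapes m (inputAt x (e + k)) (Tape.mk₁ [])
      (regs [u e - k, if u e = 0 then 0 else 1])) (u e)
    (fun k hk => by
      rw [zeroSym_heads (Nat.zero_le m)]
      simp [regs]
      omega)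
    (fun k hk => by
      have h := RunsIn.decReg (A := toLanguage Z) (X := inputAt x (e + k)) (Y := Tape.mk₁ [])
        (v := regs [u e - k, if u e = 0 then 0 else 1]) (Nat.zero_le m) (by simp [regs]; omega)
      rw [update_regs _ (by simp)] at h
      exact h.seq RunsIn.goInput)
    (by
      rw [zeroSym_heads (Nat.zero_le m)]
      simp [regs])
  simp only [Nat.sub_self, Nat.sub_zero, Nat.add_zero] at h₃
  exact h₀.seq (h₁.seq ((hB _).seq (h₂.seq h₃)))

/-- A function that is computable from a set `Z` yields a machine with oracle `Z` whose running
time depends only on the number of letters `1` at the beginning of the input. -/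
theorem exists_machine_of_recursiveIn {Z : Set ℕ} {u : ℕ → ℕ}
    (hu : Nat.RecursiveIn {charFun Z} fun n => Part.some (u n)) :
    ∃ (M : OracleTM) (τ : ℕ → ℕ), ∀ x, M.AnswersWithin (toLanguage Z) x (τ (ones x))
      (decide (u (ones x) ≠ 0 ∧ ones x + u (ones x) < x.length)) := by
  obtain ⟨P, hP⟩ := exists_computes hu
  let m := max 1 P.width
  choose B hB using CProg.runsIn_onInput (m := m) (le_max_left _ _) (le_max_right _ _) hP
  refine ⟨(P.onInput m).machine fun h => (h .input).isSome && !zeroSym (h (regTape m 1)),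
    fun e => B e + 1, fun x => ?_⟩
  obtain ⟨t, ht, h⟩ := hB (ones x) x rfl
  have hout := Exec.answersWithin (out := fun h => (h .input).isSome && !zeroSym (h (regTape m 1)))
    h (add_le_add ht le_rfl)
  rw [zeroSym_heads (le_max_left _ _)] at hout
  refine (congrArg _ ?_).mp hout
  have : (heads (regTapes m (inputAt x (ones x + u (ones x))) (Tape.mk₁ [])
      (regs [0, if u (ones x) = 0 then 0 else 1])) .input).isSome =
      decide (ones x + u (ones x) < x.length) := isSome_head_inputAt _ _
  rw [this]
  by_cases h0 : u (ones x) = 0 <;> simp [h0, regs]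

end SpeedLow

/-! ### Halting times and a computable language that is fast only with them -/

namespace SpeedLow

open Nat.Partrec (Code)

/-- The program with number `e` halts on input `0` within `j` steps. -/
def haltsBy (e j : ℕ) : Bool := (Code.evaln j (Denumerable.ofNat Code e) 0).isSome

theorem primrec_haltsBy : Primrec₂ haltsBy :=
  Primrec.option_isSome.comp (Code.primrec_evaln.comp
    (Primrec.pair (Primrec.pair Primrec.snd ((Primrec.ofNat Code).comp Primrec.fst))
      (Primrec.const 0)))

theorem haltsBy_mono {e j k : ℕ} (h : haltsBy e j = true) (hjk : j ≤ k) : haltsBy e k = true := by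
  obtain ⟨y, hy⟩ := Option.isSome_iff_exists.1 h
  exact Option.isSome_iff_exists.2 ⟨y, Code.evaln_mono hjk hy⟩

theorem haltsBy_zero (e : ℕ) : haltsBy e 0 = false := by
  simp [haltsBy, Code.evaln]

theorem exists_haltsBy (c : Code) :
    (∃ j, haltsBy (Encodable.encode c) j = true) ↔ (c.eval 0).Dom := by
  simp only [haltsBy, Denumerable.ofNat_encode, Option.isSome_iff_exists, Part.dom_iff_mem,
    Code.evaln_complete]
  exact exists_comm

open Classical in
/-- One more than the number of steps after which the program with number `e` halts on input `0`,
or `0` if it does not halt. -/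
noncomputable def haltTime (e : ℕ) : ℕ :=
  if h : ∃ j, haltsBy e j = true then Nat.find h + 1 else 0

theorem haltTime_ne_zero {e : ℕ} : haltTime e ≠ 0 ↔ ∃ j, haltsBy e j = true := by
  classical
  unfold haltTime
  split_ifs with h <;> simpa using h

theorem haltTime_eq {e j : ℕ} (h : haltsBy e j = true) (hlt : ∀ i < j, haltsBy e i = false) :
    haltTime e = j + 1 := by
  classical
  rw [haltTime, dif_pos ⟨j, h⟩, (Nat.find_eq_iff _).2 ⟨h, fun i hi => by simp [hlt i hi]⟩]

theorem haltTime_le {e j : ℕ} (h : haltsBy e j = true) : haltTime e ≤ j + 1 := by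
  classical
  rw [haltTime, dif_pos ⟨j, h⟩]
  exact Nat.succ_le_succ (Nat.find_min' _ h)

theorem haltsBy_haltTime {e : ℕ} (h : haltTime e ≠ 0) : haltsBy e (haltTime e - 1) = true := by
  classical
  have h' := haltTime_ne_zero.1 h
  rw [haltTime, dif_pos h', Nat.add_sub_cancel]
  exact Nat.find_spec h'

/-- The words `1 … 1 0 …` with `e` letters `1` and a length that exceeds the time that the program
with number `e` needs to halt. -/
def haltLang : Set (List Bool) :=
  {x | haltTime (ones x) ≠ 0 ∧ ones x + haltTime (ones x) < x.length}

/-- A criterion without `haltTime`, which makes the language computable. The 2 consists of the shift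
by one in `haltTime` and of the strict inequality; truncation in the subtraction does no harm, since
nothing halts within 0 steps. -/
theorem mem_haltLang (x : List Bool) :
    x ∈ haltLang ↔ haltsBy (ones x) (x.length - ones x - 2) = true := by
  constructor
  · rintro ⟨h, hx⟩
    exact haltsBy_mono (haltsBy_haltTime h) (by omega)
  · intro h
    have h0 : x.length - ones x - 2 ≠ 0 := fun h0 => by simp [h0, haltsBy_zero] at h
    have := haltTime_le h
    exact ⟨haltTime_ne_zero.2 ⟨_, h⟩, by omega⟩

theorem computablePred_haltLang : ComputablePred fun x => x ∈ haltLang := by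
  refine ComputablePred.computable_iff.2
    ⟨fun x => haltsBy (ones x) (x.length - ones x - 2), ?_, ?_⟩
  · have h : Primrec ones := Primrec.list_length.comp (Primrec.list_takeWhile Primrec.id)
    exact (primrec_haltsBy.comp h (Primrec.nat_sub.comp
      (Primrec.nat_sub.comp Primrec.list_length h) (Primrec.const 2))).to_comp
  · funext x
    exact propext (mem_haltLang x)

theorem take_padded {e T k : ℕ} (h : T ≤ k) :
    (List.replicate e true ++ false :: List.replicate T true).take T =
      (List.replicate e true ++ false :: List.replicate k true).take T := by
  obtain ⟨d, rfl⟩ := Nat.exists_eq_add_of_le h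
  have hp : List.replicate e true ++ false :: List.replicate (T + d) true =
      (List.replicate e true ++ false :: List.replicate T true) ++ List.replicate d true := by
    simp
  rw [hp]
  exact (List.take_append_of_le_length (by simp; omega)).symm

/-- No machine without oracle decides the language within a time that depends only on the number
of letters `1` at the beginning of the input. -/
theorem not_decidesInTime_haltLang (M : OracleTM) (τ : ℕ → ℕ) :
    ¬ M.DecidesInTime ∅ haltLang fun x => τ (ones x) := by
  intro hM
  obtain ⟨φ, hφ, hφM⟩ := exists_primrec_answers M
  let pad : ℕ → ℕ → List Bool := fun e T => List.replicate e true ++ false :: List.replicate T true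
  have hones : ∀ e T, ones (pad e T) = e := fun e T => ones_replicate_append e _
  have hlen : ∀ e T, (pad e T).length = e + T + 1 := fun e T => by simp [pad]; omega
  have hpad : Primrec₂ pad := Primrec.list_append.comp ((primrec_replicate true).comp Primrec.fst)
    (Primrec.list_cons.comp (Primrec.const false) ((primrec_replicate true).comp Primrec.snd))
  -- An answer after T steps has depended on the first T letters only, so it is also the answer for
  -- any longer padding. For padding at least as long as the halting time, membership says just that
  -- program e halts.
  have hcorrect : ∀ e T b, φ (pad e T) T = some b → (b = true ↔ haltTime e ≠ 0) := by
    intro e T b h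
    set k := max T (haltTime e) with hk
    have h₁ : M.AnswersWithin ∅ (pad e k) T b :=
      AnswersWithin.congr_input ((hφM _ _ _).1 h) (take_padded (le_max_left _ _))
    obtain ⟨b', h₂, hb'⟩ := hM (pad e k)
    rw [AnswersWithin.unique h₁ h₂, hb']
    change _ ∧ _ ↔ _
    rw [hones, hlen]
    refine and_iff_left ?_
    have := le_max_right T (haltTime e)
    omega
  -- The search for T succeeds because the time bound τ e is the same for all paddings; T = τ e is a
  -- witness.
  have hex : ∀ e, ∃ T b, φ (pad e T) T = some b := by
    intro e
    obtain ⟨b, h, -⟩ := hM (pad e (τ e))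
    simp only [hones] at h
    exact ⟨τ e, b, (hφM _ _ _).2 h⟩
  have hpart : Partrec fun c : Code =>
      Nat.rfindOpt fun T => φ (pad (Encodable.encode c) T) T := by
    refine Partrec.rfindOpt (Primrec.to_comp ?_)
    exact hφ.comp (hpad.comp (Primrec.encode.comp Primrec.fst) Primrec.snd) Primrec.snd
  have hmem : ∀ c : Code, decide (haltTime (Encodable.encode c) ≠ 0) ∈
      Nat.rfindOpt fun T => φ (pad (Encodable.encode c) T) T := by
    intro c
    have hdom := Nat.rfindOpt_dom.2 (hex (Encodable.encode c))
    obtain ⟨b, hb⟩ := Part.dom_iff_mem.1 hdom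
    obtain ⟨T, hT⟩ := Nat.rfindOpt_spec hb
    have := hcorrect _ _ _ hT
    rwa [show decide (haltTime (Encodable.encode c) ≠ 0) = b by
      cases b <;> simpa using this]
  refine ComputablePred.halting_problem 0 (ComputablePred.computable_iff.2
    ⟨fun c => decide (haltTime (Encodable.encode c) ≠ 0), hpart.of_eq_tot hmem, ?_⟩)
  funext c
  rw [← exists_haltsBy, ← haltTime_ne_zero]
  simp

/-- A polynomial of a function of the leading ones is again such a function, so polynomial slowdown
cannot help the machine without oracle. -/
theorem not_lowForSpeed_of_recursiveIn {Z : Set ℕ}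
    (hZ : Nat.RecursiveIn {charFun Z} fun n => Part.some (haltTime n)) :
    ¬ LowForSpeed (toLanguage Z) := by
  intro h
  obtain ⟨M, τ, hM⟩ := exists_machine_of_recursiveIn hZ
  obtain ⟨M', p, -, hM'⟩ := h haltLang computablePred_haltLang M (fun x => τ (ones x))
    fun x => ⟨_, hM x, decide_eq_true_iff⟩
  exact not_decidesInTime_haltLang M' (fun e => p.eval (τ e)) hM'

/-! ### Functions that are total and computable from a set -/

section Total

variable {O : Set (ℕ →. ℕ)}

theorem recursiveIn_comp {f g : ℕ → ℕ} (hf : Nat.RecursiveIn O fun n => Part.some (f n))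
    (hg : Nat.RecursiveIn O fun n => Part.some (g n)) :
    Nat.RecursiveIn O fun n => Part.some (f (g n)) :=
  (hf.comp hg).of_eq fun _ => Part.bind_some _ _

theorem recursiveIn_pair {f g : ℕ → ℕ} (hf : Nat.RecursiveIn O fun n => Part.some (f n))
    (hg : Nat.RecursiveIn O fun n => Part.some (g n)) :
    Nat.RecursiveIn O fun n => Part.some (Nat.pair (f n) (g n)) :=
  (hf.pair hg).of_eq fun _ => by simp [Seq.seq]

theorem recursiveIn_primrec {f : ℕ → ℕ} (hf : Primrec f) :
    Nat.RecursiveIn O fun n => Part.some (f n) :=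
  Nat.Primrec.recursiveIn (Primrec.nat_iff.1 hf)

theorem recursiveIn_primrec₂ {f : ℕ → ℕ → ℕ} {g h : ℕ → ℕ} (hf : Primrec₂ f)
    (hg : Nat.RecursiveIn O fun n => Part.some (g n))
    (hh : Nat.RecursiveIn O fun n => Part.some (h n)) :
    Nat.RecursiveIn O fun n => Part.some (f (g n) (h n)) := by
  have hu : Primrec fun n : ℕ => f n.unpair.1 n.unpair.2 :=
    hf.comp (Primrec.fst.comp Primrec.unpair) (Primrec.snd.comp Primrec.unpair)
  simpa using recursiveIn_comp (recursiveIn_primrec hu) (recursiveIn_pair hg hh)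

/-- The least zero of a function from a given number on. -/
theorem recursiveIn_next {f d : ℕ → ℕ} (hf : Nat.RecursiveIn O fun n => Part.some (f n))
    (hd : ∀ n, n ≤ d n ∧ f (d n) = 0 ∧ ∀ k, n ≤ k → k < d n → f k ≠ 0) :
    Nat.RecursiveIn O fun n => Part.some (d n) := by
  have hid : Nat.RecursiveIn O fun n => Part.some n := recursiveIn_primrec Primrec.id
  have hg : Nat.RecursiveIn O fun p => Part.some (f (p.unpair.1 + p.unpair.2)) :=
    recursiveIn_comp hf (recursiveIn_primrec (Primrec.nat_add.comp
      (Primrec.fst.comp Primrec.unpair) (Primrec.snd.comp Primrec.unpair)))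
  have hs : Nat.RecursiveIn O fun n => Part.some (d n - n) := by
    refine Nat.RecursiveIn.of_eq_tot hg.rfind fun n => ?_
    obtain ⟨h₁, h₂, h₃⟩ := hd n
    refine Nat.mem_rfind.2 ⟨?_, fun {m} hm => ?_⟩
    · simp [Nat.add_sub_cancel' h₁, h₂]
    · simpa using h₃ (n + m) (by omega) (by omega)
  refine (recursiveIn_primrec₂ Primrec.nat_add hid hs).of_eq fun n => ?_
  rw [Nat.add_sub_cancel' (hd n).1]

end Total

/-- A bound suffices: program e halts if and only if it does so within q e steps, and then the first
such stage is found by a bounded search. -/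
theorem recursiveIn_haltTime {O : Set (ℕ →. ℕ)} {q : ℕ → ℕ}
    (hq : Nat.RecursiveIn O fun n => Part.some (q n)) (h : ∀ e, haltTime e ≤ q e) :
    Nat.RecursiveIn O fun n => Part.some (haltTime n) := by
  have hH : Primrec₂ fun e q : ℕ =>
      cond (haltsBy e q) ((List.range (q + 1)).findIdx (haltsBy e) + 1) 0 :=
    Primrec.cond primrec_haltsBy (Primrec.succ.comp (Primrec.list_findIdx
      (Primrec.list_range.comp (Primrec.succ.comp Primrec.snd))
      (primrec_haltsBy.comp (Primrec.fst.comp Primrec.fst) Primrec.snd).to₂)) (Primrec.const 0)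
  refine (recursiveIn_primrec₂ hH (recursiveIn_primrec Primrec.id) hq).of_eq fun e => ?_
  congr 1
  by_cases h0 : haltTime e = 0
  · have hq0 : haltsBy e (q e) = false := by
      by_contra hc
      exact haltTime_ne_zero.2 ⟨q e, by simpa using hc⟩ h0
    simp [h0, hq0]
  · have h₁ := haltsBy_haltTime h0
    have h₂ : haltsBy e (q e) = true := haltsBy_mono h₁ (by have := h e; omega)
    have hlt : (List.range (q e + 1)).findIdx (haltsBy e) < (List.range (q e + 1)).length :=
      List.findIdx_lt_length_of_exists ⟨q e, by simp, h₂⟩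
    have hspec := List.findIdx_getElem (w := hlt)
    rw [List.getElem_range] at hspec
    rw [id, h₂, cond_true]
    refine (haltTime_eq hspec fun i hi => ?_).symm
    have := List.not_of_lt_findIdx hi
    simpa using this

end SpeedLow

/-! ### The join computes the halting times -/

namespace SpeedLow

/-- The set of natural numbers identified with a sparse language. -/
def sparseSet (X : ℕ → Bool) : Set ℕ := lexNum '' sparseLang X

theorem toLanguage_sparseSet (X : ℕ → Bool) : toLanguage (sparseSet X) = sparseLang X :=
  Set.ext fun _ => lexNum_injective.mem_set_image

/-- The number of the word at a given position. -/
def sparseNum (j : ℕ) : ℕ := 2 ^ (2 ^ (j + 1) - 2 + 1) - 2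

theorem primrec_sparseNum : Primrec sparseNum := by
  have hpow : Primrec₂ ((· ^ ·) : ℕ → ℕ → ℕ) := Primrec₂.unpaired'.1 Nat.Primrec.pow
  have h : Primrec fun n : ℕ => 2 ^ n := hpow.comp (Primrec.const 2) Primrec.id
  exact Primrec.nat_sub.comp (h.comp (Primrec.succ.comp (Primrec.nat_sub.comp
    (h.comp Primrec.succ) (Primrec.const 2)))) (Primrec.const 2)

theorem sparseNum_mem_iff (X : ℕ → Bool) (j : ℕ) : sparseNum j ∈ sparseSet X ↔ X j = true := by
  rw [sparseNum, ← lexNum_replicate_true, sparseSet, lexNum_injective.mem_set_image]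
  constructor
  · rintro ⟨i, hi, h⟩
    have hl : 2 ^ (j + 1) - 2 = 2 ^ (i + 1) - 2 := by simpa using congrArg List.length h
    have hji : j = i := sparse_injective hl
    rwa [hji]
  · exact fun h => ⟨j, h, rfl⟩

theorem recursiveIn_sparse_left {O : Set (ℕ →. ℕ)} {X Y : ℕ → Bool}
    (hJ : Nat.RecursiveIn O (charFun (setJoin (sparseSet X) (sparseSet Y)))) :
    Nat.RecursiveIn O fun n => Part.some (X n).toNat := by
  have h := hJ.comp (recursiveIn_primrec (O := O)
    (Primrec.nat_mul.comp (Primrec.const 2) primrec_sparseNum))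
  refine h.of_eq fun n => (Part.bind_some _ _).trans ?_
  have : 2 * sparseNum n ∈ setJoin (sparseSet X) (sparseSet Y) ↔ X n = true := by
    rw [← sparseNum_mem_iff]
    simp [setJoin]
  cases hX : X n <;> simp [charFun, this, hX]

theorem recursiveIn_sparse_right {O : Set (ℕ →. ℕ)} {X Y : ℕ → Bool}
    (hJ : Nat.RecursiveIn O (charFun (setJoin (sparseSet X) (sparseSet Y)))) :
    Nat.RecursiveIn O fun n => Part.some (Y n).toNat := by
  have h := hJ.comp (recursiveIn_primrec (O := O)
    (Primrec.succ.comp (Primrec.nat_mul.comp (Primrec.const 2) primrec_sparseNum)))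
  refine h.of_eq fun n => (Part.bind_some _ _).trans ?_
  have : 2 * sparseNum n + 1 ∈ setJoin (sparseSet X) (sparseSet Y) ↔ Y n = true := by
    rw [← sparseNum_mem_iff]
    have h₁ : (2 * sparseNum n + 1) % 2 = 1 := by omega
    have h₂ : (2 * sparseNum n + 1) / 2 = sparseNum n := by omega
    simp [setJoin, h₁, h₂]
  cases hY : Y n <;> simp [charFun, this, hY]

/-- If the distances between the differences of two sequences grow fast enough, then the join of
the corresponding sets computes the halting times. -/
theorem recursiveIn_haltTime_of_sparse {O : Set (ℕ →. ℕ)} {X Y : ℕ → Bool}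
    (hJ : Nat.RecursiveIn O (charFun (setJoin (sparseSet X) (sparseSet Y))))
    (hinf : ∀ n, ∃ k ≥ n, X k ≠ Y k)
    (hg : ∀ i j, i < j → X i ≠ Y i → X j ≠ Y j → ∀ e ≤ i, haltTime e ≤ j) :
    Nat.RecursiveIn O fun n => Part.some (haltTime n) := by
  classical
  -- The next difference from n on, found by searching with both sequences at hand.
  let d : ℕ → ℕ := fun n => Nat.find (hinf n)
  have hd : ∀ n, n ≤ d n ∧ X (d n) ≠ Y (d n) := fun n => Nat.find_spec (hinf n)
  have heq : Primrec₂ fun a b : ℕ => if a = b then 1 else 0 :=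
    Primrec.ite Primrec.eq (Primrec.const 1) (Primrec.const 0)
  have hdr : Nat.RecursiveIn O fun n => Part.some (d n) := by
    refine recursiveIn_next (recursiveIn_primrec₂ heq (recursiveIn_sparse_left hJ)
      (recursiveIn_sparse_right hJ)) fun n => ⟨(hd n).1, ?_, fun k hk hlt => ?_⟩
    · have h := (hd n).2
      cases hX : X (d n) <;> cases hY : Y (d n) <;> simp_all
    · have h := Nat.find_min (hinf n) hlt
      have : X k = Y k := by
        by_contra hc
        exact h ⟨hk, hc⟩
      simp [this]
  -- d e is a difference at or beyond e, and d (d e + 1) is the one after it, so the gap between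
  -- them bounds the halting time of program e.
  refine recursiveIn_haltTime (q := fun n => d (d n + 1))
    (recursiveIn_comp hdr (recursiveIn_comp (recursiveIn_primrec Primrec.succ) hdr)) fun e => ?_
  exact hg (d e) (d (d e + 1)) (hd _).1 (hd _).2 (hd _).2 e (hd e).1

theorem exists_lfsDegrees_sup_notMem :
    ∃ a b : SetDegree, a ∈ LFSDegrees ∧ b ∈ LFSDegrees ∧ a ⊔ b ∉ LFSDegrees := by
  -- Summing makes the gap function monotone and at least as large as each halting time with number
  -- at most n.
  have hg : Monotone fun n => ∑ e ∈ Finset.range (n + 1), haltTime e := fun m n h =>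
    Finset.sum_le_sum_of_subset (Finset.range_mono (Nat.succ_le_succ h))
  obtain ⟨X, Y, hX, hY, hinf, hfast⟩ := exists_lowForSpeed_pair hg
  refine ⟨degree (sparseSet X), degree (sparseSet Y),
    ⟨_, rfl, by rwa [toLanguage_sparseSet]⟩, ⟨_, rfl, by rwa [toLanguage_sparseSet]⟩, ?_⟩
  rintro ⟨Z, hZ, hlow⟩
  -- Only this half of the equality of degrees is needed: `Z` computes the join.
  have hJ : SetReducible (setJoin (sparseSet X) (sparseSet Y)) Z :=
    (degree_le_degree _ _).1 hZ.ge
  refine not_lowForSpeed_of_recursiveIn (recursiveIn_haltTime_of_sparse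
    (RecursiveIn.iff_nat.1 hJ) hinf fun i j hij hi hj e he => ?_) hlow
  exact (Finset.single_le_sum (f := haltTime) (fun _ _ => Nat.zero_le _)
    (Finset.mem_range.2 (Nat.lt_succ_of_le he))).trans (hfast i j hij hi hj)

end SpeedLow

theorem mainTheorem6 :
    ∃ a b : SetDegree, a ∈ LFSDegrees ∧ b ∈ LFSDegrees ∧ a ⊔ b ∉ LFSDegrees :=
  SpeedLow.exists_lfsDegrees_sup_notMem
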